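/- Let $R$ be a Noetherian commutative ring, $m\ge 0$, $r_1,\dots,r_m\ge 0$, let $\pi\colon \mathbb P=\mathbb P^{r_1}\times\dots\times\mathbb P^{r_m}\to\operatorname{Spec}R$ be the product of projective spaces and $S=R[x_{i,k}: 1\le i\le m,\ 0\le k\le r_i]$ its $\mathbb Z^m$-graded coordinate ring, $\deg x_{i,k}$ being the $i$-th unit vector. For $e\in\mathbb N_0^m$ let $$K_{\le e}^\bullet=\bigotimes_{i=1}^m\operatorname{Kosz}^*\bigl(x_{i,0}^{e_i},\dots,x_{i,r_i}^{e_i}\bigr),$$ where, for homogeneous $f_1,\dots,f_n\in S$ and $F=\bigoplus_i S(-\deg f_i)$, $\operatorname{Kosz}^*(f_1,\dots,f_n)$ is the truncated graded Koszul complex $0\to\bigwedge^nF\to\dots\to\bigwedge^1F\to0$ of contraction with $(f_1,\dots,f_n)$, with $\bigwedge^{1}F$ in degree $0$. Index $K_{\le e}^\bullet$ so that for a graded $S$-module $M$ the module $\operatorname{Hom}(K_{\le e}^j,M)_0$ of degree-preserving $S$-linear maps sits in cohomological degree $j$ (i.e. $K^j_{\le e}$ is the term built from the $\bigwedge^{p_1+1}\otimes\dots\otimes\bigwedge^{p_m+1}$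 with $\sum_i p_i=j$). For $e\le e'$ componentwise there is an inclusion of complexes $\iota\colon\operatorname{Hom}(K_{\le e}^\bullet,M)_0\to\operatorname{Hom}(K_{\le e'}^\bullet,M)_0$ that multiplies the value on a basis element $\bigotimes_i e_{I_i}$, where $e_I=\bigwedge_{k\in I}e_k$, by $\prod_i\prod_{k\in I_i}x_{i,k}^{e'_i-e_i}$, and, for $M$ free, a projection $\pi_{e}^{e'}$ back, which divides by this monomial and forgets remainders. For $\delta\in\mathbb Z^m$ the minimal exponent vector $e_0(-\delta)\in\mathbb N_0^m$ is the least vector $e_0$ such that for all $e_0\le e\le e'$ the endomorphism $\iota\circ\pi_e^{e'}$ of $\operatorname{Hom}(K_{\le e'}^\bullet,S(-\delta))_0$ is homotopic to the identity. Let $M=\bigoplus_{k=1}^b S(-d_k)$ with $d_k\in\mathbb Z^m$, and consider its Čech complex with terms $\varinjlim_{e}\operatorname{Hom}(K_{\le e}^j,M)_0$ and differential $\check\partial$ induced by the Koszul differentials. Let $R^j\pi_*(\widetilde M)$ be the $R$-module given by the $j$-th Čech cohomology of $\widetilde M$ on the covering of $\mathbb P$ by the principal open sets $D(x_{1,k_1}\cdots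 x_{m,k_m})$, the sections of $\widetilde M$ on $D(f)$ being $(M[f^{-1}])_0$. Then the minimal exponent vectors $e_0(-d_k)$ exist, and for every $j\in\mathbb Z$ there is an isomorphism of $R$-modules $$\ker\bigl(\check\partial\text{ on degree }j\bigr)\;\cong\;R^j\pi_*(\widetilde M)\oplus\operatorname{im}\bigl(\check\partial\text{ into degree }j\bigr)$$ which is the identity on $\operatorname{im}\check\partial$. Both summands are free $R$-modules, the first one is finitely generated, and the submodule of $\ker\check\partial$ corresponding to it is contained in (the image of) $\operatorname{Hom}(K_{\le e}^j,M)_0$ for $e$ the componentwise supremum of the $e_0(-d_k)$, $k=1,\dots,b$. -/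

import Mathlib

open MvPolynomial

namespace MultiProj

universe u

noncomputable section

/-! ### The multigraded ring and its free graded modules -/

/-- Index set of the homogeneous coordinates `x_{i,k}`, `0 ≤ k ≤ r i`, of
`ℙ^{r 0} × ⋯ × ℙ^{r (m-1)}`. -/
abbrev Var {m : ℕ} (r : Fin m → ℕ) : Type := Σ i : Fin m, Fin (r i + 1)

/-- The homogeneous coordinate ring `S = R[x_{i,k}]`. -/
abbrev CoordRing (R : Type u) [CommRing R] {m : ℕ} (r : Fin m → ℕ) : Type u :=
  MvPolynomial (Var r) R

/-- The `ℤ^m`-grading of `S`: the variable `x_{i,k}` has degree the `i`-th unit vector. -/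
def varDeg {m : ℕ} (r : Fin m → ℕ) (s : Var r) : Fin m → ℤ := Pi.single s.1 1

/-- The homogeneous part of degree `n` of the free graded module `⨁_c S(-g c)`, whose `c`-th
generator has degree `g c`: vectors whose `c`-th entry is homogeneous of degree `n - g c`. -/
def strand (R : Type u) [CommRing R] {m : ℕ} (r : Fin m → ℕ) {ι : Type} (g : ι → Fin m → ℤ)
    (n : Fin m → ℤ) : Submodule R (ι → CoordRing R r) where
  carrier := {v | ∀ c, IsWeightedHomogeneous (varDeg r) (v c) (n - g c)}
  add_mem' hv hw c := (hv c).add (hw c)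
  zero_mem' _ := isWeightedHomogeneous_zero R _ _
  smul_mem' a _ hv c := (weightedHomogeneousSubmodule R (varDeg r) _).smul_mem a (hv c)

/-! ### The truncated Koszul complexes and their tensor product -/

/-- Basis of the term of the tensor product of the `m` truncated Koszul complexes in cohomological
degree `-j`: a tuple of nonempty subsets `c i = {k_0 < ⋯ < k_p} ⊆ {0, …, r i}`
stands for `⨂_i e_{k_0} ∧ ⋯ ∧ e_{k_p}`, the `i`-th factor sitting in degree `-p = -(#(c i) - 1)`. -/
def Cell {m : ℕ} (r : Fin m → ℕ) (j : ℤ) : Type :=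
  {c : ∀ i, Finset (Fin (r i + 1)) //
    (∀ i, (c i).Nonempty) ∧ ∑ i, (((c i).card : ℤ) - 1) = j}

instance {m : ℕ} (r : Fin m → ℕ) (j : ℤ) : Fintype (Cell r j) := by
  classical
  unfold Cell
  infer_instance

instance {m : ℕ} (r : Fin m → ℕ) (j : ℤ) : DecidableEq (Cell r j) := by
  unfold Cell
  infer_instance

/-- The degree of the generator of `K_{≤ e}` belonging to a cell. -/
def cellDeg {m : ℕ} {r : Fin m → ℕ} (e : Fin m → ℕ) {j : ℤ} (c : Cell r j) : Fin m → ℤ :=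
  fun i => (e i : ℤ) * ((c.1 i).card : ℤ)

/-- The term of `K_{≤ e}` in cohomological degree `-j`. Its grading is
`strand R r (cellDeg e)`. -/
abbrev Kosz (R : Type u) [CommRing R] {m : ℕ} (r : Fin m → ℕ) (j : ℤ) : Type u :=
  Cell r j → CoordRing R r

/-- The sign with which the element `k` of `c i` is contracted: the position of `k` in `c i`
together with the degrees of the tensor factors preceding the `i`-th one. -/
def contractSign {m : ℕ} {r : Fin m → ℕ} (c : ∀ i, Finset (Fin (r i + 1))) (s : Var r) : ℤ :=
  (-1) ^ ((∑ l ∈ Finset.univ.filter (· < s.1), ((c l).card - 1)) +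
    ((c s.1).filter (· < s.2)).card)

/-- Matrix of the differential of
`K_{≤ e} = ⨂_i Kosz^*(x_{i,0}^{e_i}, …, x_{i,r_i}^{e_i})`: the generator of a cell `c` goes to the
signed sum of `x_{i,k}^{e_i}` times the generator of `c` with `k` removed from `c i`. It vanishes
unless `j' = j - 1`. -/
def koszMatrix (R : Type u) [CommRing R] {m : ℕ} (r : Fin m → ℕ) (e : Fin m → ℕ) (j j' : ℤ) :
    Matrix (Cell r j') (Cell r j) (CoordRing R r) :=
  fun c' c => ∑ s : Var r,
    if s.2 ∈ c.1 s.1 ∧ c'.1 = Function.update c.1 s.1 ((c.1 s.1).erase s.2) then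
      (contractSign c.1 s : CoordRing R r) * X s ^ e s.1 else 0

/-- The differential of `K_{≤ e}` from cohomological degree `-j` to `-j'`. -/
def koszD (R : Type u) [CommRing R] {m : ℕ} (r : Fin m → ℕ) (e : Fin m → ℕ) (j j' : ℤ) :
    Kosz R r j →ₗ[CoordRing R r] Kosz R r j' :=
  (koszMatrix R r e j j').mulVecLin

/-- The exponent of the monomial `∏_{i} ∏_{k ∈ c i} x_{i,k}^{a i}`. -/
def cellExp {m : ℕ} {r : Fin m → ℕ} (a : Fin m → ℕ) {j : ℤ} (c : Cell r j) : Var r →₀ ℕ :=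
  Finsupp.equivFunOnFinite.symm fun s => if s.2 ∈ c.1 s.1 then a s.1 else 0

/-- The morphism of complexes `K_{≤ e'} → K_{≤ e}`, for `e ≤ e'`, multiplying the generator of a
cell `c` by `∏_i ∏_{k ∈ c i} x_{i,k}^{e'_i - e_i}`. -/
def koszTrans (R : Type u) [CommRing R] {m : ℕ} (r : Fin m → ℕ) (e e' : Fin m → ℕ) (j : ℤ) :
    Kosz R r j →ₗ[CoordRing R r] Kosz R r j :=
  (Matrix.diagonal fun c : Cell r j =>
    (monomial (cellExp (e' - e) c) 1 : CoordRing R r)).mulVecLin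

/-! ### The strands `Hom(K_{≤ e}^j, M)_0` and their direct limit -/

theorem mulVecLin_mem_strand {R : Type u} [CommRing R] {m : ℕ} {r : Fin m → ℕ}
    {ι κ : Type} [Fintype ι] {g : ι → Fin m → ℤ} {g' : κ → Fin m → ℤ}
    (A : Matrix κ ι (CoordRing R r))
    (hA : ∀ c' c, IsWeightedHomogeneous (varDeg r) (A c' c) (g c - g' c'))
    (n : Fin m → ℤ) (v : ι → CoordRing R r) (hv : v ∈ strand R r g n) :
    A.mulVecLin v ∈ strand R r g' n := by
  intro c'
  rw [Matrix.mulVecLin_apply, Matrix.mulVec, dotProduct]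
  refine IsWeightedHomogeneous.sum _ _ _ fun c _ => ?_
  have := (hA c' c).mul (hv c)
  rwa [show g c - g' c' + (n - g c) = n - g' c' by abel] at this

theorem isWeightedHomogeneous_X_pow (R : Type u) [CommRing R] {m : ℕ} {r : Fin m → ℕ}
    (s : Var r) (k : ℕ) :
    IsWeightedHomogeneous (varDeg r) (X s ^ k : CoordRing R r) (Pi.single s.1 (k : ℤ)) := by
  have h := (isWeightedHomogeneous_X R (varDeg r) s).pow k
  have h2 : k • varDeg r s = Pi.single s.1 (k : ℤ) := by
    ext i
    by_cases hi : i = s.1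
    · subst hi
      simp [varDeg]
    · simp [varDeg, hi]
  rwa [h2] at h

theorem koszD_mem_strand (R : Type u) [CommRing R] {m : ℕ} (r : Fin m → ℕ) (e : Fin m → ℕ)
    (j j' : ℤ) (n : Fin m → ℤ) (v : Kosz R r j)
    (hv : v ∈ strand R r (cellDeg e) n) : koszD R r e j j' v ∈ strand R r (cellDeg e) n := by
  refine mulVecLin_mem_strand _ (fun c' c => ?_) n v hv
  refine IsWeightedHomogeneous.sum _ _ _ fun s _ => ?_
  split_ifs with h
  · obtain ⟨hs, hc⟩ := h
    have h1 := (isWeightedHomogeneous_X_pow R s (e s.1)).C_mul ((contractSign c.1 s : ℤ) : R)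
    have h2 : (Pi.single s.1 (e s.1 : ℤ) : Fin m → ℤ) = cellDeg e c - cellDeg e c' := by
      ext i
      have hpos : 1 ≤ (c.1 s.1).card := Finset.card_pos.mpr ⟨_, hs⟩
      by_cases hi : i = s.1
      · subst hi
        simp only [cellDeg, hc, Pi.sub_apply, Pi.single_eq_same, Function.update_self,
          Finset.card_erase_of_mem hs]
        push_cast [hpos]
        ring
      · simp [cellDeg, hc, hi]
    rw [← h2]
    simpa using h1
  · exact isWeightedHomogeneous_zero R _ _

theorem weight_cellExp {m : ℕ} {r : Fin m → ℕ} (a : Fin m → ℕ) {j : ℤ} (c : Cell r j) :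
    Finsupp.weight (varDeg r) (cellExp a c) = cellDeg a c := by
  rw [Finsupp.weight_apply, Finsupp.sum_fintype _ _ (by simp)]
  ext i
  rw [Finset.sum_apply, ← Finset.univ_sigma_univ, Finset.sum_sigma]
  rw [Finset.sum_eq_single i]
  · simp [cellExp, cellDeg, varDeg, Finset.sum_ite_mem, mul_comm]
  · intro l _ hl
    simp [varDeg, hl.symm]
  · simp

theorem koszTrans_mem_strand (R : Type u) [CommRing R] {m : ℕ} (r : Fin m → ℕ)
    {e e' : Fin m → ℕ} (h : e ≤ e') (j : ℤ) (n : Fin m → ℤ) (v : Kosz R r j)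
    (hv : v ∈ strand R r (cellDeg e') n) : koszTrans R r e e' j v ∈ strand R r (cellDeg e) n := by
  refine mulVecLin_mem_strand _ (fun c' c => ?_) n v hv
  by_cases hc : c' = c
  · subst hc
    rw [Matrix.diagonal_apply_eq]
    refine isWeightedHomogeneous_monomial _ _ _ ?_
    rw [weight_cellExp]
    ext i
    have := h i
    simp only [cellDeg, Pi.sub_apply]
    push_cast [this]
    ring
  · rw [Matrix.diagonal_apply_ne _ hc]
    exact isWeightedHomogeneous_zero R _ _

/-- `Hom(K_{≤ e}^j, M)_0` for `M = ⨁_k S(-d k)`: the `S`-linear maps preserving degrees, as an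
`R`-module. It sits in cohomological degree `j`. -/
def homZero (R : Type u) [CommRing R] {m : ℕ} (r : Fin m → ℕ) {κ : Type} (d : κ → Fin m → ℤ)
    (e : Fin m → ℕ) (j : ℤ) :
    Submodule R (Kosz R r j →ₗ[CoordRing R r] (κ → CoordRing R r)) where
  carrier := {φ | ∀ n, ∀ v ∈ strand R r (cellDeg e) n, φ v ∈ strand R r d n}
  add_mem' hφ hψ n v hv := (strand R r d n).add_mem (hφ n v hv) (hψ n v hv)
  zero_mem' n _ _ := (strand R r d n).zero_mem
  smul_mem' a _ hφ n v hv := (strand R r d n).smul_mem a (hφ n v hv)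

/-- The differential of `Hom(K_{≤ e}, M)_0` from degree `j` to degree `j'`
(zero unless `j' = j + 1`). -/
def homD (R : Type u) [CommRing R] {m : ℕ} (r : Fin m → ℕ) {κ : Type} (d : κ → Fin m → ℤ)
    (e : Fin m → ℕ) (j j' : ℤ) : homZero R r d e j →ₗ[R] homZero R r d e j' where
  toFun φ := ⟨φ.1 ∘ₗ koszD R r e j' j,
    fun n v hv => φ.2 n _ (koszD_mem_strand R r e j' j n v hv)⟩
  map_add' _ _ := rfl
  map_smul' _ _ := rfl

/-- The inclusion `ι : Hom(K_{≤ e}^j, M)_0 → Hom(K_{≤ e'}^j, M)_0` for `e ≤ e'`. -/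
def homIncl (R : Type u) [CommRing R] {m : ℕ} (r : Fin m → ℕ) {κ : Type} (d : κ → Fin m → ℤ)
    (j : ℤ) (e e' : Fin m → ℕ) (h : e ≤ e') : homZero R r d e j →ₗ[R] homZero R r d e' j where
  toFun φ := ⟨φ.1 ∘ₗ koszTrans R r e e' j,
    fun n v hv => φ.2 n _ (koszTrans_mem_strand R r h j n v hv)⟩
  map_add' _ _ := rfl
  map_smul' _ _ := rfl

theorem koszD_koszTrans (R : Type u) [CommRing R] {m : ℕ} (r : Fin m → ℕ)
    {e e' : Fin m → ℕ} (h : e ≤ e') (j j' : ℤ) :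
    koszD R r e j j' ∘ₗ koszTrans R r e e' j = koszTrans R r e e' j' ∘ₗ koszD R r e' j j' := by
  rw [koszD, koszTrans, koszTrans, koszD, ← Matrix.mulVecLin_mul, ← Matrix.mulVecLin_mul]
  congr 1
  ext1 c' c
  rw [Matrix.mul_diagonal, Matrix.diagonal_mul, koszMatrix, koszMatrix, Finset.sum_mul,
    Finset.mul_sum]
  refine Finset.sum_congr rfl fun s _ => ?_
  split_ifs with hs
  · obtain ⟨hs, hc⟩ := hs
    have hexp : Finsupp.single s (e s.1) + cellExp (e' - e) c =
        cellExp (e' - e) c' + Finsupp.single s (e' s.1) := by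
      ext t
      simp only [Finsupp.add_apply, cellExp, Finsupp.equivFunOnFinite_symm_apply_apply, hc,
        Pi.sub_apply]
      have hle := h s.1
      obtain ⟨ti, tk⟩ := t
      obtain ⟨si, sk⟩ := s
      by_cases hti : ti = si
      · subst hti
        by_cases hne : tk = sk
        · subst hne
          simp_all
        · have hts : ¬ (⟨ti, sk⟩ : Var r) = ⟨ti, tk⟩ := fun hh => hne (by simpa using hh.symm)
          simp [hne]
      · have hts : ¬ (⟨si, sk⟩ : Var r) = ⟨ti, tk⟩ := fun hh => hti (congrArg Sigma.fst hh).symm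
        simp [hti]
    have key : (X s ^ e s.1 * monomial (cellExp (e' - e) c) 1 : CoordRing R r) =
        monomial (cellExp (e' - e) c') 1 * X s ^ e' s.1 := by
      rw [X_pow_eq_monomial, X_pow_eq_monomial, monomial_mul, monomial_mul, hexp]
    rw [mul_assoc, key]
    ring
  · simp

theorem homD_homIncl (R : Type u) [CommRing R] {m : ℕ} (r : Fin m → ℕ) {κ : Type}
    (d : κ → Fin m → ℤ) (j j' : ℤ) (e e' : Fin m → ℕ) (h : e ≤ e') :
    homD R r d e' j j' ∘ₗ homIncl R r d j e e' h =
      homIncl R r d j' e e' h ∘ₗ homD R r d e j j' := by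
  ext1 φ
  apply Subtype.ext
  change (φ.1 ∘ₗ koszTrans R r e e' j) ∘ₗ koszD R r e' j' j =
    (φ.1 ∘ₗ koszD R r e j' j) ∘ₗ koszTrans R r e e' j'
  rw [LinearMap.comp_assoc, LinearMap.comp_assoc, koszD_koszTrans R r h]

/-- `lim_{e → ∞} Hom(K_{≤ e}^j, M)_0`, the term of degree `j` of the Čech complex of
`M = ⨁_k S(-d k)`. -/
abbrev CechLim (R : Type u) [CommRing R] {m : ℕ} (r : Fin m → ℕ) {κ : Type} (d : κ → Fin m → ℤ)
    (j : ℤ) : Type u :=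
  Module.DirectLimit (fun e : Fin m → ℕ => homZero R r d e j) (homIncl R r d j)

/-- The canonical map `Hom(K_{≤ e}^j, M)_0 → lim_{e → ∞} Hom(K_{≤ e}^j, M)_0`. -/
abbrev toCechLim (R : Type u) [CommRing R] {m : ℕ} (r : Fin m → ℕ) {κ : Type}
    (d : κ → Fin m → ℤ) (e : Fin m → ℕ) (j : ℤ) : homZero R r d e j →ₗ[R] CechLim R r d j :=
  Module.DirectLimit.of R (Fin m → ℕ) (fun e : Fin m → ℕ => homZero R r d e j)
    (homIncl R r d j) e

/-- The differential `∂̌` of the direct limit from degree `j` to degree `j'`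
(zero unless `j' = j + 1`). -/
def cechLimD (R : Type u) [CommRing R] {m : ℕ} (r : Fin m → ℕ) {κ : Type} (d : κ → Fin m → ℤ)
    (j j' : ℤ) : CechLim R r d j →ₗ[R] CechLim R r d j' :=
  Module.DirectLimit.map (fun e => homD R r d e j j') (homD_homIncl R r d j j')

/-! ### Minimal exponent vectors -/

theorem divMonomial_isWeightedHomogeneous {R : Type u} [CommRing R] {m : ℕ} {r : Fin m → ℕ}
    {p : CoordRing R r} {n : Fin m → ℤ} (hp : IsWeightedHomogeneous (varDeg r) p n)
    (s : Var r →₀ ℕ) :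
    IsWeightedHomogeneous (varDeg r) (p.divMonomial s) (n - Finsupp.weight (varDeg r) s) := by
  intro t ht
  rw [coeff_divMonomial] at ht
  have := hp ht
  rw [map_add] at this
  rw [← this]
  abel

/-- The projection `π : Hom(K_{≤ e'}^j, M)_0 → Hom(K_{≤ e}^j, M)_0` for `e ≤ e'`, left inverse to
the inclusion: the values on the generators are divided by the monomials
`∏_i ∏_{k ∈ c i} x_{i,k}^{e'_i - e_i}`, forgetting remainders. -/
def homProj (R : Type u) [CommRing R] {m : ℕ} (r : Fin m → ℕ) {κ : Type} (d : κ → Fin m → ℤ)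
    (j : ℤ) (e e' : Fin m → ℕ) (h : e ≤ e') : homZero R r d e' j →ₗ[R] homZero R r d e j where
  toFun φ := ⟨Fintype.linearCombination (CoordRing R r) fun (c : Cell r j) k =>
      (φ.1 (Pi.single c 1) k).divMonomial (cellExp (e' - e) c), by
    intro n v hv k
    rw [Fintype.linearCombination_apply, Finset.sum_apply]
    refine IsWeightedHomogeneous.sum _ _ _ fun c _ => ?_
    have h1 : (Pi.single c 1 : Kosz R r j) ∈ strand R r (cellDeg e') (cellDeg e' c) := by
      intro c'
      by_cases hc : c' = c
      · subst hc
        simpa using isWeightedHomogeneous_one R (varDeg r)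
      · simpa [hc] using isWeightedHomogeneous_zero R (varDeg r) _
    have h2 := divMonomial_isWeightedHomogeneous (φ.2 _ _ h1 k) (cellExp (e' - e) c)
    have h3 := (hv c).mul h2
    have h4 : n - cellDeg e c + (cellDeg e' c - d k -
        Finsupp.weight (varDeg r) (cellExp (e' - e) c)) = n - d k := by
      rw [weight_cellExp]
      ext i
      have := h i
      simp only [cellDeg, Pi.sub_apply, Pi.add_apply]
      push_cast [this]
      ring
    rw [h4] at h3
    exact h3⟩
  map_add' φ ψ := by
    apply Subtype.ext
    apply LinearMap.ext
    intro v
    ext1 k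
    simp [Fintype.linearCombination_apply, Finset.sum_apply, add_divMonomial, mul_add,
      Finset.sum_add_distrib]
  map_smul' a φ := by
    apply Subtype.ext
    apply LinearMap.ext
    intro v
    ext1 k
    have hdiv : ∀ (p : CoordRing R r) (s : Var r →₀ ℕ),
        (a • p).divMonomial s = a • p.divMonomial s := by
      intro p s
      ext t
      simp [coeff_divMonomial]
    simp [Fintype.linearCombination_apply, Finset.sum_apply, hdiv, Finset.smul_sum]

/-- `e₀` is large enough for the degree `-δ`: for all `e₀ ≤ e ≤ e'` the endomorphism `ι ∘ π` of the
complex `Hom(K_{≤ e'}, S)_{-δ} = Hom(K_{≤ e'}, S(-δ))_0` is homotopic to the identity,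
`id - ι ∘ π = h ∘ ∂̌ + ∂̌ ∘ h`. -/
def IsExponentBound (R : Type u) [CommRing R] {m : ℕ} (r : Fin m → ℕ) (δ : Fin m → ℤ)
    (e₀ : Fin m → ℕ) : Prop :=
  ∀ (e e' : Fin m → ℕ) (_ : e₀ ≤ e) (hee : e ≤ e'),
    ∃ h : ∀ j j' : ℤ, homZero R r (fun _ : Unit => δ) e' j →ₗ[R]
        homZero R r (fun _ : Unit => δ) e' j',
      ∀ (j : ℤ) (φ : homZero R r (fun _ : Unit => δ) e' j),
        φ - homIncl R r _ j e e' hee (homProj R r _ j e e' hee φ) =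
          h (j + 1) j (homD R r _ e' j (j + 1) φ) + homD R r _ e' (j - 1) j (h j (j - 1) φ)

/-- The minimal exponent vector for the degree `-δ`: the least vector, for the componentwise order,
that is large enough for `-δ`. -/
def IsMinimalExponentVector (R : Type u) [CommRing R] {m : ℕ} (r : Fin m → ℕ) (δ : Fin m → ℤ)
    (e₀ : Fin m → ℕ) : Prop :=
  IsLeast {e | IsExponentBound R r δ e} e₀

/-! ### The higher direct images

`R^jπ_*` of the sheaf `M~` is computed by the alternating Čech complex of `M~` on the covering of
`ℙ^{r 0} × ⋯ × ℙ^{r (m-1)}` by the principal open sets `D(h_v)`, `h_v = ∏_i x_{i, v i}`; the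
sections of `M~` on `D(f)` are the elements of degree zero of `M[f⁻¹]`. -/

/-- Index set of the covering. -/
abbrev Chart {m : ℕ} (r : Fin m → ℕ) : Type := ∀ i : Fin m, Fin (r i + 1)

/-- The equation `∏_{v ∈ J} h_v` of the complement of `⋂_{v ∈ J} D(h_v)`. -/
def chartEq (R : Type u) [CommRing R] {m : ℕ} (r : Fin m → ℕ) (J : Finset (Chart r)) :
    CoordRing R r :=
  ∏ v ∈ J, ∏ i, X ⟨i, v i⟩

/-- `M[f⁻¹]` for `f = ∏_{v ∈ J} h_v` and the free module `M = ⨁_{κ} S`. -/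
abbrev LocMod (R : Type u) [CommRing R] {m : ℕ} (r : Fin m → ℕ) (κ : Type)
    (J : Finset (Chart r)) : Type u :=
  LocalizedModule (Submonoid.powers (chartEq R r J)) (κ → CoordRing R r)

theorem chartEq_isWeightedHomogeneous (R : Type u) [CommRing R] {m : ℕ} (r : Fin m → ℕ)
    (J : Finset (Chart r)) :
    IsWeightedHomogeneous (varDeg r) (chartEq R r J) (fun _ => (J.card : ℤ)) := by
  have h1 : ∀ v : Chart r, IsWeightedHomogeneous (varDeg r)
      (∏ i, X ⟨i, v i⟩ : CoordRing R r) (∑ i, varDeg r ⟨i, v i⟩) := fun v =>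
    IsWeightedHomogeneous.prod _ _ _ fun i _ => isWeightedHomogeneous_X R (varDeg r) _
  have h2 := IsWeightedHomogeneous.prod J _ _ fun v _ => h1 v
  have h3 : (fun _ : Fin m => (J.card : ℤ)) = ∑ v ∈ J, ∑ i, varDeg r ⟨i, v i⟩ := by
    funext i
    simp [varDeg, Finset.sum_apply, Pi.single_apply]
  rw [h3]
  exact h2

theorem smul_mem_strand {R : Type u} [CommRing R] {m : ℕ} {r : Fin m → ℕ} {κ : Type}
    {d : κ → Fin m → ℤ} {p : CoordRing R r} {n n' : Fin m → ℤ}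
    (hp : IsWeightedHomogeneous (varDeg r) p n) {v : κ → CoordRing R r}
    (hv : v ∈ strand R r d n') : p • v ∈ strand R r d (n + n') := by
  intro c
  have := hp.mul (hv c)
  rwa [show n + (n' - d c) = n + n' - d c by abel] at this

/-- The sections `(M[f⁻¹])_0` of `M~` on `⋂_{v ∈ J} D(h_v)`, where `f = ∏_{v ∈ J} h_v` and
`M = ⨁_k S(-d k)`: the fractions `a / f^t` with `a ∈ M` homogeneous of degree
`t • deg f = t • (#J, …, #J)`. -/
def chartSections (R : Type u) [CommRing R] {m : ℕ} (r : Fin m → ℕ) {κ : Type}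
    (d : κ → Fin m → ℤ) (J : Finset (Chart r)) : Submodule R (LocMod R r κ J) where
  carrier := {z | ∃ (t : ℕ) (a : κ → CoordRing R r),
    a ∈ strand R r d (t • fun _ => (J.card : ℤ)) ∧
      z = LocalizedModule.mk a (⟨chartEq R r J ^ t, t, rfl⟩ : Submonoid.powers (chartEq R r J))}
  add_mem' := by
    rintro _ _ ⟨t, a, ha, rfl⟩ ⟨t', a', ha', rfl⟩
    have hf := chartEq_isWeightedHomogeneous R r J
    refine ⟨t + t', chartEq R r J ^ t' • a + chartEq R r J ^ t • a', ?_, ?_⟩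
    · rw [add_smul]
      refine Submodule.add_mem _ ?_ (smul_mem_strand (hf.pow t) ha')
      rw [add_comm]
      exact smul_mem_strand (hf.pow t') ha
    · rw [LocalizedModule.mk_add_mk]
      congr 1
      exact Subtype.ext (pow_add _ _ _).symm
  zero_mem' := ⟨0, 0, Submodule.zero_mem _, (LocalizedModule.zero_mk _).symm⟩
  smul_mem' := by
    rintro b _ ⟨t, a, ha, rfl⟩
    exact ⟨t, b • a, Submodule.smul_mem _ b ha, by rw [LocalizedModule.smul'_mk]⟩

/-- The restriction `M[f⁻¹] → M[f'⁻¹]` for `J ⊆ J'`, `a / f^t ↦ (f' / f)^t a / f'^t`. -/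
def locRes (R : Type u) [CommRing R] {m : ℕ} (r : Fin m → ℕ) (κ : Type)
    {J J' : Finset (Chart r)} (h : J ⊆ J') :
    LocMod R r κ J →ₗ[CoordRing R r] LocMod R r κ J' :=
  LocalizedModule.lift (Submonoid.powers (chartEq R r J))
    (LocalizedModule.mkLinearMap (Submonoid.powers (chartEq R r J')) (κ → CoordRing R r))
    (by
      rintro ⟨_, t, rfl⟩
      have h1 : IsUnit (algebraMap (CoordRing R r)
          (Module.End (CoordRing R r) (LocMod R r κ J')) (chartEq R r J')) :=
        IsLocalizedModule.map_units (LocalizedModule.mkLinearMap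
          (Submonoid.powers (chartEq R r J')) (κ → CoordRing R r))
          (⟨chartEq R r J', Submonoid.mem_powers _⟩ : Submonoid.powers (chartEq R r J'))
      have h2 : chartEq R r J' = chartEq R r J * chartEq R r (J' \ J) := by
        rw [mul_comm]
        exact (Finset.prod_sdiff h).symm
      replace h1 := (congrArg (fun p => IsUnit (algebraMap (CoordRing R r)
          (Module.End (CoordRing R r) (LocMod R r κ J')) p)) h2).mp h1
      rw [map_mul] at h1
      have hc : Commute
          (algebraMap (CoordRing R r) (Module.End (CoordRing R r) (LocMod R r κ J'))
            (chartEq R r J))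
          (algebraMap (CoordRing R r) (Module.End (CoordRing R r) (LocMod R r κ J'))
            (chartEq R r (J' \ J))) := Algebra.commutes _ _
      have h3 := (hc.isUnit_mul_iff.mp h1).1
      simpa using h3.pow t)

theorem locRes_mem (R : Type u) [CommRing R] {m : ℕ} (r : Fin m → ℕ) {κ : Type}
    (d : κ → Fin m → ℤ) {J J' : Finset (Chart r)} (h : J ⊆ J') (z : LocMod R r κ J)
    (hz : z ∈ chartSections R r d J) : locRes R r κ h z ∈ chartSections R r d J' := by
  obtain ⟨t, a, ha, rfl⟩ := hz
  have h2 : chartEq R r J' = chartEq R r J * chartEq R r (J' \ J) := by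
    rw [mul_comm]
    exact (Finset.prod_sdiff h).symm
  refine ⟨t, chartEq R r (J' \ J) ^ t • a, ?_, ?_⟩
  · have h3 := smul_mem_strand ((chartEq_isWeightedHomogeneous R r (J' \ J)).pow t) ha
    rw [← smul_add] at h3
    convert h3 using 3
    funext i
    simp only [Pi.add_apply]
    rw [← Nat.cast_add, Finset.card_sdiff_add_card_eq_card h]
  · rw [locRes, LocalizedModule.lift_mk]
    generalize_proofs h4 h5
    rw [Module.End.algebraMap_isUnit_inv_apply_eq_iff]
    simp only [LocalizedModule.mkLinearMap_apply, LocalizedModule.smul'_mk]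
    rw [smul_smul, ← mul_pow, ← h2]
    exact (LocalizedModule.mk_cancel
      (⟨chartEq R r J' ^ t, t, rfl⟩ : Submonoid.powers (chartEq R r J')) a).symm

/-- `M~(⋂_{v ∈ J} D(h_v))` as an `R`-module. -/
def ChartSec (R : Type u) [CommRing R] {m : ℕ} (r : Fin m → ℕ) {κ : Type}
    (d : κ → Fin m → ℤ) (J : Finset (Chart r)) : Type u :=
  chartSections R r d J

instance (R : Type u) [CommRing R] {m : ℕ} (r : Fin m → ℕ) {κ : Type}
    (d : κ → Fin m → ℤ) (J : Finset (Chart r)) : AddCommGroup (ChartSec R r d J) :=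
  inferInstanceAs (AddCommGroup (chartSections R r d J))

instance (R : Type u) [CommRing R] {m : ℕ} (r : Fin m → ℕ) {κ : Type}
    (d : κ → Fin m → ℤ) (J : Finset (Chart r)) : Module R (ChartSec R r d J) :=
  inferInstanceAs (Module R (chartSections R r d J))

/-- The restriction map of sections of `M~` for `J ⊆ J'`. -/
def chartRes (R : Type u) [CommRing R] {m : ℕ} (r : Fin m → ℕ) {κ : Type}
    (d : κ → Fin m → ℤ) {J J' : Finset (Chart r)} (h : J ⊆ J') :
    ChartSec R r d J →ₗ[R] ChartSec R r d J' :=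
  ((locRes R r κ h).restrictScalars R).restrict (locRes_mem R r d h)

/-- The `(q + 1)`-fold intersections of charts. -/
def ChartCell {m : ℕ} (r : Fin m → ℕ) (q : ℤ) : Type :=
  {J : Finset (Chart r) // J.Nonempty ∧ (J.card : ℤ) = q + 1}

instance {m : ℕ} (r : Fin m → ℕ) (q : ℤ) : Fintype (ChartCell r q) := by
  classical
  unfold ChartCell
  infer_instance

/-- The alternating Čech cochains `Č^q(M~; 𝔘) = ⨁_{#J = q + 1} M~(⋂_{v ∈ J} D(h_v))`. -/
abbrev ChartCochain (R : Type u) [CommRing R] {m : ℕ} (r : Fin m → ℕ) {κ : Type}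
    (d : κ → Fin m → ℤ) (q : ℤ) : Type u :=
  ∀ J : ChartCell r q, ChartSec R r d J.1

open scoped Classical in
/-- The Čech differential from degree `q` to degree `q'` (zero unless `q' = q + 1`),
`(∂ a)_J = ∑_{v ∈ J} (-1)^{position of v in J} a_{J ∖ v}|_J`,
for the lexicographic order of the charts. -/
def chartD (R : Type u) [CommRing R] {m : ℕ} (r : Fin m → ℕ) {κ : Type}
    (d : κ → Fin m → ℤ) (q q' : ℤ) : ChartCochain R r d q →ₗ[R] ChartCochain R r d q' :=
  LinearMap.pi fun J => ∑ J' : ChartCell r q, ∑ v ∈ J.1,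
    if h : J'.1 = J.1.erase v then
      ((-1 : R) ^ (J.1.filter fun w => toLex w < toLex v).card) •
        (chartRes R r d (h.subset.trans (Finset.erase_subset v J.1)) ∘ₗ
          LinearMap.proj (R := R) (φ := fun J : ChartCell r q => ChartSec R r d J.1) J')
    else 0

/-- `R^jπ_*(M~)` for `M = ⨁_k S(-d k)` and `π : ℙ^{r 0} × ⋯ × ℙ^{r (m-1)} → Spec R`, as an
`R`-module: the `j`-th Čech cohomology, cocycles modulo coboundaries. -/
abbrev HigherDirectImage (R : Type u) [CommRing R] {m : ℕ} (r : Fin m → ℕ) {κ : Type}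
    (d : κ → Fin m → ℤ) (j : ℤ) : Type u :=
  LinearMap.ker (chartD R r d j (j + 1)) ⧸
    (LinearMap.range (chartD R r d (j - 1) j)).submoduleOf
      (LinearMap.ker (chartD R r d j (j + 1)))

end

end MultiProj

open MultiProj

/-!
Both complexes of the theorem are direct sums, over the Laurent monomials `x^α` of degree `-d k` in
the `k`-th summand of `M`, of complexes of integral cochains of a purely combinatorial kind. Let `N`
be the set of variables with a negative exponent in `α`.

* In `lim Hom(K_{≤ e}, M)_0`, the monomial occurs at a cell `c` exactly if `c` contains `N`. If the
  value at the generator of `c` is divided by `∏ x_{i,k}^{e i}`, the inclusions `ι` become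
  identities, level `e` consists of the monomials with all exponents at least `-e i`, and `ι ∘ π`
  forgets all other monomials (`homCoeff`, `homCoeff_homIncl`, `homCoeff_homProj`).
* In the Čech complex of the charts, it occurs on the intersection of the charts in `J` exactly if
  the equations of the charts in `J` involve all variables in `N` (`chartCoeff`).

So both summands consist of the cochains of a simplex, whose vertices are the variables or the
charts, that are supported on an upper set `W` of faces. Over the integers these complexes split
into a contractible complex and at most one copy of `ℤ` (`HasSplit`). If some block of variables
contains both negative and nonnegative exponents, the complex of cells is contracted by a vertex not
in `N`. Otherwise the monomial is critical, and the cohomology is `ℤ`, in degree `∑ r i` over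
the blocks in `N`, for the cells as for the charts (`hasSplit_cellFamily`,
`hasSplit_chartFamily`). Both follow from `HasSplit.of_union`, which is the connecting isomorphism: if
the cochains on `W₁ ∪ W₂` are contractible, those on `W₁` split like those on `W₂`, one degree higher.

In critical monomials the exponents of a block have the same sign, hence their absolute values are
bounded by `|d k i|` (`IsCritical.abs_le`), and there are finitely many of them. This gives the
splitting of the cocycles into coboundaries and the free finite module on the critical monomials of
the right degree, which is the cohomology of both complexes (`exists_cohomology_splitting`,
`exists_splitting_of_equiv_cochains`). The coboundaries are free because `d H`, for the homotopy
`H`, is an idempotent integral matrix at each monomial, so that its image is free over `ℤ` and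
stays so after base change to `R` (`free_map_bigD`).

Finally, `ι ∘ π` is homotopic to the identity if and only if the monomials it forgets are not
critical (`BoundsPoles.isExponentBound`, `IsExponentBound.boundsPoles`; over the zero ring every
vector is a bound). Hence the minimal exponent vectors exist, and their supremum is a level that
contains all critical monomials, in particular the complement of the coboundaries.
-/

namespace MultiProj

open Matrix

/-! ### Split complexes of cochains on a family of finite sets -/

/-- Signs `ε(c, s)` for which `f ↦ (c ↦ ∑_{s ∈ c} ε(c, s) f(c ∖ s))` is the coboundary of a
simplex with vertex set `V`, and for which adding a vertex contracts it. -/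
structure ContractionSign (V : Type) [DecidableEq V] where
  sign : Finset V → V → ℤ
  mul_self : ∀ c s, sign c s * sign c s = 1
  sign_erase : ∀ c s, sign (c.erase s) s = sign c s
  anti : ∀ c s t, t ∈ c → s ∉ c →
    sign c s * sign (insert s c) t = -(sign c t * sign (c.erase t) s)

/-- The signs given by the position of a vertex in a set, for the order induced by an injection
`ρ` into a linear order, twisted by signs `η` attached to the vertices. -/
def ContractionSign.ofOrder {V L : Type} [DecidableEq V] [LinearOrder L] (ρ : V → L)
    (hρ : Function.Injective ρ) (η : V → ℤ) (hη : ∀ s, η s * η s = 1) : ContractionSign V where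
  sign c s := η s * (-1) ^ (c.filter fun t => ρ t < ρ s).card
  mul_self c s := by
    rw [mul_mul_mul_comm, hη, ← pow_add, ← two_mul, pow_mul]
    simp
  sign_erase c s := by
    congr 3
    ext t
    simp only [Finset.mem_filter, Finset.mem_erase]
    exact ⟨fun h => ⟨h.1.2, h.2⟩, fun h => ⟨⟨fun e => absurd h.2 (by simp [e]), h.1⟩, h.2⟩⟩
  anti c s t ht hs := by
    have hst : s ≠ t := fun e => hs (e ▸ ht)
    have key : (-1 : ℤ) ^ (c.filter fun a => ρ a < ρ s).card *
        (-1) ^ ((insert s c).filter fun a => ρ a < ρ t).card =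
        -((-1) ^ (c.filter fun a => ρ a < ρ t).card *
          (-1) ^ ((c.erase t).filter fun a => ρ a < ρ s).card) := by
      rw [Finset.filter_insert, Finset.filter_erase]
      rcases lt_or_gt_of_ne (hρ.ne hst) with h | h
      · rw [if_pos h, Finset.card_insert_of_notMem (by simp [hs]),
          Finset.erase_eq_of_notMem (by simp [h.le]), pow_succ]
        ring
      · rw [if_neg h.not_gt]
        have h1 : t ∈ c.filter fun a => ρ a < ρ s := by simp [ht, h]
        rw [← Finset.card_erase_add_one h1, pow_succ]
        ring
    linear_combination (η s * η t) * key

section Split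

variable {V : Type} [Fintype V] [DecidableEq V] (ε : ContractionSign V)

/-- The coboundary of the full simplex on `V`, the empty face included. -/
def cobd : Matrix (Finset V) (Finset V) ℤ :=
  fun c c' => ∑ s ∈ c, if c.erase s = c' then ε.sign c s else 0

/-- The contraction of the full simplex with the vertex `s`. -/
def coneOp (s : V) : Matrix (Finset V) (Finset V) ℤ :=
  fun c c' => if s ∉ c ∧ insert s c = c' then ε.sign c s else 0

theorem cobd_map_mulVec {R : Type*} [CommRing R] (f : Finset V → R) (c : Finset V) :
    ((cobd ε).map (Int.cast : ℤ → R) *ᵥ f) c = ∑ s ∈ c, (ε.sign c s : R) * f (c.erase s) := by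
  simp only [mulVec, dotProduct, Matrix.map_apply, cobd, Int.cast_sum, Finset.sum_mul]
  rw [Finset.sum_comm]
  refine Finset.sum_congr rfl fun s _ => ?_
  rw [Finset.sum_eq_single (c.erase s)]
  · simp
  · intro b _ hb
    simp [hb.symm]
  · simp

theorem cobd_mulVec (f : Finset V → ℤ) (c : Finset V) :
    (cobd ε *ᵥ f) c = ∑ s ∈ c, ε.sign c s * f (c.erase s) := by
  have h : (cobd ε).map (Int.cast : ℤ → ℤ) = cobd ε := by
    ext
    simp
  have := cobd_map_mulVec ε f c
  rw [h] at this
  simpa using this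

theorem coneOp_mulVec (s : V) (f : Finset V → ℤ) (c : Finset V) :
    (coneOp ε s *ᵥ f) c = if s ∉ c then ε.sign c s * f (insert s c) else 0 := by
  simp only [mulVec, dotProduct, coneOp]
  rw [Finset.sum_eq_single (insert s c)]
  · by_cases h : s ∈ c <;> simp [h]
  · intro b _ hb
    simp [hb.symm]
  · simp

theorem cobd_coneOp (s : V) : cobd ε * coneOp ε s + coneOp ε s * cobd ε = 1 := by
  refine Matrix.mulVec_injective (funext fun f => funext fun c => ?_)
  rw [Matrix.add_mulVec, ← Matrix.mulVec_mulVec, ← Matrix.mulVec_mulVec, Pi.add_apply,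
    cobd_mulVec, coneOp_mulVec, Matrix.one_mulVec]
  simp only [coneOp_mulVec, cobd_mulVec]
  by_cases hs : s ∈ c
  · rw [if_neg (by simpa using hs), Finset.sum_eq_single s]
    · rw [if_pos (by simp), Finset.insert_erase hs, ε.sign_erase, ← mul_assoc, ε.mul_self]
      ring
    · intro t _ hts
      rw [if_neg (by simp [hs, hts.symm])]
      ring
    · simp [hs]
  · rw [if_pos hs, Finset.sum_insert hs, Finset.erase_insert hs, mul_add, ← mul_assoc,
      ← ε.sign_erase (insert s c), Finset.erase_insert hs, ε.mul_self, one_mul, Finset.mul_sum,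
      add_comm, add_assoc, ← Finset.sum_add_distrib, Finset.sum_eq_zero, add_zero]
    intro t ht
    have hst : s ≠ t := fun e => hs (e ▸ ht)
    rw [if_pos (by simp [hs]), ← mul_assoc, ε.anti c s t ht hs, Finset.erase_insert_of_ne hst]
    ring

theorem cobd_sq : cobd ε * cobd ε = 0 := by
  refine Matrix.mulVec_injective (funext fun f => funext fun c => ?_)
  rw [Matrix.zero_mulVec, Pi.zero_apply]
  induction c using Finset.induction_on generalizing f with
  | empty => rw [← Matrix.mulVec_mulVec, cobd_mulVec, Finset.sum_empty]
  | insert s c hs ih =>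
    -- the square of the coboundary commutes with every contraction
    have hc : coneOp ε s * (cobd ε * cobd ε) = cobd ε * cobd ε * coneOp ε s := by
      have h := cobd_coneOp ε s
      have h1 : coneOp ε s * cobd ε = 1 - cobd ε * coneOp ε s := eq_sub_of_add_eq' h
      have h2 : cobd ε * coneOp ε s = 1 - coneOp ε s * cobd ε := eq_sub_of_add_eq h
      rw [← mul_assoc, h1, sub_mul, one_mul, mul_assoc, h1, mul_sub, mul_one, sub_sub_cancel,
        mul_assoc]
    have h1 : (coneOp ε s *ᵥ ((cobd ε * cobd ε) *ᵥ f)) c = 0 := by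
      rw [Matrix.mulVec_mulVec, hc, ← Matrix.mulVec_mulVec]
      exact ih _
    rw [coneOp_mulVec, if_pos hs] at h1
    have h2 := congrArg (fun z => ε.sign c s * z) h1
    simpa [← mul_assoc, ε.mul_self] using h2

end Split

section

variable {V : Type} [DecidableEq V] (ε : ContractionSign V)

theorem cobd_apply_ne_zero {c c' : Finset V} (h : cobd ε c c' ≠ 0) :
    c' ⊆ c ∧ c.card = c'.card + 1 := by
  obtain ⟨s, hs, h1⟩ := Finset.exists_ne_zero_of_sum_ne_zero h
  have h2 : c.erase s = c' := by
    by_contra hne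
    exact h1 (if_neg hne)
  subst h2
  exact ⟨Finset.erase_subset s c, (Finset.card_erase_add_one hs).symm⟩

end

/-- Matrices that raise the number of elements of a set by `k`. -/
def RaisesCard {V : Type} (A : Matrix (Finset V) (Finset V) ℤ) (k : ℤ) : Prop :=
  ∀ c c', A c c' ≠ 0 → (c.card : ℤ) = c'.card + k

theorem RaisesCard.mul {V : Type} [Fintype V] {A B : Matrix (Finset V) (Finset V) ℤ} {k l : ℤ}
    (hA : RaisesCard A k) (hB : RaisesCard B l) : RaisesCard (A * B) (k + l) := by
  intro c c' h
  obtain ⟨a, _, ha⟩ := Finset.exists_ne_zero_of_sum_ne_zero h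
  have h1 := hA c a (left_ne_zero_of_mul ha)
  have h2 := hB a c' (right_ne_zero_of_mul ha)
  omega

theorem RaisesCard.sub {V : Type} {A B : Matrix (Finset V) (Finset V) ℤ} {k : ℤ}
    (hA : RaisesCard A k) (hB : RaisesCard B k) : RaisesCard (A - B) k := by
  intro c c' h
  by_cases h1 : A c c' = 0
  · exact hB c c' fun h2 => h (by simp [h1, h2])
  · exact hA c c' h1

theorem raisesCard_diagonal {V : Type} [DecidableEq V] (w : Finset V → ℤ) :
    RaisesCard (Matrix.diagonal w) 0 := by
  intro c c' h
  by_cases hc : c = c'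
  · simp [hc]
  · exact absurd (Matrix.diagonal_apply_ne _ hc) h

theorem raisesCard_cobd {V : Type} [DecidableEq V] (ε : ContractionSign V) :
    RaisesCard (cobd ε) 1 := by
  intro c c' h
  have := (cobd_apply_ne_zero ε h).2
  omega

theorem raisesCard_coneOp {V : Type} [DecidableEq V] (ε : ContractionSign V) (s : V) :
    RaisesCard (coneOp ε s) (-1) := by
  intro c c' h
  have h1 : s ∉ c ∧ insert s c = c' := by
    by_contra hne
    exact h (if_neg hne)
  rw [← h1.2, Finset.card_insert_of_notMem h1.1]
  push_cast
  ring

open scoped Classical in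
/-- The projection to the cochains supported on `W`. -/
noncomputable def indMat {V : Type} [DecidableEq V] (W : Set (Finset V)) :
    Matrix (Finset V) (Finset V) ℤ :=
  Matrix.diagonal fun c => if c ∈ W then 1 else 0

theorem raisesCard_indMat {V : Type} [DecidableEq V] (W : Set (Finset V)) :
    RaisesCard (indMat W) 0 := raisesCard_diagonal _

theorem indMat_union {V : Type} [DecidableEq V] {W W' : Set (Finset V)} (h : Disjoint W W') :
    indMat (W ∪ W') = indMat W + indMat W' := by
  rw [indMat, indMat, indMat, Matrix.diagonal_add]
  congr 1
  funext c
  by_cases h1 : c ∈ W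
  · simp [h1, Set.disjoint_left.mp h h1]
  · by_cases h2 : c ∈ W' <;> simp [h1, h2]

section Split

variable {V : Type} [Fintype V] [DecidableEq V] (ε : ContractionSign V)

theorem indMat_mul_self (W : Set (Finset V)) : indMat W * indMat W = indMat W := by
  rw [indMat, Matrix.diagonal_mul_diagonal]
  congr 1
  funext c
  split_ifs <;> simp

theorem indMat_mul_of_disjoint {W W' : Set (Finset V)} (h : Disjoint W W') :
    indMat W * indMat W' = 0 := by
  rw [indMat, indMat, Matrix.diagonal_mul_diagonal, ← Matrix.diagonal_zero]
  congr 1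
  funext c
  by_cases h1 : c ∈ W
  · simp [h1, Set.disjoint_left.mp h h1]
  · simp [h1]

theorem indMat_mul_mul_apply (W W' : Set (Finset V)) (A : Matrix (Finset V) (Finset V) ℤ)
    (c c' : Finset V) [Decidable (c ∈ W)] [Decidable (c' ∈ W')] :
    (indMat W * A * indMat W') c c' = if c ∈ W ∧ c' ∈ W' then A c c' else 0 := by
  rw [indMat, indMat, Matrix.mul_diagonal, Matrix.diagonal_mul]
  by_cases h1 : c ∈ W <;> by_cases h2 : c' ∈ W' <;> simp [h1, h2]

/-- The coboundary of the cochains supported on `W`. -/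
noncomputable def cobdOn (W : Set (Finset V)) : Matrix (Finset V) (Finset V) ℤ :=
  indMat W * cobd ε * indMat W

theorem raisesCard_cobdOn (W : Set (Finset V)) : RaisesCard (cobdOn ε W) 1 :=
  ((raisesCard_diagonal _).mul (raisesCard_cobd ε)).mul (raisesCard_diagonal _)

theorem cobdOn_of_subset {W W' : Set (Finset V)} (h : W' ⊆ W) :
    cobdOn ε W' = indMat W' * cobdOn ε W * indMat W' := by
  classical
  ext a b
  rw [indMat_mul_mul_apply, cobdOn, cobdOn, indMat_mul_mul_apply, indMat_mul_mul_apply]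
  by_cases h1 : a ∈ W' ∧ b ∈ W'
  · rw [if_pos h1, if_pos h1, if_pos ⟨h h1.1, h h1.2⟩]
  · rw [if_neg h1, if_neg h1]

/-- Cochains supported on an order-connected family form a complex: the complement of an upper set
in an upper set. -/
theorem cobdOn_sq {W : Set (Finset V)} (hW : W.OrdConnected) :
    cobdOn ε W * cobdOn ε W = 0 := by
  classical
  have h : indMat W * (cobd ε * indMat W * cobd ε) * indMat W =
      indMat W * (cobd ε * cobd ε) * indMat W := by
    ext a b
    rw [indMat_mul_mul_apply, indMat_mul_mul_apply]
    split_ifs with hab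
    · rw [Matrix.mul_apply, Matrix.mul_apply]
      refine Finset.sum_congr rfl fun c _ => ?_
      rw [indMat, Matrix.mul_diagonal]
      by_cases h0 : cobd ε a c * cobd ε c b = 0
      · rw [mul_right_comm, h0, zero_mul]
      · have h1 := (cobd_apply_ne_zero ε (left_ne_zero_of_mul h0)).1
        have h2 := (cobd_apply_ne_zero ε (right_ne_zero_of_mul h0)).1
        rw [if_pos (hW.out hab.2 hab.1 ⟨h2, h1⟩), mul_one]
    · rfl
  have h2 : cobdOn ε W * cobdOn ε W = indMat W * (cobd ε * (indMat W * indMat W) * cobd ε) *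
      indMat W := by
    simp only [cobdOn, mul_assoc]
  rw [h2, indMat_mul_self, h, cobd_sq]
  simp

/-- The complex of cochains supported on `W` splits, over the integers, into a contractible complex
and the cohomology, which is zero if `p` fails, and `ℤ`, generated by a cochain `u` supported on
sets with `n` elements, if `p` holds. The projection to the cohomology is given by `v`. -/
def HasSplit (W : Set (Finset V)) (p : Prop) (n : ℕ) : Prop :=
  ∃ (H : Matrix (Finset V) (Finset V) ℤ) (u v : Finset V → ℤ),
    RaisesCard H (-1) ∧ indMat W * H * indMat W = H ∧
    (∀ c, u c ≠ 0 → c ∈ W ∧ c.card = n) ∧ (∀ c, v c ≠ 0 → c ∈ W ∧ c.card = n) ∧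
    cobdOn ε W * H + H * cobdOn ε W = indMat W - vecMulVec u v ∧
    cobdOn ε W *ᵥ u = 0 ∧ v ᵥ* cobdOn ε W = 0 ∧ (p → v ⬝ᵥ u = 1) ∧ (¬ p → u = 0)

end Split

/-- The algebra behind the long exact sequence of a subcomplex, with projection `x`, and its
complement, with projection `y`, in a complex contracted by `b`: the blocks of the identities
`d b + b d = 1` and `d d = 0`. -/
theorem contraction_sub {A : Type*} [Ring A] {x y d b : A} (hx : x * x = x) (hy : y * y = y)
    (hxy : x * y = 0) (hyx : y * x = 0) (hl : (x + y) * d = d) (hr : d * (x + y) = d)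
    (hd : y * d * x = 0) (hdd : d * d = 0) (hb : d * b + b * d = x + y) :
    x * d * x * (x * b * x) + x * d * y * (y * b * x) + x * b * x * (x * d * x) = x ∧
    y * d * y * (y * b * x) + y * b * x * (x * d * x) = 0 ∧
    y * d * y * (y * b * y) + y * b * x * (x * d * y) + y * b * y * (y * d * y) = y ∧
    x * d * x * (x * d * y) + x * d * y * (y * d * y) = 0 := by
  have hx' : ∀ z, x * (x * z) = x * z := fun z => by rw [← mul_assoc, hx]
  have hy' : ∀ z, y * (y * z) = y * z := fun z => by rw [← mul_assoc, hy]
  have hd0 : y * (d * x) = 0 := by rw [← mul_assoc, hd]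
  have hd1 : ∀ z, y * (d * (x * z)) = 0 := fun z => by
    rw [← mul_assoc d, ← mul_assoc, hd0, zero_mul]
  have key : ∀ p q, p * (d * (x * (b * q))) + p * (d * (y * (b * q))) +
      (p * (b * (x * (d * q))) + p * (b * (y * (d * q)))) = p * x * q + p * y * q := by
    intro p q
    have h := congrArg (fun z => p * z * q) hb
    have h1 : d * b = d * (x * b) + d * (y * b) := by
      nth_rewrite 1 [← hr]; noncomm_ring
    have h2 : b * d = b * (x * d) + b * (y * d) := by
      nth_rewrite 1 [← hl]; noncomm_ring
    simp only [h1, h2] at h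
    rw [mul_add, add_mul, mul_add, mul_add, add_mul, add_mul, mul_add, add_mul] at h
    simpa only [mul_assoc] using h
  have h11 := key x x
  have h21 := key y x
  have h22 := key y y
  simp only [mul_assoc, hx', hy', hx, hy, hxy, hyx, hd0, hd1, mul_zero, zero_mul, add_zero,
    zero_add] at h11 h21 h22 ⊢
  have hdd1 : x * (d * (x * (d * y))) + x * (d * (y * (d * y))) = 0 := by
    have h : x * (d * (x + y) * d) * y = 0 := by rw [hr, hdd]; simp
    rw [← h]; noncomm_ring
  refine ⟨?_, h21, ?_, hdd1⟩
  · exact h11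
  · rw [add_assoc]
    exact h22

/-- The homotopy of the subcomplex: `γ` fails to contract it by `δ β`, which passes through the
quotient complex, and a homotopy `H` there from the identity to `P` corrects it. -/
theorem contraction_correct {A : Type*} [Ring A] {x y d₁ d₂ δ β γ H P : A}
    (h₁ : d₁ * γ + δ * β + γ * d₁ = x) (hδ : d₁ * δ = -(δ * d₂)) (hβ : β * d₁ = -(d₂ * β))
    (hH : d₂ * H + H * d₂ = y - P) (hy : y * β = β) :
    d₁ * (γ - δ * H * β) + (γ - δ * H * β) * d₁ = x - δ * (P * β) := by
  have h₂ : δ * (d₂ * H + H * d₂) * β = δ * β - δ * (P * β) := by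
    rw [hH, mul_sub, sub_mul, mul_assoc δ y, hy, mul_assoc]
  have h₃ : d₁ * (δ * H * β) = -(δ * (d₂ * H) * β) := by
    rw [← mul_assoc, ← mul_assoc, hδ]
    noncomm_ring
  have h₄ : δ * H * β * d₁ = -(δ * (H * d₂) * β) := by
    rw [mul_assoc, hβ]
    noncomm_ring
  rw [mul_sub, sub_mul, h₃, h₄, ← h₁, sub_neg_eq_add, sub_neg_eq_add,
    show δ * (P * β) = δ * β - δ * (d₂ * H + H * d₂) * β by rw [h₂]; abel, mul_add, add_mul]
  abel

section Split

variable {V : Type} [Fintype V] [DecidableEq V] {ε : ContractionSign V}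

/-- If membership in `W` does not depend on the vertex `s`, the contraction with `s` contracts the
cochains supported on `W`. -/
theorem hasSplit_of_cone {W : Set (Finset V)} (s : V) (h1 : ∀ c ∈ W, insert s c ∈ W)
    (h2 : ∀ c ∈ W, c.erase s ∈ W) (n : ℕ) : HasSplit ε W False n := by
  classical
  have hmem : ∀ c, insert s c ∈ W ↔ c ∈ W := by
    refine fun c => ⟨fun h => ?_, h1 c⟩
    by_cases hs : s ∈ c
    · rwa [Finset.insert_eq_of_mem hs] at h
    · have := h2 _ h
      rwa [Finset.erase_insert hs] at this
  -- the contraction commutes with the projection to the cochains supported on `W`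
  have hcomm : coneOp ε s * indMat W = indMat W * coneOp ε s := by
    ext c c'
    rw [indMat, Matrix.mul_diagonal, Matrix.diagonal_mul, coneOp]
    by_cases h : s ∉ c ∧ insert s c = c'
    · rw [← h.2]
      simp only [hmem]
      ring
    · rw [if_neg h]
      simp
  have hX := indMat_mul_self W
  have hX' : ∀ Z, indMat W * (indMat W * Z) = indMat W * Z := fun Z => by rw [← mul_assoc, hX]
  have hc' : ∀ Z, coneOp ε s * (indMat W * Z) = indMat W * (coneOp ε s * Z) := fun Z => by
    rw [← mul_assoc, hcomm, mul_assoc]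
  refine ⟨indMat W * coneOp ε s * indMat W, 0, 0, ?_, ?_, by simp, by simp, ?_, by simp, by simp,
    by simp, by simp⟩
  · simpa using ((raisesCard_indMat W).mul (raisesCard_coneOp ε s)).mul (raisesCard_indMat W)
  · simp only [mul_assoc, hX, hX']
  · have h := congrArg (fun Z => indMat W * Z * indMat W) (cobd_coneOp ε s)
    simp only [mul_add, add_mul, mul_one, mul_assoc, hX] at h
    simp only [cobdOn, mul_assoc, hX', hc', hcomm, Matrix.vecMulVec_zero, sub_zero]
    simp only [hcomm] at h
    exact h

/-- A family with a single member has its cohomology spanned by that member. -/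
theorem hasSplit_singleton (c : Finset V) (p : Prop) (hp : p) :
    HasSplit ε {c} p c.card := by
  classical
  have hd : cobdOn ε {c} = 0 := by
    ext a b
    rw [cobdOn, indMat_mul_mul_apply]
    split_ifs with h
    · by_contra h0
      have := (cobd_apply_ne_zero ε h0).2
      rw [Set.mem_singleton_iff] at h
      rw [h.1, h.2] at this
      omega
    · rfl
  refine ⟨0, Pi.single c 1, Pi.single c 1, ?_, by simp, ?_, ?_, ?_,
    by rw [hd, Matrix.zero_mulVec], by rw [hd, Matrix.vecMul_zero], by simp, fun h => absurd hp h⟩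
  · intro a b h
    simp at h
  · intro a ha
    by_cases h : a = c
    · simp [h]
    · simp [h] at ha
  · intro a ha
    by_cases h : a = c
    · simp [h]
    · simp [h] at ha
  · rw [hd, zero_mul, add_zero, eq_comm, sub_eq_zero]
    ext a b
    rw [indMat, Matrix.vecMulVec_apply]
    by_cases ha : a = c
    · by_cases hb : b = c
      · simp [ha, hb]
      · simp [ha, hb, Matrix.diagonal_apply_ne _ (Ne.symm hb)]
    · by_cases hab : a = b
      · subst hab
        simp [ha]
      · simp [ha, Matrix.diagonal_apply_ne _ hab]

theorem hasSplit_empty (n : ℕ) : HasSplit ε ∅ False n := by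
  have h : indMat (∅ : Set (Finset V)) = 0 := by
    simp [indMat]
  refine ⟨0, 0, 0, ?_, by simp, by simp, by simp, by simp [cobdOn, h], by simp, by simp, by simp,
    by simp⟩
  intro a b hab
  simp at hab

/-- The connecting isomorphism: if the cochains supported on `W₁ ∪ W₂` are contractible, those
supported on `W₁`, a subcomplex, split like those supported on `W₂`, one degree higher. -/
theorem HasSplit.of_union {W₁ W₂ : Set (Finset V)} {p : Prop} {n : ℕ}
    (hdisj : Disjoint W₁ W₂) (hup : ∀ a ∈ W₁, ∀ c ∈ W₂, ¬ a ⊆ c)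
    (hconn : (W₁ ∪ W₂).OrdConnected) {k : ℕ} (h : HasSplit ε (W₁ ∪ W₂) False k)
    (h₂ : HasSplit ε W₂ p n) : HasSplit ε W₁ p (n + 1) := by
  classical
  obtain ⟨b, u', v', hbdeg, -, -, -, hb, -, -, -, hu'⟩ := h
  rw [hu' not_false, Matrix.zero_vecMulVec, sub_zero] at hb
  obtain ⟨H, u, v, hHdeg, hHW, hu, hv, hH, hdu, hvd, hp, hnp⟩ := h₂
  have hx := indMat_mul_self W₁
  have hy := indMat_mul_self W₂
  have hxy := indMat_mul_of_disjoint hdisj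
  have hyx := indMat_mul_of_disjoint hdisj.symm
  have hsum := indMat_union hdisj
  have hdd := cobdOn_sq ε hconn
  have hl : (indMat W₁ + indMat W₂) * cobdOn ε (W₁ ∪ W₂) = cobdOn ε (W₁ ∪ W₂) := by
    rw [← hsum, cobdOn, mul_assoc, ← mul_assoc (indMat _) (indMat _), indMat_mul_self]
  have hr : cobdOn ε (W₁ ∪ W₂) * (indMat W₁ + indMat W₂) = cobdOn ε (W₁ ∪ W₂) := by
    rw [← hsum, cobdOn, mul_assoc, indMat_mul_self]
  have hd : indMat W₂ * cobdOn ε (W₁ ∪ W₂) * indMat W₁ = 0 := by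
    ext a c
    rw [indMat_mul_mul_apply, cobdOn, indMat_mul_mul_apply]
    split_ifs with h1 h2
    · by_contra h0
      exact hup _ h1.2 _ h1.1 (cobd_apply_ne_zero ε h0).1
    · rfl
    · rfl
  have h1 : cobdOn ε W₁ = indMat W₁ * cobdOn ε (W₁ ∪ W₂) * indMat W₁ :=
    cobdOn_of_subset ε Set.subset_union_left
  have h2 : cobdOn ε W₂ = indMat W₂ * cobdOn ε (W₁ ∪ W₂) * indMat W₂ :=
    cobdOn_of_subset ε Set.subset_union_right
  obtain ⟨e11, e21, e22, edd⟩ := contraction_sub hx hy hxy hyx hl hr hd hdd (hsum ▸ hb)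
  rw [← h1] at e11 e21 edd
  rw [← h2] at e21 e22 edd
  have hddeg := raisesCard_cobdOn ε (W₁ ∪ W₂)
  set D := cobdOn ε (W₁ ∪ W₂) with hD
  have hxdeg : RaisesCard (indMat W₁) 0 := raisesCard_indMat _
  have hydeg : RaisesCard (indMat W₂) 0 := raisesCard_indMat _
  have hδdeg : RaisesCard (indMat W₁ * D * indMat W₂) 1 := by
    simpa using (hxdeg.mul hddeg).mul hydeg
  have hb21deg : RaisesCard (indMat W₂ * b * indMat W₁) (-1) := by
    simpa using (hydeg.mul hbdeg).mul hxdeg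
  have hxδ : indMat W₁ * (indMat W₁ * D * indMat W₂) = indMat W₁ * D * indMat W₂ := by
    rw [← mul_assoc, ← mul_assoc, hx]
  have hbx : indMat W₂ * b * indMat W₁ * indMat W₁ = indMat W₂ * b * indMat W₁ := by
    rw [mul_assoc, hx]
  have hxb : indMat W₁ * (indMat W₁ * b * indMat W₁) * indMat W₁ = indMat W₁ * b * indMat W₁ := by
    rw [← mul_assoc, ← mul_assoc, hx, mul_assoc, hx]
  have hb11deg : RaisesCard (indMat W₁ * b * indMat W₁) (-1) := by
    simpa using (hxdeg.mul hbdeg).mul hxdeg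
  set δ := indMat W₁ * D * indMat W₂ with hδ
  set β := indMat W₂ * b * indMat W₁ with hβ
  set γ := indMat W₁ * b * indMat W₁ with hγ
  clear_value δ β γ D
  refine ⟨γ - δ * H * β, δ *ᵥ u, v ᵥ* β, ?_, ?_, ?_, ?_, ?_, ?_, ?_, ?_, ?_⟩
  · refine hb11deg.sub ?_
    simpa using (hδdeg.mul hHdeg).mul hb21deg
  · rw [mul_sub, sub_mul, hxb]
    congr 1
    rw [← mul_assoc, ← mul_assoc, hxδ, mul_assoc, hbx]
  · intro c hc
    have hcW : c ∈ W₁ := by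
      rw [← hxδ, ← Matrix.mulVec_mulVec, indMat, Matrix.mulVec_diagonal] at hc
      by_contra h0
      exact hc (by simp [h0])
    obtain ⟨a, _, ha⟩ := Finset.exists_ne_zero_of_sum_ne_zero hc
    have e1 := hδdeg _ _ (left_ne_zero_of_mul ha)
    have e2 := (hu _ (right_ne_zero_of_mul ha)).2
    exact ⟨hcW, by omega⟩
  · intro c hc
    have hcW : c ∈ W₁ := by
      rw [← hbx, ← Matrix.vecMul_vecMul, indMat, Matrix.vecMul_diagonal] at hc
      by_contra h0
      exact hc (by simp [h0])
    obtain ⟨a, _, ha⟩ := Finset.exists_ne_zero_of_sum_ne_zero hc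
    have e1 := hb21deg _ _ (right_ne_zero_of_mul ha)
    have e2 := (hv _ (left_ne_zero_of_mul ha)).2
    exact ⟨hcW, by omega⟩
  · have e3 : cobdOn ε W₁ * δ = -(δ * cobdOn ε W₂) := eq_neg_of_add_eq_zero_left edd
    have e4 : β * cobdOn ε W₁ = -(cobdOn ε W₂ * β) := eq_neg_of_add_eq_zero_right e21
    have hyβ : indMat W₂ * β = β := by
      simp only [hβ, ← mul_assoc, hy]
    rw [← Matrix.mul_vecMulVec, ← Matrix.vecMulVec_mul]
    exact contraction_correct e11 e3 e4 hH hyβ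
  · rw [Matrix.mulVec_mulVec, eq_neg_of_add_eq_zero_left edd, Matrix.neg_mulVec,
      ← Matrix.mulVec_mulVec, hdu, Matrix.mulVec_zero, neg_zero]
  · rw [Matrix.vecMul_vecMul, eq_neg_of_add_eq_zero_right e21, Matrix.vecMul_neg,
      ← Matrix.vecMul_vecMul, hvd, Matrix.zero_vecMul, neg_zero]
  -- `β δ` is homotopic to the identity on the cochains supported on `W₂`
  · intro hp'
    have hyu : indMat W₂ *ᵥ u = u := by
      funext c
      rw [indMat, Matrix.mulVec_diagonal]
      by_cases hc : u c = 0
      · simp [hc]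
      · simp [(hu c hc).1]
    have e9 : β * δ = indMat W₂ - cobdOn ε W₂ * (indMat W₂ * b * indMat W₂) -
        indMat W₂ * b * indMat W₂ * cobdOn ε W₂ := by
      rw [eq_sub_iff_add_eq, eq_sub_iff_add_eq]
      refine Eq.trans ?_ e22
      abel
    rw [← Matrix.dotProduct_mulVec, Matrix.mulVec_mulVec, e9, Matrix.sub_mulVec, Matrix.sub_mulVec,
      hyu, ← Matrix.mulVec_mulVec u (indMat W₂ * b * indMat W₂), hdu, Matrix.mulVec_zero, sub_zero,
      dotProduct_sub, hp hp', ← Matrix.mulVec_mulVec, Matrix.dotProduct_mulVec, hvd,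
      zero_dotProduct, sub_zero]
  · intro hp'
    rw [hnp hp', Matrix.mulVec_zero]

end Split

/-! ### The families of cells and of sets of charts attached to an exponent -/

section

variable {V : Type} [Fintype V] [DecidableEq V] {ε : ContractionSign V}

theorem HasSplit.of_false {W : Set (Finset V)} {n : ℕ} (h : HasSplit ε W False n) {p : Prop}
    (hp : ¬ p) (k : ℕ) : HasSplit ε W p k := by
  obtain ⟨H, u, v, h1, h2, -, -, h3, -, -, -, h4⟩ := h
  rw [h4 not_false, Matrix.zero_vecMulVec, ← Matrix.vecMulVec_zero (0 : Finset V → ℤ)] at h3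
  exact ⟨H, 0, 0, h1, h2, by simp, by simp, h3, by simp, by simp, fun h => absurd h hp, by simp⟩

theorem HasSplit.of_true {W : Set (Finset V)} {n : ℕ} (h : HasSplit ε W True n) {p : Prop}
    (hp : p) : HasSplit ε W p n := by
  rwa [eq_true hp]

/-- The sets of vertices that contain `N` and meet precisely the blocks in `I`, the blocks being
the fibres of `bl`. -/
def blockFamily {B : Type} (bl : V → B) (I : Finset B) (N : Finset V) : Set (Finset V) :=
  {c | N ⊆ c ∧ (∀ s ∈ c, bl s ∈ I) ∧ ∀ i ∈ I, ∃ s ∈ c, bl s = i}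

/-- If `N` contains some but not all vertices of a block, every member of the family meets this
block in `N` already, and the family is a cone over any of its other vertices. -/
theorem blockFamily_acyclic {B : Type} {bl : V → B} {I : Finset B} {N : Finset V} {s t : V}
    (hs : s ∉ N) (ht : t ∈ N) (hst : bl s = bl t) (n : ℕ) :
    HasSplit ε (blockFamily bl I N) False n := by
  refine hasSplit_of_cone s ?_ ?_ n
  · rintro c ⟨h1, h2, h3⟩
    refine ⟨h1.trans (Finset.subset_insert s c), fun a ha => ?_, fun i hi => ?_⟩
    · rcases Finset.mem_insert.mp ha with rfl | ha
      · rw [hst]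
        exact h2 t (h1 ht)
      · exact h2 a ha
    · obtain ⟨a, ha, hai⟩ := h3 i hi
      exact ⟨a, Finset.mem_insert_of_mem ha, hai⟩
  · rintro c ⟨h1, h2, h3⟩
    have hN : N ⊆ c.erase s := fun a ha =>
      Finset.mem_erase.mpr ⟨fun e => hs (e ▸ ha), h1 ha⟩
    refine ⟨hN, fun a ha => h2 a (Finset.mem_of_mem_erase ha), fun i hi => ?_⟩
    obtain ⟨a, ha, hai⟩ := h3 i hi
    by_cases has : a = s
    · exact ⟨t, hN ht, by rw [← hst, ← has, hai]⟩
    · exact ⟨a, Finset.mem_erase.mpr ⟨has, ha⟩, hai⟩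

/-- If `N` is a union of blocks, the blocks not in `N` are removed one at a time: allowing such a
block to be empty gives a cone over any of its vertices. When all blocks are in `N`, the family
consists of `N` only. -/
theorem blockFamily_sphere {B : Type} [DecidableEq B] {bl : V → B}
    (hbl : Function.Surjective bl) (N : Finset V) (I : Finset B)
    (hN : ∀ s ∈ N, bl s ∈ I)
    (hcrit : ∀ i ∈ I, (∀ s ∈ N, bl s ≠ i) ∨ ∀ s, bl s = i → s ∈ N) :
    HasSplit ε (blockFamily bl I N) True
      (N.card + (I.filter fun i => ∀ s ∈ N, bl s ≠ i).card) := by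
  induction hk : (I.filter fun i => ∀ s ∈ N, bl s ≠ i).card generalizing I with
  | zero =>
    rw [Finset.card_eq_zero, Finset.filter_eq_empty_iff] at hk
    have hW : blockFamily bl I N = {N} := by
      ext c
      simp only [blockFamily, Set.mem_ofPred_eq, Set.mem_singleton_iff]
      constructor
      · rintro ⟨h1, h2, -⟩
        refine (Finset.Subset.antisymm h1 fun s hs => ?_).symm
        exact (hcrit _ (h2 s hs)).resolve_left (hk (h2 s hs)) s rfl
      · rintro rfl
        refine ⟨subset_rfl, hN, fun i hi => ?_⟩
        have := hk hi
        push Not at this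
        exact this
    rw [hW]
    exact hasSplit_singleton N True trivial
  | succ k ih =>
    obtain ⟨i, hi⟩ : (I.filter fun i => ∀ s ∈ N, bl s ≠ i).Nonempty := by
      rw [← Finset.card_pos]
      omega
    have hiI := (Finset.mem_filter.mp hi).1
    have hiN := (Finset.mem_filter.mp hi).2
    obtain ⟨s, rfl⟩ := hbl i
    have h2 := ih (I.erase (bl s)) (fun a ha => Finset.mem_erase.mpr ⟨hiN a ha, hN a ha⟩)
      (fun l hl => hcrit l (Finset.mem_of_mem_erase hl)) (by
        rw [Finset.filter_erase, Finset.card_erase_of_mem hi, hk]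
        rfl)
    have hU : blockFamily bl I N ∪ blockFamily bl (I.erase (bl s)) N =
        {c | N ⊆ c ∧ (∀ a ∈ c, bl a ∈ I) ∧ ∀ l ∈ I, l ≠ bl s → ∃ a ∈ c, bl a = l} := by
      ext c
      simp only [blockFamily, Set.mem_union, Set.mem_ofPred_eq, Finset.mem_erase]
      constructor
      · rintro (⟨h1, h2, h3⟩ | ⟨h1, h2, h3⟩)
        · exact ⟨h1, h2, fun l hl _ => h3 l hl⟩
        · exact ⟨h1, fun a ha => (h2 a ha).2, fun l hl hne => h3 l ⟨hne, hl⟩⟩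
      · rintro ⟨h1, h2, h3⟩
        by_cases h : ∃ a ∈ c, bl a = bl s
        · refine Or.inl ⟨h1, h2, fun l hl => ?_⟩
          by_cases hls : l = bl s
          · rwa [hls]
          · exact h3 l hl hls
        · push Not at h
          exact Or.inr ⟨h1, fun a ha => ⟨h a ha, h2 a ha⟩, fun l hl => h3 l hl.2 hl.1⟩
    rw [← add_assoc]
    refine HasSplit.of_union (k := 0) ?_ ?_ ?_ ?_ h2
    · rw [Set.disjoint_left]
      rintro c ⟨-, -, h1⟩ ⟨-, h2, -⟩
      obtain ⟨a, ha, has⟩ := h1 _ hiI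
      exact (Finset.mem_erase.mp (h2 a ha)).1 has
    · rintro a ⟨-, -, h1⟩ c ⟨-, h2, -⟩ hac
      obtain ⟨t, ht, hts⟩ := h1 _ hiI
      exact (Finset.mem_erase.mp (h2 t (hac ht))).1 hts
    · rw [hU]
      refine ⟨?_⟩
      rintro a ⟨ha1, -, ha3⟩ c ⟨-, hc2, -⟩ x ⟨hax, hxc⟩
      refine ⟨ha1.trans hax, fun t ht => hc2 t (hxc ht), fun l hl hne => ?_⟩
      obtain ⟨t, ht, htl⟩ := ha3 l hl hne
      exact ⟨t, hax ht, htl⟩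
    · rw [hU]
      refine hasSplit_of_cone s ?_ ?_ 0
      · rintro c ⟨h1, h2, h3⟩
        refine ⟨h1.trans (Finset.subset_insert s c), fun a ha => ?_, fun l hl hne => ?_⟩
        · rcases Finset.mem_insert.mp ha with rfl | ha
          · exact hiI
          · exact h2 a ha
        · obtain ⟨a, ha, hal⟩ := h3 l hl hne
          exact ⟨a, Finset.mem_insert_of_mem ha, hal⟩
      · rintro c ⟨h1, h2, h3⟩
        refine ⟨fun a ha => Finset.mem_erase.mpr ⟨fun e => hiN a ha (by rw [e]), h1 ha⟩,
          fun a ha => h2 a (Finset.mem_of_mem_erase ha), fun l hl hne => ?_⟩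
        obtain ⟨a, ha, hal⟩ := h3 l hl hne
        exact ⟨a, Finset.mem_erase.mpr ⟨fun e => hne (by rw [← hal, e]), ha⟩, hal⟩

end

section

variable {m : ℕ} {r : Fin m → ℕ} {ε : ContractionSign (Chart r)}

/-- The nonempty sets of charts which do not involve the coordinates in `Q` and involve all those
in `N`. -/
def chartFamily (Q N : Finset (Var r)) : Set (Finset (Chart r)) :=
  {J | J.Nonempty ∧ (∀ v ∈ J, ∀ s ∈ Q, v s.1 ≠ s.2) ∧ ∀ s ∈ N, ∃ v ∈ J, v s.1 = s.2}

theorem chartFamily_union {Q N : Finset (Var r)} {s : Var r} (hs : s ∈ N) :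
    chartFamily Q N ∪ chartFamily (insert s Q) (N.erase s) = chartFamily Q (N.erase s) := by
  ext J
  simp only [chartFamily, Set.mem_union, Set.mem_ofPred_eq]
  constructor
  · rintro (⟨h1, h2, h3⟩ | ⟨h1, h2, h3⟩)
    · exact ⟨h1, h2, fun t ht => h3 t (Finset.mem_of_mem_erase ht)⟩
    · exact ⟨h1, fun v hv t ht => h2 v hv t (Finset.mem_insert_of_mem ht), h3⟩
  · rintro ⟨h1, h2, h3⟩
    by_cases h : ∃ v ∈ J, v s.1 = s.2
    · refine Or.inl ⟨h1, h2, fun t ht => ?_⟩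
      by_cases hts : t = s
      · rwa [hts]
      · exact h3 t (Finset.mem_erase.mpr ⟨hts, ht⟩)
    · push Not at h
      refine Or.inr ⟨h1, fun v hv t ht => ?_, h3⟩
      rcases Finset.mem_insert.mp ht with rfl | ht
      · exact h v hv
      · exact h2 v hv t ht

/-- Requiring the coordinate `s ∈ N` to occur: if the cochains without this requirement are
contractible, they are related by a connecting isomorphism to those not involving `s`. -/
theorem HasSplit.chartFamily {Q N : Finset (Var r)} {s : Var r} (hs : s ∈ N) {p : Prop} {n : ℕ}
    (h : HasSplit ε (chartFamily Q (N.erase s)) False 0)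
    (h₂ : HasSplit ε (chartFamily (insert s Q) (N.erase s)) p n) :
    HasSplit ε (chartFamily Q N) p (n + 1) := by
  rw [← chartFamily_union hs] at h
  refine HasSplit.of_union ?_ ?_ ?_ h h₂
  · rw [Set.disjoint_left]
    rintro J ⟨-, -, h1⟩ ⟨-, h2, -⟩
    obtain ⟨v, hv, hvs⟩ := h1 s hs
    exact h2 v hv s (Finset.mem_insert_self _ _) hvs
  · rintro J ⟨-, -, h1⟩ J' ⟨-, h2, -⟩ hJ
    obtain ⟨v, hv, hvs⟩ := h1 s hs
    exact h2 v (hJ hv) s (Finset.mem_insert_self _ _) hvs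
  · rw [chartFamily_union hs]
    refine ⟨?_⟩
    rintro a ⟨ha1, -, ha3⟩ c ⟨-, hc2, -⟩ x ⟨hax, hxc⟩
    refine ⟨ha1.mono hax, fun v hv => hc2 v (hxc hv), fun t ht => ?_⟩
    obtain ⟨v, hv, hvt⟩ := ha3 t ht
    exact ⟨v, hax hv, hvt⟩

/-- The family of charts is acyclic if some block contains a coordinate `s₀` in `N` and a coordinate
`t₀` in neither `N` nor `Q`. The family is empty, if a block is contained in `Q`, or a cone, if some
chart avoids `N` and `Q`, or the requirement on a coordinate in another block is dropped. -/
theorem chartFamily_acyclic (N Q : Finset (Var r)) (s₀ t₀ : Var r) (hs₀ : s₀ ∈ N)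
    (ht₀ : t₀ ∉ N) (ht₀' : t₀ ∉ Q) (hst : t₀.1 = s₀.1) (n : ℕ) :
    HasSplit ε (chartFamily Q N) False n := by
  refine HasSplit.of_false ?_ not_false n (n := N.card)
  induction hk : N.card generalizing N Q n with
  | zero => simp [Finset.card_eq_zero.mp hk] at hs₀
  | succ k ih =>
    by_cases hA : ∃ i, ∀ a, (⟨i, a⟩ : Var r) ∈ Q
    · obtain ⟨i, hi⟩ := hA
      have h0 : MultiProj.chartFamily Q N = ∅ := by
        rw [Set.eq_empty_iff_forall_notMem]
        rintro J ⟨⟨v, hv⟩, h2, -⟩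
        exact h2 v hv _ (hi (v i)) rfl
      rw [h0]
      exact hasSplit_empty _
    by_cases hB : ∀ i, ∃ a, (⟨i, a⟩ : Var r) ∉ N ∧ (⟨i, a⟩ : Var r) ∉ Q
    · -- a chart involving no coordinate in `N` or `Q`
      choose v hvN hvQ using hB
      refine hasSplit_of_cone v ?_ ?_ _
      · rintro J ⟨h1, h2, h3⟩
        refine ⟨Finset.insert_nonempty v J, fun w hw t ht => ?_, fun t ht => ?_⟩
        · rcases Finset.mem_insert.mp hw with rfl | hw
          · intro e
            have := hvQ t.1
            rw [e] at this
            exact this ht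
          · exact h2 w hw t ht
        · obtain ⟨w, hw, hwt⟩ := h3 t ht
          exact ⟨w, Finset.mem_insert_of_mem hw, hwt⟩
      · rintro J ⟨h1, h2, h3⟩
        have h4 : ∀ t ∈ N, ∃ w ∈ J.erase v, w t.1 = t.2 := by
          intro t ht
          obtain ⟨w, hw, hwt⟩ := h3 t ht
          refine ⟨w, Finset.mem_erase.mpr ⟨?_, hw⟩, hwt⟩
          rintro rfl
          have := hvN t.1
          rw [hwt] at this
          exact this ht
        obtain ⟨w, hw, -⟩ := h4 s₀ hs₀
        exact ⟨⟨w, hw⟩, fun w hw => h2 w (Finset.mem_of_mem_erase hw), h4⟩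
    · push Not at hA hB
      obtain ⟨i, hi⟩ := hB
      obtain ⟨a, ha⟩ := hA i
      have hsN : (⟨i, a⟩ : Var r) ∈ N := by
        by_contra h
        exact ha (hi a h)
      have hi0 : s₀.1 ≠ i := by
        rintro rfl
        obtain ⟨ti, ta⟩ := t₀
        dsimp only at hst
        subst hst
        exact ht₀' (hi ta ht₀)
      have hs₀' : s₀ ∈ N.erase ⟨i, a⟩ :=
        Finset.mem_erase.mpr ⟨fun e => hi0 (by rw [e]), hs₀⟩
      have hcard : (N.erase ⟨i, a⟩).card = k := by
        rw [Finset.card_erase_of_mem hsN, hk]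
        rfl
      have ht₁ : t₀ ∉ N.erase ⟨i, a⟩ := fun h => ht₀ (Finset.mem_of_mem_erase h)
      refine HasSplit.chartFamily hsN ?_
        (ih (N.erase ⟨i, a⟩) (insert (⟨i, a⟩ : Var r) Q) hs₀' ht₁ ?_ 0 hcard)
      · exact (ih (N.erase ⟨i, a⟩) Q hs₀' ht₁ ht₀' 0 hcard).of_false not_false 0
      · rw [Finset.mem_insert, not_or]
        exact ⟨fun e => hi0 (by rw [← hst, e]), ht₀'⟩

/-- If each block is disjoint from `N` or exhausted by `N` and `Q`, the requirements on the
coordinates in `N` are dropped one at a time. Each raises the degree by one, except the last one in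
a block, where it is automatic: all other coordinates of the block are excluded. Without
requirements the family consists of the nonempty faces of a simplex. -/
theorem chartFamily_sphere (N Q : Finset (Var r)) (hNQ : Disjoint N Q)
    (hQ : ∀ i, ∃ a, (⟨i, a⟩ : Var r) ∉ Q)
    (hcrit : ∀ i, (∀ a, (⟨i, a⟩ : Var r) ∉ N) ∨ ∀ a, (⟨i, a⟩ : Var r) ∈ N ∪ Q) :
    HasSplit ε (chartFamily Q N) True
      (∑ i, ((N.filter fun s => s.1 = i).card - 1) + 1) := by
  induction hk : N.card generalizing N Q with
  | zero =>
    obtain rfl := Finset.card_eq_zero.mp hk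
    choose v hv using hQ
    have hU : chartFamily Q ∅ ∪ {∅} = {J : Finset (Chart r) | ∀ w ∈ J, ∀ s ∈ Q, w s.1 ≠ s.2} := by
      ext J
      simp only [chartFamily, Set.mem_union, Set.mem_ofPred_eq, Set.mem_singleton_iff]
      constructor
      · rintro (⟨-, h, -⟩ | rfl)
        · exact h
        · simp
      · intro h
        rcases J.eq_empty_or_nonempty with h0 | h0
        · exact Or.inr h0
        · exact Or.inl ⟨h0, h, by simp⟩
    simp only [Finset.filter_empty, Finset.card_empty, Finset.sum_const_zero, zero_tsub]
    refine HasSplit.of_union (W₂ := {∅}) (k := 0) ?_ ?_ ?_ ?_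
      (by simpa using hasSplit_singleton (∅ : Finset (Chart r)) True trivial)
    · rw [Set.disjoint_right]
      rintro _ rfl ⟨h, -⟩
      exact Finset.not_nonempty_empty h
    · rintro a ⟨h, -⟩ _ rfl ha
      exact Finset.not_nonempty_empty (h.mono ha)
    · rw [hU]
      exact ⟨fun a _ c hc x hx w hw => hc w (hx.2 hw)⟩
    · rw [hU]
      refine hasSplit_of_cone v ?_ ?_ 0
      · intro J hJ w hw t ht
        rcases Finset.mem_insert.mp hw with rfl | hw
        · intro e
          have := hv t.1
          rw [e] at this
          exact this ht
        · exact hJ w hw t ht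
      · exact fun J hJ w hw => hJ w (Finset.mem_of_mem_erase hw)
  | succ k ih =>
    obtain ⟨s, hs⟩ : N.Nonempty := by
      rw [← Finset.card_pos]
      omega
    obtain ⟨i, a⟩ := s
    have hfull := (hcrit i).resolve_left fun h => h a hs
    have hcard : (N.erase ⟨i, a⟩).card = k := by
      rw [Finset.card_erase_of_mem hs, hk]
      rfl
    have hQs : (⟨i, a⟩ : Var r) ∉ Q := Finset.disjoint_left.mp hNQ hs
    have hcount : ∀ l, ((N.erase ⟨i, a⟩).filter fun s => s.1 = l).card =
        (N.filter fun s => s.1 = l).card - if l = i then 1 else 0 := by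
      intro l
      rw [Finset.filter_erase]
      split_ifs with h
      · subst h
        rw [Finset.card_erase_of_mem (by simp [hs])]
      · rw [Finset.erase_eq_of_notMem (by simp [Ne.symm h])]
        rfl
    by_cases hmore : ∃ t ∈ N.erase ⟨i, a⟩, t.1 = i
    · obtain ⟨t, ht, hti⟩ := hmore
      have hsum : ∑ l, ((N.filter fun s => s.1 = l).card - 1) =
          ∑ l, (((N.erase ⟨i, a⟩).filter fun s => s.1 = l).card - 1) + 1 := by
        have h2 : 2 ≤ (N.filter fun s => s.1 = i).card := by
          have : 1 ≤ ((N.erase ⟨i, a⟩).filter fun s => s.1 = i).card :=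
            Finset.card_pos.mpr ⟨t, by simp only [Finset.mem_filter]; exact ⟨ht, hti⟩⟩
          rw [hcount, if_pos rfl] at this
          omega
        rw [← Finset.add_sum_erase _ _ (Finset.mem_univ i),
          ← Finset.add_sum_erase (Finset.univ) (fun l =>
            ((N.erase ⟨i, a⟩).filter fun s => s.1 = l).card - 1) (Finset.mem_univ i)]
        have h3 : ∑ l ∈ Finset.univ.erase i, ((N.filter fun s => s.1 = l).card - 1) =
            ∑ l ∈ Finset.univ.erase i,
              (((N.erase ⟨i, a⟩).filter fun s => s.1 = l).card - 1) := by
          refine Finset.sum_congr rfl fun l hl => ?_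
          rw [hcount, if_neg (Finset.ne_of_mem_erase hl)]
          rfl
        rw [h3, hcount, if_pos rfl]
        omega
      rw [hsum]
      refine HasSplit.chartFamily hs ?_
        (ih (N.erase ⟨i, a⟩) (insert (⟨i, a⟩ : Var r) Q) ?_ ?_ ?_ hcard)
      · exact chartFamily_acyclic _ _ t ⟨i, a⟩ ht (Finset.notMem_erase _ _) hQs hti.symm 0
      · rw [Finset.disjoint_insert_right]
        exact ⟨Finset.notMem_erase _ _, hNQ.mono_left (Finset.erase_subset _ _)⟩
      · intro l
        by_cases hl : l = i
        · subst hl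
          obtain ⟨tl, ta⟩ := t
          dsimp only at hti
          subst hti
          refine ⟨ta, ?_⟩
          rw [Finset.mem_insert, not_or]
          exact ⟨Finset.ne_of_mem_erase ht,
            Finset.disjoint_left.mp hNQ (Finset.mem_of_mem_erase ht)⟩
        · obtain ⟨c, hc⟩ := hQ l
          refine ⟨c, ?_⟩
          rw [Finset.mem_insert, not_or]
          exact ⟨fun e => hl (congrArg Sigma.fst e), hc⟩
      · intro l
        refine (hcrit l).imp (fun h c hc => h c (Finset.mem_of_mem_erase hc)) fun h c => ?_
        have := h c
        simp only [Finset.mem_union, Finset.mem_insert, Finset.mem_erase] at this ⊢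
        tauto
    · push Not at hmore
      have hW : chartFamily Q N = chartFamily Q (N.erase ⟨i, a⟩) := by
        ext J
        simp only [chartFamily, Set.mem_ofPred_eq]
        refine and_congr_right fun h1 => and_congr_right fun h2 =>
          ⟨fun h t ht => h t (Finset.mem_of_mem_erase ht), fun h t ht => ?_⟩
        by_cases hta : t = ⟨i, a⟩
        · -- the only coordinate of the block that is allowed is the one of `s`
          subst hta
          obtain ⟨v, hv⟩ := h1
          refine ⟨v, hv, ?_⟩
          have h3 : (⟨i, v i⟩ : Var r) ∉ Q := fun h4 => h2 v hv _ h4 rfl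
          have h5 := (Finset.mem_union.mp (hfull (v i))).resolve_right h3
          by_contra h6
          exact hmore _ (Finset.mem_erase.mpr ⟨fun e => h6 (by simpa using e), h5⟩) rfl
        · exact h t (Finset.mem_erase.mpr ⟨hta, ht⟩)
      have hone : (N.filter fun s => s.1 = i).card - 1 = 0 := by
        have h1 : ((N.erase ⟨i, a⟩).filter fun s => s.1 = i).card = 0 := by
          rw [Finset.card_eq_zero, Finset.filter_eq_empty_iff]
          exact hmore
        rw [hcount, if_pos rfl] at h1
        exact h1
      have hsum : ∑ l, ((N.filter fun s => s.1 = l).card - 1) =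
          ∑ l, (((N.erase ⟨i, a⟩).filter fun s => s.1 = l).card - 1) := by
        refine Finset.sum_congr rfl fun l _ => ?_
        rw [hcount]
        split_ifs with h
        · rw [h, hone]
        · rfl
      rw [hsum, hW]
      refine ih _ Q (hNQ.mono_left (Finset.erase_subset _ _)) hQ (fun l => ?_) hcard
      by_cases hl : l = i
      · subst hl
        exact Or.inl fun c hc => hmore _ hc rfl
      · refine (hcrit l).imp (fun h c hc => h c (Finset.mem_of_mem_erase hc)) fun h c => ?_
        have := h c
        simp only [Finset.mem_union, Finset.mem_erase] at this ⊢
        exact this.imp_left fun h' => ⟨fun e => hl (congrArg Sigma.fst e), h'⟩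

end

/-! ### Sums of split complexes over an index set -/

section Act

variable (R : Type*) [CommRing R] {α β γ : Type} [Fintype β] [Fintype γ]

/-- The `R`-linear map given by an integer matrix. -/
def act (A : Matrix α β ℤ) : (β → R) →ₗ[R] (α → R) :=
  (A.map (Int.cast : ℤ → R)).mulVecLin

variable {R}

theorem act_apply (A : Matrix α β ℤ) (f : β → R) (a : α) :
    act R A f a = ∑ b, (A a b : R) * f b := rfl

theorem act_mul (A : Matrix α β ℤ) (B : Matrix β γ ℤ) (f : γ → R) :
    act R (A * B) f = act R A (act R B f) := by
  have h : (A * B).map (Int.cast : ℤ → R) =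
      A.map (Int.cast : ℤ → R) * B.map (Int.cast : ℤ → R) :=
    Matrix.map_mul (f := Int.castRingHom R)
  rw [act, h, Matrix.mulVecLin_mul]
  rfl

theorem act_add (A B : Matrix α β ℤ) (f : β → R) : act R (A + B) f = act R A f + act R B f := by
  funext a
  simp [act_apply, add_mul, Finset.sum_add_distrib]

theorem act_sub (A B : Matrix α β ℤ) (f : β → R) : act R (A - B) f = act R A f - act R B f := by
  funext a
  simp [act_apply, sub_mul, Finset.sum_sub_distrib]

theorem act_one [DecidableEq β] (f : β → R) : act R (1 : Matrix β β ℤ) f = f := by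
  funext a
  rw [act_apply, Finset.sum_eq_single a]
  · simp
  · intro b _ hb
    simp [Matrix.one_apply_ne hb.symm]
  · simp

theorem act_vecMulVec (u : α → ℤ) (v : β → ℤ) (f : β → R) (a : α) :
    act R (vecMulVec u v) f a = (∑ b, (v b : R) * f b) * u a := by
  rw [act_apply, Finset.sum_mul]
  refine Finset.sum_congr rfl fun b _ => ?_
  rw [Matrix.vecMulVec_apply]
  push_cast
  ring

theorem act_diagonal [DecidableEq β] (w : β → ℤ) (f : β → R) (b : β) :
    act R (Matrix.diagonal w) f b = w b * f b := by
  rw [act_apply, Finset.sum_eq_single b]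
  · simp
  · intro c _ hc
    simp [Matrix.diagonal_apply_ne _ hc.symm]
  · simp

/-- An idempotent integer matrix factors through a free module. -/
theorem exists_factorization_of_idempotent [DecidableEq β] (E : Matrix β β ℤ) (hE : E * E = E) :
    ∃ (k : ℕ) (B : Matrix β (Fin k) ℤ) (A : Matrix (Fin k) β ℤ), A * B = 1 ∧ B * A = E := by
  obtain ⟨k, b⟩ := Submodule.basisOfPid (Pi.basisFun ℤ β) (LinearMap.range E.mulVecLin)
  let B : Matrix β (Fin k) ℤ := fun i j => (b j).1 i
  let A : Matrix (Fin k) β ℤ := fun j i => b.repr (E.mulVecLin.rangeRestrict (Pi.single i 1)) j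
  have hA : ∀ f, A *ᵥ f = b.repr (E.mulVecLin.rangeRestrict f) := by
    intro f
    funext j
    have h : f = ∑ i, f i • (Pi.single i 1 : β → ℤ) := (pi_eq_sum_univ' f)
    conv_rhs => rw [h]
    simp only [map_sum, map_smul, Finsupp.coe_finsetSum, Finset.sum_apply, Finsupp.smul_apply,
      smul_eq_mul]
    change ∑ i, A j i * f i = _
    exact Finset.sum_congr rfl fun i _ => mul_comm (A j i) _
  have hB : ∀ g : Fin k → ℤ, B *ᵥ g = (∑ j, g j • b j : LinearMap.range E.mulVecLin) := by
    intro g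
    funext i
    simp only [Submodule.coe_sum, Submodule.coe_smul, Finset.sum_apply, Pi.smul_apply, smul_eq_mul]
    change ∑ j, B i j * g j = _
    exact Finset.sum_congr rfl fun j _ => mul_comm (B i j) (g j)
  have hrange : ∀ y : LinearMap.range E.mulVecLin, E.mulVecLin.rangeRestrict y.1 = y := by
    rintro ⟨_, f, rfl⟩
    apply Subtype.ext
    change E *ᵥ (E *ᵥ f) = E *ᵥ f
    rw [Matrix.mulVec_mulVec, hE]
  refine ⟨k, B, A, ?_, ?_⟩
  · refine Matrix.mulVec_injective (funext fun g => ?_)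
    rw [← Matrix.mulVec_mulVec, hB, hA, hrange, Matrix.one_mulVec]
    exact b.repr_sum_self g
  · refine Matrix.mulVec_injective (funext fun f => ?_)
    rw [← Matrix.mulVec_mulVec, hA, hB, b.sum_repr]
    rfl

theorem act_raisesCard {V : Type} [Fintype V] {A : Matrix (Finset V) (Finset V) ℤ} {k n : ℤ}
    (hA : RaisesCard A k) {f : Finset V → R} (hf : ∀ c, f c ≠ 0 → (c.card : ℤ) = n) (c : Finset V)
    (hc : act R A f c ≠ 0) : (c.card : ℤ) = n + k := by
  rw [act_apply] at hc
  obtain ⟨b, _, hb⟩ := Finset.exists_ne_zero_of_sum_ne_zero hc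
  have h1 := hA c b fun h => hb (by simp [h])
  rw [h1, hf b (right_ne_zero_of_mul hb)]

end Act

section Big

variable (R : Type*) [CommRing R] {V X : Type} [Fintype V] [DecidableEq V]

/-- The families of cochains, finitely many of which are nonzero, that are supported on the members
of `W x` with `n` elements. -/
def cochains (W : X → Set (Finset V)) (n : ℤ) : Submodule R (X → Finset V → R) where
  carrier := {f | {x | f x ≠ 0}.Finite ∧ ∀ x c, f x c ≠ 0 → c ∈ W x ∧ (c.card : ℤ) = n}
  add_mem' := by
    rintro f g ⟨hf, hf'⟩ ⟨hg, hg'⟩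
    refine ⟨(hf.union hg).subset fun x hx => ?_, fun x c hc => ?_⟩
    · by_contra h
      simp only [Set.mem_union, Set.mem_ofPred_eq, not_or, not_not] at h
      exact hx (by simp [h.1, h.2])
    · by_cases h : f x c = 0
      · exact hg' x c fun h' => hc (by simp [h, h'])
      · exact hf' x c h
  zero_mem' := by simp
  smul_mem' := by
    rintro a f ⟨hf, hf'⟩
    refine ⟨hf.subset fun x hx h => hx (by simp [h]), fun x c hc => hf' x c fun h => hc ?_⟩
    simp [h]

variable {R}

/-- The endomorphism given by a family of integer matrices. -/
def pointwise (A : X → Matrix (Finset V) (Finset V) ℤ) :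
    (X → Finset V → R) →ₗ[R] (X → Finset V → R) where
  toFun f x := act R (A x) (f x)
  map_add' f g := funext fun x => by simp
  map_smul' a f := funext fun x => by simp

variable (R X) in
/-- The coboundary of families of cochains. -/
def bigD (ε : ContractionSign V) : (X → Finset V → R) →ₗ[R] (X → Finset V → R) :=
  pointwise fun _ => cobd ε

theorem bigD_apply (ε : ContractionSign V) (f : X → Finset V → R) (x : X) :
    bigD R X ε f x = act R (cobd ε) (f x) := rfl

theorem bigD_bigD (ε : ContractionSign V) (f : X → Finset V → R) :
    bigD R X ε (bigD R X ε f) = 0 := by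
  funext x c
  rw [bigD_apply, bigD_apply, ← act_mul, cobd_sq]
  simp [act_apply]

theorem bigD_apply_apply (ε : ContractionSign V) (f : X → Finset V → R) (x : X) (c : Finset V) :
    bigD R X ε f x c = ∑ s ∈ c, (ε.sign c s : R) * f x (c.erase s) :=
  cobd_map_mulVec ε (f x) c

theorem act_indMat_of_supp {W : Set (Finset V)} {f : Finset V → R} (hf : ∀ c, f c ≠ 0 → c ∈ W) :
    act R (indMat W) f = f := by
  funext c
  rw [indMat, act_diagonal]
  by_cases h : f c = 0
  · simp [h]
  · simp [hf c h]

theorem act_indMat_supp {W : Set (Finset V)} {f : Finset V → R} (c : Finset V)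
    (hc : act R (indMat W) f c ≠ 0) : c ∈ W := by
  rw [indMat, act_diagonal] at hc
  by_contra h
  simp [h] at hc

theorem act_cobd_supp (ε : ContractionSign V) {W : Set (Finset V)} (hW : IsUpperSet W)
    {f : Finset V → R} (hf : ∀ c, f c ≠ 0 → c ∈ W) (c : Finset V)
    (hc : act R (cobd ε) f c ≠ 0) : c ∈ W := by
  rw [act_apply] at hc
  obtain ⟨b, _, hb⟩ := Finset.exists_ne_zero_of_sum_ne_zero hc
  have h1 := (cobd_apply_ne_zero ε (c := c) (c' := b)
    fun h => hb (by simp [h])).1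
  exact hW h1 (hf b (right_ne_zero_of_mul hb))

theorem act_cobdOn_of_supp (ε : ContractionSign V) {W : Set (Finset V)} (hW : IsUpperSet W)
    {f : Finset V → R} (hf : ∀ c, f c ≠ 0 → c ∈ W) :
    act R (cobdOn ε W) f = act R (cobd ε) f := by
  rw [cobdOn, act_mul, act_mul, act_indMat_of_supp hf,
    act_indMat_of_supp (act_cobd_supp ε hW hf)]

theorem bigD_mem (ε : ContractionSign V) {W : X → Set (Finset V)} (hW : ∀ x, IsUpperSet (W x))
    {n n' : ℤ} (hn : n + 1 = n') {f : X → Finset V → R} (hf : f ∈ cochains R W n) :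
    bigD R X ε f ∈ cochains R W n' := by
  refine ⟨hf.1.subset fun x hx h => hx ?_, fun x c hc => ⟨?_, ?_⟩⟩
  · rw [bigD_apply, h, map_zero]
  · exact act_cobd_supp ε (hW x) (fun c h => (hf.2 x c h).1) c hc
  · rw [← hn]
    exact act_raisesCard (raisesCard_cobd ε) (fun c h => (hf.2 x c h).2) c hc

/-- A choice of the matrices in `HasSplit`. -/
structure SplitData (ε : ContractionSign V) (W : Set (Finset V)) (p : Prop) (n : ℕ) where
  H : Matrix (Finset V) (Finset V) ℤ
  u : Finset V → ℤ
  v : Finset V → ℤ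
  raisesCard : RaisesCard H (-1)
  indMat_mul_H : indMat W * H = H
  u_supp : ∀ c, u c ≠ 0 → c ∈ W ∧ c.card = n
  homotopy : cobdOn ε W * H + H * cobdOn ε W = indMat W - vecMulVec u v
  cobdOn_u : cobdOn ε W *ᵥ u = 0
  v_cobdOn : v ᵥ* cobdOn ε W = 0
  v_u : p → v ⬝ᵥ u = 1
  u_eq_zero : ¬ p → u = 0
  v_supp : ∀ c, v c ≠ 0 → c ∈ W ∧ c.card = n

theorem HasSplit.nonempty_splitData {ε : ContractionSign V} {W : Set (Finset V)} {p : Prop}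
    {n : ℕ} (h : HasSplit ε W p n) : Nonempty (SplitData ε W p n) := by
  obtain ⟨H, u, v, h1, h2, h3, h4, h5, h6, h7, h8, h9⟩ := h
  refine ⟨H, u, v, h1, ?_, h3, h5, h6, h7, h8, h9, h4⟩
  rw [← h2, ← mul_assoc, ← mul_assoc, indMat_mul_self]

namespace SplitData

variable {ε : ContractionSign V} {W : Set (Finset V)} {p : Prop} {k : ℕ} (S : SplitData ε W p k)

theorem act_H_supp (f : Finset V → R) (c : Finset V) (hc : act R S.H f c ≠ 0) : c ∈ W := by
  rw [← S.indMat_mul_H, act_mul] at hc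
  exact act_indMat_supp c hc

theorem act_homotopy (hW : IsUpperSet W) {f : Finset V → R} (hf : ∀ c, f c ≠ 0 → c ∈ W) :
    act R (cobd ε) (act R S.H f) + act R S.H (act R (cobd ε) f) =
      f - act R (vecMulVec S.u S.v) f := by
  have h := congrArg (fun A => act R A f) S.homotopy
  simp only [act_add, act_sub, act_mul, act_indMat_of_supp hf] at h
  rwa [act_cobdOn_of_supp ε hW hf, act_cobdOn_of_supp ε hW (S.act_H_supp f)] at h

theorem sum_v_act_cobd (hW : IsUpperSet W) {f : Finset V → R} (hf : ∀ c, f c ≠ 0 → c ∈ W) :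
    ∑ c, (S.v c : R) * act R (cobd ε) f c = 0 := by
  have h1 : act R (vecMulVec (fun _ : Unit => (1 : ℤ)) S.v * cobdOn ε W) f () = 0 := by
    rw [Matrix.vecMulVec_mul, S.v_cobdOn, act_apply]
    simp [Matrix.vecMulVec_apply]
  rwa [act_mul, act_vecMulVec, act_cobdOn_of_supp ε hW hf, Int.cast_one, mul_one] at h1

theorem act_cobd_u (hW : IsUpperSet W) : act R (cobd ε) (fun c => (S.u c : R)) = 0 := by
  rw [← act_cobdOn_of_supp ε hW (W := W)]
  · funext c
    have h := congrArg (Int.cast : ℤ → R) (congrFun S.cobdOn_u c)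
    simp only [Matrix.mulVec, dotProduct, Int.cast_sum, Int.cast_mul, Pi.zero_apply,
      Int.cast_zero] at h
    rw [act_apply, h]
    rfl
  · intro c hc
    exact (S.u_supp c fun h => hc (by simp [h])).1

theorem sum_v_u (hp : p) : ∑ c, (S.v c : R) * (S.u c : R) = 1 := by
  have h := congrArg (Int.cast : ℤ → R) (S.v_u hp)
  simpa [dotProduct] using h

/-- The projection `d H` to the coboundaries, in degree `n`. -/
noncomputable def coboundaryProj (n : ℤ) : Matrix (Finset V) (Finset V) ℤ :=
  cobdOn ε W * S.H * indMat {c | (c.card : ℤ) = n}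

theorem cobdOn_H_cobdOn (hW : IsUpperSet W) :
    cobdOn ε W * S.H * cobdOn ε W = cobdOn ε W := by
  have h1 : vecMulVec S.u S.v * cobdOn ε W = 0 := by
    rw [Matrix.vecMulVec_mul, S.v_cobdOn, Matrix.vecMulVec_zero]
  have h2 : indMat W * cobdOn ε W = cobdOn ε W := by
    rw [cobdOn, ← mul_assoc, ← mul_assoc, indMat_mul_self]
  have h3 := congrArg (fun A => A * cobdOn ε W) S.homotopy
  simp only [add_mul, sub_mul, h1, h2, sub_zero] at h3
  rwa [mul_assoc S.H, cobdOn_sq ε hW.ordConnected, mul_zero, add_zero] at h3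

theorem coboundaryProj_idem (hW : IsUpperSet W) (n : ℤ) :
    S.coboundaryProj n * S.coboundaryProj n = S.coboundaryProj n := by
  have hdeg : RaisesCard (cobdOn ε W * S.H) 0 := by
    simpa using (raisesCard_cobdOn ε W).mul S.raisesCard
  have hcomm : indMat {c : Finset V | (c.card : ℤ) = n} * (cobdOn ε W * S.H) =
      cobdOn ε W * S.H * indMat {c : Finset V | (c.card : ℤ) = n} := by
    ext a b
    rw [indMat, Matrix.mul_diagonal, Matrix.diagonal_mul, mul_comm]
    by_cases h : (cobdOn ε W * S.H) a b = 0
    · rw [h, zero_mul, zero_mul]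
    · have := hdeg a b h
      by_cases hb : (b.card : ℤ) = n <;> simp [this, hb]
  rw [coboundaryProj, mul_assoc, ← mul_assoc (indMat _), hcomm, mul_assoc (cobdOn ε W * S.H),
    indMat_mul_self, ← mul_assoc, ← mul_assoc, S.cobdOn_H_cobdOn hW]

end SplitData

variable {ε : ContractionSign V} {W : X → Set (Finset V)} {p : X → Prop} {k : X → ℕ}

theorem pointwise_H_mem (S : ∀ x, SplitData ε (W x) (p x) (k x)) {n n' : ℤ} (hn : n' + 1 = n)
    {f : X → Finset V → R} (hf : f ∈ cochains R W n) :
    pointwise (fun x => (S x).H) f ∈ cochains R W n' := by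
  refine ⟨hf.1.subset fun x hx h => hx ?_, fun x c hc => ⟨(S x).act_H_supp _ c hc, ?_⟩⟩
  · change act R (S x).H (f x) = 0
    rw [h, map_zero]
  · have := act_raisesCard (S x).raisesCard (fun c h => (hf.2 x c h).2) c hc
    omega

/-- Sums of split complexes: the cohomology in degree `n` is free on the indices of the summands
with cohomology in that degree. -/
theorem exists_cohomology_splitting (hW : ∀ x, IsUpperSet (W x))
    (hs : ∀ x, HasSplit ε (W x) (p x) (k x)) (n : ℤ) [Finite {x // p x ∧ (k x : ℤ) = n}] :
    ∃ (U : ({x // p x ∧ (k x : ℤ) = n} → R) →ₗ[R] (X → Finset V → R))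
      (T : (X → Finset V → R) →ₗ[R] ({x // p x ∧ (k x : ℤ) = n} → R)),
      (∀ q, U q ∈ cochains R W n) ∧ (∀ q x, U q x ≠ 0 → ∃ h, q ⟨x, h⟩ ≠ 0) ∧
      (∀ q, bigD R X ε (U q) = 0) ∧ (∀ q, T (U q) = q) ∧
      (∀ n', n' + 1 = n → ∀ f ∈ cochains R W n', T (bigD R X ε f) = 0) ∧
      ∀ n', n' + 1 = n → ∀ f ∈ cochains R W n, bigD R X ε f = 0 → T f = 0 →
        ∃ g ∈ cochains R W n', bigD R X ε g = f := by
  classical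
  have S := fun x => Classical.choice (hs x).nonempty_splitData
  refine ⟨{ toFun := fun q x => if h : p x ∧ (k x : ℤ) = n then
              q ⟨x, h⟩ • fun c => ((S x).u c : R) else 0
            map_add' := ?_
            map_smul' := ?_ },
    { toFun := fun f x => ∑ c, ((S x.1).v c : R) * f x.1 c
      map_add' := ?_
      map_smul' := ?_ }, ?_, ?_, ?_, ?_, ?_, ?_⟩
  · intro q q'
    funext x
    by_cases h : p x ∧ (k x : ℤ) = n
    · simp [h, add_smul]
    · simp [h]
  · intro a q
    funext x
    by_cases h : p x ∧ (k x : ℤ) = n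
    · simp [h, mul_smul]
    · simp [h]
  · intro f g
    funext x
    simp [mul_add, Finset.sum_add_distrib]
  · intro a f
    funext x
    simp [Finset.mul_sum, mul_left_comm]
  · intro q
    refine ⟨(Set.finite_range (Subtype.val : {x // p x ∧ (k x : ℤ) = n} → X)).subset
      fun x hx => ?_, fun x c hc => ?_⟩
    · by_contra h
      refine hx (dif_neg fun h' => h ⟨⟨x, h'⟩, rfl⟩)
    · by_cases h : p x ∧ (k x : ℤ) = n
      · simp only [LinearMap.coe_mk, AddHom.coe_mk, dif_pos h, Pi.smul_apply, smul_eq_mul] at hc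
        have := (S x).u_supp c fun h' => hc (by simp [h'])
        exact ⟨this.1, by rw [this.2, h.2]⟩
      · simp [h] at hc
  · intro q x hx
    by_cases h : p x ∧ (k x : ℤ) = n
    · refine ⟨h, fun h' => hx ?_⟩
      simp [h, h']
    · simp [h] at hx
  · intro q
    funext x
    rw [bigD_apply]
    by_cases h : p x ∧ (k x : ℤ) = n
    · simp only [LinearMap.coe_mk, AddHom.coe_mk, dif_pos h]
      rw [map_smul, (S x).act_cobd_u (hW x), smul_zero]
      rfl
    · simp [h]
  · intro q
    funext x
    simp only [LinearMap.coe_mk, AddHom.coe_mk, dif_pos x.2, Pi.smul_apply, smul_eq_mul]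
    refine Eq.trans ?_ (mul_one (q x))
    rw [← (S x.1).sum_v_u (R := R) x.2.1, Finset.mul_sum]
    exact Finset.sum_congr rfl fun c _ => mul_left_comm _ _ _
  · intro n' _ f hf
    funext x
    exact (S x.1).sum_v_act_cobd (hW x.1) fun c hc => (hf.2 x.1 c hc).1
  · intro n' hn f hf hdf hTf
    refine ⟨_, pointwise_H_mem S hn hf, ?_⟩
    funext x
    have h1 := (S x).act_homotopy (hW x) fun c hc => (hf.2 x c hc).1
    have h2 : act R (cobd ε) (f x) = 0 := congrFun hdf x
    rw [h2, map_zero, add_zero] at h1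
    rw [bigD_apply]
    refine h1.trans ?_
    rw [sub_eq_self]
    funext c
    rw [act_vecMulVec]
    by_cases h : p x ∧ (k x : ℤ) = n
    · have h3 : ∑ c, ((S x).v c : R) * f x c = 0 := congrFun hTf ⟨x, h⟩
      rw [h3, zero_mul]
      rfl
    · by_cases hp : p x
      · rw [Finset.sum_eq_zero, zero_mul]
        · rfl
        intro c _
        by_cases hv : (S x).v c = 0
        · simp [hv]
        · by_cases hfc : f x c = 0
          · simp [hfc]
          · exact absurd ⟨hp, by rw [← ((S x).v_supp c hv).2, (hf.2 x c hfc).2]⟩ h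
      · rw [(S x).u_eq_zero hp]
        simp

/-- On the summands without cohomology, there is a homotopy from the identity to zero. -/
theorem exists_contraction (hW : ∀ x, IsUpperSet (W x))
    (hs : ∀ x, HasSplit ε (W x) (p x) (k x)) :
    ∃ h : (X → Finset V → R) →ₗ[R] (X → Finset V → R),
      (∀ n n', n' + 1 = n → ∀ f ∈ cochains R W n, h f ∈ cochains R W n') ∧
      (∀ f x, f x = 0 → h f x = 0) ∧
      ∀ n, ∀ f ∈ cochains R W n, (∀ x, f x ≠ 0 → ¬ p x) →
        f = h (bigD R X ε f) + bigD R X ε (h f) := by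
  have S := fun x => Classical.choice (hs x).nonempty_splitData
  refine ⟨pointwise fun x => (S x).H, fun n n' hn f hf => pointwise_H_mem S hn hf,
    fun f x hx => ?_, fun n f hf hp => funext fun x => ?_⟩
  · change act R (S x).H (f x) = 0
    rw [hx, map_zero]
  · have h1 := (S x).act_homotopy (hW x) fun c hc => (hf.2 x c hc).1
    have h2 : act R (vecMulVec (S x).u (S x).v) (f x) = 0 := by
      by_cases hx : f x = 0
      · rw [hx, map_zero]
      · rw [(S x).u_eq_zero (hp x hx), Matrix.zero_vecMulVec]
        funext c
        simp [act_apply]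
    rw [h2, sub_zero, add_comm] at h1
    exact h1.symm

/-- The coboundaries of a sum of split complexes form a free module: each projection to the
coboundaries is an idempotent matrix over the integers. -/
theorem free_map_bigD (hW : ∀ x, IsUpperSet (W x)) (hs : ∀ x, HasSplit ε (W x) (p x) (k x))
    {n n' : ℤ} (hn : n' + 1 = n) : Module.Free R ((cochains R W n').map (bigD R X ε)) := by
  classical
  have S := fun x => Classical.choice (hs x).nonempty_splitData
  choose l B A hAB hBA using fun x =>
    exists_factorization_of_idempotent _ ((S x).coboundaryProj_idem (hW x) n)
  let F : (Π₀ x, (Fin (l x) → R)) →ₗ[R] (X → Finset V → R) :=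
    { toFun := fun g x => act R (B x) (g x)
      map_add' := fun g g' => funext fun x => by simp
      map_smul' := fun a g => funext fun x => by simp }
  have hinj : Function.Injective F := by
    intro g g' h
    ext1 x
    have h1 : act R (A x) (act R (B x) (g x)) = act R (A x) (act R (B x) (g' x)) :=
      congrArg _ (congrFun h x)
    rwa [← act_mul, ← act_mul, hAB, act_one, act_one] at h1
  have hcard : ∀ (f : Finset V → R) c, act R (indMat {c | (c.card : ℤ) = n}) f c ≠ 0 →
      (c.card : ℤ) = n := fun f c hc => act_indMat_supp c hc
  have hrange : LinearMap.range F = (cochains R W n').map (bigD R X ε) := by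
    apply le_antisymm
    · rintro _ ⟨g, rfl⟩
      refine ⟨fun x => act R (S x).H (act R (indMat {c | (c.card : ℤ) = n})
        (act R (B x) (g x))), ⟨?_, fun x c hc => ⟨(S x).act_H_supp _ c hc, ?_⟩⟩, ?_⟩
      · refine (DFinsupp.finite_support g).subset fun x hx h => hx ?_
        simp only [h, map_zero]
      · have := act_raisesCard (S x).raisesCard (hcard (act R (B x) (g x))) c hc
        omega
      · funext x
        rw [bigD_apply, ← act_cobdOn_of_supp ε (hW x) ((S x).act_H_supp _), ← act_mul, ← act_mul]
        change act R ((S x).coboundaryProj n) (act R (B x) (g x)) = act R (B x) (g x)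
        rw [← hBA, act_mul, ← act_mul (A x), hAB, act_one]
    · rintro _ ⟨f, hf, rfl⟩
      have hdf := bigD_mem ε hW hn hf
      refine ⟨DFinsupp.mk hdf.1.toFinset fun x => act R (A x) (bigD R X ε f x), ?_⟩
      funext x
      change act R (B x) ((DFinsupp.mk hdf.1.toFinset
        fun x => act R (A x) (bigD R X ε f x) : Π₀ x, (Fin (l x) → R)) x) = bigD R X ε f x
      rw [DFinsupp.mk_apply]
      split_ifs with hx
      · have h1 : act R (indMat {c : Finset V | (c.card : ℤ) = n}) (bigD R X ε f x) =
            bigD R X ε f x := act_indMat_of_supp fun c hc => (hdf.2 x c hc).2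
        rw [← act_mul, hBA, SplitData.coboundaryProj, act_mul, h1, bigD_apply,
          ← act_cobdOn_of_supp ε (hW x) (fun c hc => (hf.2 x c hc).1), ← act_mul,
          (S x).cobdOn_H_cobdOn (hW x)]
      · rw [map_zero]
        simp only [Set.Finite.mem_toFinset, Set.mem_ofPred_eq, not_not] at hx
        exact hx.symm
  rw [← hrange]
  exact Module.Free.of_equiv (LinearEquiv.ofInjective F hinj)

end Big

/-! ### Coefficients at integral exponents -/

section IntCoeff

variable {R : Type*} [CommRing R] {σ : Type} [Fintype σ]

open scoped Classical in
/-- The coefficient of a polynomial at an integral exponent vector: zero unless all exponents are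
nonnegative. -/
noncomputable def intCoeff (β : σ → ℤ) : MvPolynomial σ R →ₗ[R] R :=
  if ∀ s, 0 ≤ β s then lcoeff R (Finsupp.equivFunOnFinite.symm fun s => (β s).toNat) else 0

theorem intCoeff_natCast (a : σ →₀ ℕ) (p : MvPolynomial σ R) :
    intCoeff (fun s => (a s : ℤ)) p = coeff a p := by
  rw [intCoeff, if_pos fun s => Int.natCast_nonneg _]
  change coeff _ p = _
  congr 1
  ext s
  simp

theorem intCoeff_of_neg {β : σ → ℤ} {s : σ} (h : β s < 0) (p : MvPolynomial σ R) :
    intCoeff β p = 0 := by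
  rw [intCoeff, if_neg fun h' => absurd (h' s) (not_le.mpr h)]
  rfl

theorem exists_natCast_or_neg (β : σ → ℤ) :
    (∃ a : σ →₀ ℕ, β = fun s => (a s : ℤ)) ∨ ∃ s, β s < 0 := by
  by_cases h : ∀ s, 0 ≤ β s
  · refine Or.inl ⟨Finsupp.equivFunOnFinite.symm fun s => (β s).toNat, funext fun s => ?_⟩
    simp [h s]
  · push Not at h
    exact Or.inr h

theorem nonneg_of_intCoeff_ne_zero {β : σ → ℤ} {p : MvPolynomial σ R} (h : intCoeff β p ≠ 0)
    (s : σ) : 0 ≤ β s := by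
  by_contra h'
  exact h (intCoeff_of_neg (not_le.mp h') p)

theorem ext_intCoeff {p q : MvPolynomial σ R} (h : ∀ β, intCoeff β p = intCoeff β q) : p = q := by
  ext a
  rw [← intCoeff_natCast, ← intCoeff_natCast, h]

theorem intCoeff_monomial_mul (a : σ →₀ ℕ) (p : MvPolynomial σ R) (β : σ → ℤ) :
    intCoeff β (monomial a 1 * p) = intCoeff (fun s => β s - a s) p := by
  rcases exists_natCast_or_neg β with ⟨b, rfl⟩ | ⟨s, hs⟩
  · rw [intCoeff_natCast, coeff_monomial_mul']
    split_ifs with h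
    · rw [one_mul, ← intCoeff_natCast]
      congr 2
      funext s
      rw [Finsupp.tsub_apply, Nat.cast_sub (h s)]
    · rw [Finsupp.le_def] at h
      push Not at h
      obtain ⟨s, hs⟩ := h
      rw [intCoeff_of_neg (s := s)]
      dsimp only
      omega
  · rw [intCoeff_of_neg hs, intCoeff_of_neg (s := s)]
    omega

theorem intCoeff_divMonomial (a : σ →₀ ℕ) (p : MvPolynomial σ R) {β : σ → ℤ}
    (hβ : ∀ s, 0 ≤ β s) :
    intCoeff β (p.divMonomial a) = intCoeff (fun s => β s + a s) p := by
  rcases exists_natCast_or_neg β with ⟨b, rfl⟩ | ⟨s, hs⟩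
  · rw [intCoeff_natCast, coeff_divMonomial, ← intCoeff_natCast]
    congr 2
    funext s
    rw [Finsupp.add_apply]
    push_cast
    ring
  · exact absurd (hβ s) (not_le.mpr hs)

theorem finite_intCoeff (p : MvPolynomial σ R) : {β : σ → ℤ | intCoeff β p ≠ 0}.Finite := by
  refine ((p.support.finite_toSet).image fun a s => (a s : ℤ)).subset fun β hβ => ?_
  rcases exists_natCast_or_neg β with ⟨b, rfl⟩ | ⟨s, hs⟩
  · refine ⟨b, ?_, rfl⟩
    rw [Finset.mem_coe, mem_support_iff, ← intCoeff_natCast]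
    exact hβ
  · exact absurd (intCoeff_of_neg hs p) hβ

/-- Polynomials are the finitely supported functions on the nonnegative exponents. -/
theorem exists_intCoeff_eq (g : (σ → ℤ) → R) (hfin : {β | g β ≠ 0}.Finite)
    (hg : ∀ β, g β ≠ 0 → ∀ s, 0 ≤ β s) : ∃ p : MvPolynomial σ R, ∀ β, intCoeff β p = g β := by
  classical
  have hinj : Function.Injective fun (a : σ →₀ ℕ) (s : σ) => (a s : ℤ) := by
    intro a b h
    ext s
    exact Nat.cast_injective (R := ℤ) (congrFun h s)
  have hfin' : {a : σ →₀ ℕ | g (fun s => (a s : ℤ)) ≠ 0}.Finite :=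
    hfin.preimage hinj.injOn
  refine ⟨∑ a ∈ hfin'.toFinset, monomial a (g fun s => (a s : ℤ)), fun β => ?_⟩
  rcases exists_natCast_or_neg β with ⟨b, rfl⟩ | ⟨s, hs⟩
  · rw [intCoeff_natCast, coeff_sum]
    simp only [coeff_monomial]
    rw [Finset.sum_ite_eq']
    split_ifs with h
    · rfl
    · simpa using Eq.symm (by simpa using h)
  · rw [intCoeff_of_neg hs]
    by_contra h
    exact absurd (hg β (Ne.symm h) s) (not_le.mpr hs)

end IntCoeff

section Homogeneous

variable {R : Type*} [CommRing R] {m : ℕ} {r : Fin m → ℕ}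

theorem weight_varDeg_apply (a : Var r →₀ ℕ) (i : Fin m) :
    Finsupp.weight (varDeg r) a i = ∑ k, (a ⟨i, k⟩ : ℤ) := by
  rw [Finsupp.weight_apply, Finsupp.sum_fintype _ _ (by simp), Finset.sum_apply,
    ← Finset.univ_sigma_univ, Finset.sum_sigma, Finset.sum_eq_single i]
  · simp [varDeg]
  · intro l _ hl
    simp [varDeg, hl.symm]
  · simp

theorem isWeightedHomogeneous_iff_intCoeff {p : CoordRing R r} {n : Fin m → ℤ} :
    IsWeightedHomogeneous (varDeg r) p n ↔
      ∀ β, intCoeff β p ≠ 0 → ∀ i, ∑ k, β ⟨i, k⟩ = n i := by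
  constructor
  · intro h β hβ i
    rcases exists_natCast_or_neg β with ⟨b, rfl⟩ | ⟨s, hs⟩
    · rw [intCoeff_natCast] at hβ
      rw [← weight_varDeg_apply, h hβ]
    · exact absurd (intCoeff_of_neg hs p) hβ
  · intro h a ha
    rw [← intCoeff_natCast] at ha
    funext i
    rw [weight_varDeg_apply]
    exact h _ ha i

end Homogeneous

/-! ### Laurent monomials and their families of cells -/

section Exponents

variable {m : ℕ} {r : Fin m → ℕ} {κ : Type}

/-- The Laurent monomials of degree zero in the summands `S(-d k)`, given by `k` and the exponent
vector. -/
abbrev LaurentExp (r : Fin m → ℕ) (d : κ → Fin m → ℤ) : Type :=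
  {x : κ × (Var r → ℤ) // ∀ i, ∑ k, x.2 ⟨i, k⟩ = -d x.1 i}

/-- The variables with negative exponent. -/
def negSupport {d : κ → Fin m → ℤ} (x : LaurentExp r d) : Finset (Var r) :=
  Finset.univ.filter fun s => x.1.2 s < 0

/-- In each block of variables all exponents have the same sign: the Laurent monomials that
contribute to the cohomology. -/
def IsCritical {d : κ → Fin m → ℤ} (x : LaurentExp r d) : Prop :=
  ∀ i, (∀ a, (⟨i, a⟩ : Var r) ∉ negSupport x) ∨ ∀ a, (⟨i, a⟩ : Var r) ∈ negSupport x

/-- The cohomological degree to which a critical Laurent monomial contributes: the sum of the `r i`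
over the blocks of variables with negative exponents. The truncated subtraction makes the other
blocks contribute zero. -/
def critDegree {d : κ → Fin m → ℤ} (x : LaurentExp r d) : ℕ :=
  ∑ i, (((negSupport x).filter fun s => s.1 = i).card - 1)

/-- The variables belonging to a cell. -/
def cellSet (c : ∀ i, Finset (Fin (r i + 1))) : Finset (Var r) := Finset.univ.sigma c

theorem mem_cellSet {c : ∀ i, Finset (Fin (r i + 1))} {s : Var r} :
    s ∈ cellSet c ↔ s.2 ∈ c s.1 := by
  simp [cellSet]

theorem cellSet_injective : Function.Injective (cellSet (r := r)) := by
  intro c c' h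
  funext i
  ext a
  have := Finset.ext_iff.mp h ⟨i, a⟩
  rwa [mem_cellSet, mem_cellSet] at this

theorem card_cellSet {j : ℤ} (c : Cell r j) : ((cellSet c.1).card : ℤ) = j + m := by
  have h := c.2.2
  rw [Finset.sum_sub_distrib] at h
  rw [cellSet, Finset.card_sigma, ← sub_eq_iff_eq_add]
  refine Eq.trans ?_ h
  simp

theorem exists_cellSet_eq {j : ℤ} {F : Finset (Var r)} (h1 : ∀ i, ∃ s ∈ F, s.1 = i)
    (h2 : (F.card : ℤ) = j + m) : ∃ c : Cell r j, cellSet c.1 = F := by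
  let c : ∀ i, Finset (Fin (r i + 1)) := fun i => Finset.univ.filter fun a => ⟨i, a⟩ ∈ F
  have hc : cellSet c = F := by
    ext s
    simp [mem_cellSet, c]
  refine ⟨⟨c, fun i => ?_, ?_⟩, hc⟩
  · obtain ⟨s, hs, rfl⟩ := h1 i
    exact ⟨s.2, by simpa [c] using hs⟩
  · rw [← hc, cellSet, Finset.card_sigma] at h2
    rw [Finset.sum_sub_distrib]
    push_cast at h2
    rw [h2]
    simp

/-- The signs of the Koszul differentials. The blocks are ordered lexicographically; the `i`-th
block contributes an additional sign `(-1)^i` since its complex is truncated. -/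
def cellSign (r : Fin m → ℕ) : ContractionSign (Var r) :=
  ContractionSign.ofOrder (L := Σₗ i : Fin m, Fin (r i + 1)) toLex toLex.injective
    (fun s => (-1) ^ (s.1 : ℕ)) fun s => by rw [← pow_add, ← two_mul, pow_mul]; simp

theorem cellSign_cellSet {c : ∀ i, Finset (Fin (r i + 1))} (hc : ∀ i, (c i).Nonempty)
    (s : Var r) : (cellSign r).sign (cellSet c) s = contractSign c s := by
  have hset : ((cellSet c).filter fun t => (toLex t : Σₗ i : Fin m, Fin (r i + 1)) < toLex s) =
      (Finset.univ.filter (· < s.1)).sigma c ∪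
        ((c s.1).filter (· < s.2)).map ⟨Sigma.mk s.1, sigma_mk_injective⟩ := by
    ext t
    obtain ⟨i, a⟩ := s
    obtain ⟨l, b⟩ := t
    simp only [Finset.mem_filter, mem_cellSet, Finset.mem_union, Finset.mem_sigma,
      Finset.mem_univ, true_and, Finset.mem_map, Function.Embedding.coeFn_mk, Sigma.Lex.lt_def]
    constructor
    · rintro ⟨h1, h2 | ⟨h2, h3⟩⟩
      · exact Or.inl ⟨h2, h1⟩
      · obtain rfl : l = i := h2
        exact Or.inr ⟨b, ⟨h1, h3⟩, rfl⟩
    · rintro (⟨h1, h2⟩ | ⟨b', ⟨h1, h2⟩, h3⟩)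
      · exact ⟨h2, Or.inl h1⟩
      · obtain ⟨rfl, h4⟩ := Sigma.mk.inj_iff.mp h3
        obtain rfl := eq_of_heq h4
        exact ⟨h1, Or.inr ⟨rfl, h2⟩⟩
  have hdisj : Disjoint ((Finset.univ.filter (· < s.1)).sigma c)
      (((c s.1).filter (· < s.2)).map ⟨Sigma.mk s.1, sigma_mk_injective⟩) := by
    rw [Finset.disjoint_left]
    intro t ht ht'
    simp only [Finset.mem_sigma, Finset.mem_filter, Finset.mem_univ, true_and, Finset.mem_map,
      Function.Embedding.coeFn_mk] at ht ht'
    obtain ⟨b, -, rfl⟩ := ht'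
    exact lt_irrefl _ ht.1
  have hsum : ∑ l ∈ Finset.univ.filter (· < s.1), (c l).card =
      ∑ l ∈ Finset.univ.filter (· < s.1), ((c l).card - 1) + s.1 := by
    have h1 : ∑ l ∈ Finset.univ.filter (· < s.1), (c l).card =
        ∑ l ∈ Finset.univ.filter (· < s.1), (((c l).card - 1) + 1) :=
      Finset.sum_congr rfl fun l _ => (Nat.sub_add_cancel (hc l).card_pos).symm
    rw [h1, Finset.sum_add_distrib]
    simp [Finset.filter_gt_eq_Iio]
  change (-1 : ℤ) ^ (s.1 : ℕ) * (-1) ^ ((cellSet c).filter fun t =>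
    (toLex t : Σₗ i : Fin m, Fin (r i + 1)) < toLex s).card = _
  rw [hset, Finset.card_union_of_disjoint hdisj, Finset.card_sigma, Finset.card_map, hsum,
    contractSign, ← pow_add]
  rw [show (s.1 : ℕ) + (∑ l ∈ Finset.univ.filter (· < s.1), ((c l).card - 1) + s.1 +
      ((c s.1).filter (· < s.2)).card) = (∑ l ∈ Finset.univ.filter (· < s.1), ((c l).card - 1) +
      ((c s.1).filter (· < s.2)).card) + 2 * s.1 by ring, pow_add, pow_mul]
  simp

/-- The sets of variables that occur as cells on which a Laurent monomial is supported. -/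
def cellFamily {d : κ → Fin m → ℤ} (x : LaurentExp r d) : Set (Finset (Var r)) :=
  blockFamily Sigma.fst Finset.univ (negSupport x)

theorem isUpperSet_cellFamily {d : κ → Fin m → ℤ} (x : LaurentExp r d) :
    IsUpperSet (cellFamily x) := by
  rintro a b hab ⟨h1, -, h3⟩
  refine ⟨h1.trans hab, fun _ _ => Finset.mem_univ _, fun i hi => ?_⟩
  obtain ⟨s, hs, hsi⟩ := h3 i hi
  exact ⟨s, hab hs, hsi⟩

/-- A cell of degree `j` has `j + m` elements, hence the shift by `m`. -/
theorem hasSplit_cellFamily {d : κ → Fin m → ℤ} (x : LaurentExp r d) :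
    HasSplit (cellSign r) (cellFamily x) (IsCritical x) (critDegree x + m) := by
  by_cases h : IsCritical x
  · have h1 := blockFamily_sphere (ε := cellSign r) (bl := Sigma.fst)
      (fun i => ⟨⟨i, 0⟩, rfl⟩) (negSupport x) Finset.univ (fun _ _ => Finset.mem_univ _)
      (fun i _ => (h i).imp (fun h s hs hsi => ?_) fun h s hsi => ?_)
    · have h2 : (negSupport x).card +
          (Finset.univ.filter fun i : Fin m => ∀ s ∈ negSupport x, s.1 ≠ i).card =
          critDegree x + m := by
        have h3 : (negSupport x).card =
            ∑ i, ((negSupport x).filter fun s => s.1 = i).card :=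
          Finset.card_eq_sum_card_fiberwise fun _ _ => Finset.mem_univ _
        have h4 : m = ∑ i : Fin m, 1 := by simp
        refine Eq.trans ?_ (congrArg (critDegree x + ·) h4.symm)
        rw [h3, critDegree, Finset.card_filter, ← Finset.sum_add_distrib, ← Finset.sum_add_distrib]
        refine Finset.sum_congr rfl fun i _ => ?_
        split_ifs with h5
        · rw [Finset.card_eq_zero.mpr (Finset.filter_eq_empty_iff.mpr fun s hs => h5 s hs)]
        · push Not at h5
          obtain ⟨s, hs, hsi⟩ := h5
          have : 0 < ((negSupport x).filter fun s => s.1 = i).card :=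
            Finset.card_pos.mpr ⟨s, Finset.mem_filter.mpr ⟨hs, hsi⟩⟩
          omega
      rw [h2] at h1
      exact h1.of_true h
    · obtain ⟨l, a⟩ := s
      dsimp at hsi
      subst hsi
      exact h a hs
    · obtain ⟨l, a⟩ := s
      dsimp at hsi
      subst hsi
      exact h a
  · have h' := h
    rw [IsCritical] at h'
    push Not at h'
    obtain ⟨i, ⟨a, ha⟩, b, hb⟩ := h'
    exact (blockFamily_acyclic hb ha rfl 0).of_false h _

end Exponents

/-! ### The strands as families of cochains -/

section HomCoeff

variable {R : Type*} [CommRing R] {m : ℕ} {r : Fin m → ℕ} {κ : Type} {d : κ → Fin m → ℤ}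

theorem sum_cellExp (e : Fin m → ℕ) {j : ℤ} (c : Cell r j) (i : Fin m) :
    ∑ k, (cellExp e c ⟨i, k⟩ : ℤ) = cellDeg e c i := by
  rw [← weight_varDeg_apply, weight_cellExp]

theorem cellExp_apply (e : Fin m → ℕ) {j : ℤ} (c : Cell r j) (s : Var r) :
    cellExp e c s = if s ∈ cellSet c.1 then e s.1 else 0 := by
  simp [cellExp, mem_cellSet]

theorem single_mem_strand (e : Fin m → ℕ) {j : ℤ} (c : Cell r j) :
    (Pi.single c 1 : Kosz R r j) ∈ strand R r (cellDeg e) (cellDeg e c) := by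
  intro c'
  by_cases hc : c' = c
  · subst hc
    simpa using isWeightedHomogeneous_one R (varDeg r)
  · simpa [hc] using isWeightedHomogeneous_zero R (varDeg r) _

theorem homZero_ext {e : Fin m → ℕ} {j : ℤ} {φ ψ : homZero R r d e j}
    (h : ∀ c k, φ.1 (Pi.single c 1) k = ψ.1 (Pi.single c 1) k) : φ = ψ := by
  apply Subtype.ext
  refine LinearMap.pi_ext' fun c => LinearMap.ext_ring ?_
  funext k
  exact h c k

/-- The coefficients of a map `φ` in `Hom(K_{≤ e}^j, M)_0` as a family of cochains: the value at the
generator of the cell `c` is divided by `∏_i ∏_{k ∈ c i} x_{i,k}^{e i}`. With this normalisation the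
inclusions `ι` become identities. -/
noncomputable def homCoeff (d : κ → Fin m → ℤ) (e : Fin m → ℕ) (j : ℤ) :
    homZero R r d e j →ₗ[R] (LaurentExp r d → Finset (Var r) → R) where
  toFun φ x F := ∑ c : Cell r j, if cellSet c.1 = F then
    intCoeff (fun s => x.1.2 s + cellExp e c s) (φ.1 (Pi.single c 1) x.1.1) else 0
  map_add' φ ψ := by
    funext x F
    simp only [Pi.add_apply]
    rw [← Finset.sum_add_distrib]
    refine Finset.sum_congr rfl fun c _ => ?_
    split_ifs
    · simp
    · simp
  map_smul' a φ := by
    funext x F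
    simp only [Pi.smul_apply, smul_eq_mul, RingHom.id_apply]
    rw [Finset.mul_sum]
    refine Finset.sum_congr rfl fun c _ => ?_
    split_ifs
    · simp
    · simp

theorem homCoeff_sub {e : Fin m → ℕ} {j : ℤ} (φ ψ : homZero R r d e j) :
    homCoeff d e j (φ - ψ) = homCoeff d e j φ - homCoeff d e j ψ :=
  map_sub (homCoeff d e j) φ ψ

theorem homCoeff_cellSet (e : Fin m → ℕ) {j : ℤ} (φ : homZero R r d e j) (x : LaurentExp r d)
    (c : Cell r j) : homCoeff d e j φ x (cellSet c.1) =
      intCoeff (fun s => x.1.2 s + cellExp e c s) (φ.1 (Pi.single c 1) x.1.1) := by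
  change ∑ c' : Cell r j, _ = _
  rw [Finset.sum_eq_single c]
  · rw [if_pos rfl]
  · intro c' _ hc'
    exact if_neg fun h => hc' (Subtype.ext (cellSet_injective h))
  · simp

theorem homCoeff_eq_zero (e : Fin m → ℕ) {j : ℤ} (φ : homZero R r d e j) (x : LaurentExp r d)
    {F : Finset (Var r)} (hF : ∀ c : Cell r j, cellSet c.1 ≠ F) : homCoeff d e j φ x F = 0 :=
  Finset.sum_eq_zero fun c _ => if_neg (hF c)

theorem exists_cell_of_homCoeff_ne_zero {e : Fin m → ℕ} {j : ℤ} {φ : homZero R r d e j}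
    {x : LaurentExp r d} {F : Finset (Var r)} (h : homCoeff d e j φ x F ≠ 0) :
    ∃ c : Cell r j, cellSet c.1 = F := by
  by_contra h'
  push Not at h'
  exact h (homCoeff_eq_zero e φ x h')

theorem neg_le_of_homCoeff_ne_zero {e : Fin m → ℕ} {j : ℤ} {φ : homZero R r d e j}
    {x : LaurentExp r d} {F : Finset (Var r)} (h : homCoeff d e j φ x F ≠ 0) (s : Var r) :
    -(e s.1 : ℤ) ≤ x.1.2 s := by
  obtain ⟨c, rfl⟩ := exists_cell_of_homCoeff_ne_zero h
  rw [homCoeff_cellSet] at h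
  have h1 := nonneg_of_intCoeff_ne_zero h s
  rw [cellExp_apply] at h1
  split_ifs at h1 <;> omega

theorem homCoeff_injective (e : Fin m → ℕ) (j : ℤ) :
    Function.Injective (homCoeff (R := R) (r := r) d e j) := by
  intro φ ψ h
  refine homZero_ext fun c k => ext_intCoeff fun β => ?_
  by_cases hβ : ∀ i, ∑ a, (β ⟨i, a⟩ - cellExp e c ⟨i, a⟩) = -d k i
  · have h1 := congrFun (congrFun h ⟨(k, fun s => β s - cellExp e c s), hβ⟩) (cellSet c.1)
    rw [homCoeff_cellSet, homCoeff_cellSet] at h1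
    simpa using h1
  · have h0 : ∀ φ : homZero R r d e j, intCoeff β (φ.1 (Pi.single c 1) k) = 0 := by
      intro φ
      by_contra h1
      refine hβ fun i => ?_
      have h2 := isWeightedHomogeneous_iff_intCoeff.mp
        (φ.2 _ _ (single_mem_strand e c) k) β h1 i
      rw [Finset.sum_sub_distrib, h2, sum_cellExp]
      simp
    rw [h0, h0]

/-- The monomials occurring at a cell have nonnegative exponents at all variables outside of it. -/
theorem homCoeff_mem [Finite κ] (e : Fin m → ℕ) (j : ℤ) (φ : homZero R r d e j) :
    homCoeff d e j φ ∈ cochains R cellFamily (j + m) := by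
  constructor
  · have hfin : (⋃ k : κ, ⋃ c : Cell r j,
        (fun β : Var r → ℤ => (k, fun s => β s - cellExp e c s)) ''
          {β | intCoeff β (φ.1 (Pi.single c 1) k) ≠ 0}).Finite :=
      Set.finite_iUnion fun k => Set.finite_iUnion fun c => (finite_intCoeff _).image _
    refine (hfin.preimage (f := Subtype.val) Subtype.val_injective.injOn).subset fun x hx => ?_
    obtain ⟨F, hF⟩ := Function.ne_iff.mp hx
    obtain ⟨c, rfl⟩ := exists_cell_of_homCoeff_ne_zero hF
    rw [homCoeff_cellSet] at hF
    simp only [Set.mem_preimage, Set.mem_iUnion]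
    refine ⟨x.1.1, c, _, hF, Prod.ext rfl (funext fun s => ?_)⟩
    simp
  · intro x F hF
    obtain ⟨c, rfl⟩ := exists_cell_of_homCoeff_ne_zero hF
    refine ⟨⟨fun s hs => ?_, fun _ _ => Finset.mem_univ _, fun i _ => ?_⟩, card_cellSet c⟩
    · rw [homCoeff_cellSet] at hF
      by_contra hsc
      have h1 := nonneg_of_intCoeff_ne_zero hF s
      rw [cellExp_apply, if_neg hsc] at h1
      have h2 := (Finset.mem_filter.mp hs).2
      simp only [Nat.cast_zero, add_zero] at h1
      omega
    · obtain ⟨a, ha⟩ := c.2.1 i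
      exact ⟨⟨i, a⟩, mem_cellSet.mpr ha, rfl⟩

theorem exists_homCoeff_eq (e : Fin m → ℕ) (j : ℤ)
    {f : LaurentExp r d → Finset (Var r) → R} (hf : f ∈ cochains R cellFamily (j + m))
    (he : ∀ x, f x ≠ 0 → ∀ s, -(e s.1 : ℤ) ≤ x.1.2 s) :
    ∃ φ : homZero R r d e j, homCoeff d e j φ = f := by
  classical
  have hP : ∀ (c : Cell r j) (k : κ), ∃ P : CoordRing R r, ∀ β, intCoeff β P =
      if h : ∀ i, ∑ a, (β ⟨i, a⟩ - cellExp e c ⟨i, a⟩) = -d k i then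
        f ⟨(k, fun s => β s - cellExp e c s), h⟩ (cellSet c.1) else 0 := by
    intro c k
    refine exists_intCoeff_eq _ ?_ ?_
    · refine ((hf.1.image fun x : LaurentExp r d => fun s =>
        x.1.2 s + cellExp e c s)).subset fun β hβ => ?_
      by_cases h : ∀ i, ∑ a, (β ⟨i, a⟩ - cellExp e c ⟨i, a⟩) = -d k i
      · rw [Set.mem_ofPred_eq, dif_pos h] at hβ
        refine ⟨_, fun h0 => hβ (congrFun h0 _), funext fun s => ?_⟩
        simp
      · exact absurd (dif_neg h) hβ
    · intro β hβ s
      by_cases h : ∀ i, ∑ a, (β ⟨i, a⟩ - cellExp e c ⟨i, a⟩) = -d k i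
      · rw [dif_pos h] at hβ
        have h1 := he _ (fun h0 => hβ (congrFun h0 _)) s
        have h2 := (hf.2 _ _ hβ).1.1
        dsimp only at h1
        by_cases hs : s ∈ cellSet c.1
        · rw [cellExp_apply, if_pos hs] at h1
          omega
        · by_contra h3
          refine hs (h2 (Finset.mem_filter.mpr ⟨Finset.mem_univ _, ?_⟩))
          dsimp only
          rw [cellExp_apply, if_neg hs]
          push_cast
          omega
      · exact absurd (dif_neg h) hβ
  choose P hP using hP
  refine ⟨⟨Fintype.linearCombination (CoordRing R r) P, fun n v hv k => ?_⟩, ?_⟩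
  · rw [Fintype.linearCombination_apply, Finset.sum_apply]
    refine IsWeightedHomogeneous.sum _ _ _ fun c _ => ?_
    have h1 : IsWeightedHomogeneous (varDeg r) (P c k) (cellDeg e c - d k) := by
      refine isWeightedHomogeneous_iff_intCoeff.mpr fun β hβ i => ?_
      rw [hP] at hβ
      by_cases h : ∀ i, ∑ a, (β ⟨i, a⟩ - cellExp e c ⟨i, a⟩) = -d k i
      · have h2 := h i
        rw [Finset.sum_sub_distrib, sum_cellExp] at h2
        rw [Pi.sub_apply]
        omega
      · exact absurd (dif_neg h) hβ
    have h3 := (hv c).mul h1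
    rwa [show n - cellDeg e c + (cellDeg e c - d k) = n - d k by abel] at h3
  · funext x F
    by_cases hF : ∃ c : Cell r j, cellSet c.1 = F
    · obtain ⟨c, rfl⟩ := hF
      rw [homCoeff_cellSet]
      have h1 : Fintype.linearCombination (CoordRing R r) P (Pi.single c 1) = P c := by
        rw [Fintype.linearCombination_apply_single, one_smul]
      change intCoeff _ (Fintype.linearCombination (CoordRing R r) P (Pi.single c 1) x.1.1) = _
      rw [h1, hP]
      simp only [add_sub_cancel_right]
      rw [dif_pos x.2]
    · push Not at hF
      rw [homCoeff_eq_zero _ _ _ hF]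
      by_contra h
      obtain ⟨⟨-, -, h1⟩, h2⟩ := hf.2 x F (Ne.symm h)
      obtain ⟨c, hc⟩ := exists_cellSet_eq (fun i => h1 i (Finset.mem_univ i)) h2
      exact hF c hc

theorem homCoeff_homIncl (e e' : Fin m → ℕ) (h : e ≤ e') (j : ℤ) (φ : homZero R r d e j) :
    homCoeff d e' j (homIncl R r d j e e' h φ) = homCoeff d e j φ := by
  funext x F
  refine Finset.sum_congr rfl fun c _ => ?_
  split_ifs with hF
  · have h1 : koszTrans R r e e' j (Pi.single c 1) =
        (monomial (cellExp (e' - e) c) 1 : CoordRing R r) • Pi.single c 1 := by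
      funext c'
      rw [koszTrans, Matrix.mulVecLin_apply, Matrix.mulVec_diagonal]
      by_cases hc : c' = c
      · subst hc
        simp
      · simp [hc]
    change intCoeff _ (φ.1 (koszTrans R r e e' j (Pi.single c 1)) x.1.1) = _
    rw [h1, map_smul, Pi.smul_apply, smul_eq_mul, intCoeff_monomial_mul]
    congr 2
    funext s
    rw [cellExp_apply, cellExp_apply, cellExp_apply]
    have := h s.1
    split_ifs
    · rw [Pi.sub_apply, Nat.cast_sub this]
      ring
    · ring
  · rfl

theorem homCoeff_homD (e : Fin m → ℕ) {j j' : ℤ} (hj : j + 1 = j') (φ : homZero R r d e j) :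
    homCoeff d e j' (homD R r d e j j' φ) = bigD R _ (cellSign r) (homCoeff d e j φ) := by
  funext x F
  rw [bigD_apply_apply]
  by_cases hF : ∃ c : Cell r j', cellSet c.1 = F
  · obtain ⟨c, rfl⟩ := hF
    rw [homCoeff_cellSet]
    have h1 : koszD R r e j' j (Pi.single c 1) =
        ∑ c' : Cell r j, koszMatrix R r e j' j c' c • Pi.single c' 1 := by
      funext c'
      rw [koszD, Matrix.mulVecLin_apply, Matrix.mulVec_single_one, Finset.sum_apply,
        Finset.sum_eq_single c']
      · simp [Matrix.col_apply]
      · intro b _ hb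
        simp [hb.symm]
      · simp
    change intCoeff _ (φ.1 (koszD R r e j' j (Pi.single c 1)) x.1.1) = _
    rw [h1, map_sum, Finset.sum_apply, map_sum]
    have h2 : ∀ c' : Cell r j, intCoeff (fun s => x.1.2 s + cellExp e c s)
        (φ.1 (koszMatrix R r e j' j c' c • Pi.single c' 1) x.1.1) =
        ∑ s ∈ cellSet c.1, if cellSet c'.1 = (cellSet c.1).erase s then
          ((cellSign r).sign (cellSet c.1) s : R) * homCoeff d e j φ x (cellSet c'.1) else 0 := by
      intro c'
      rw [map_smul, Pi.smul_apply, smul_eq_mul, koszMatrix, Finset.sum_mul, map_sum,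
        ← Finset.sum_subset (Finset.subset_univ (cellSet c.1))]
      · refine Finset.sum_congr rfl fun s hs => ?_
        have hiff : (s.2 ∈ c.1 s.1 ∧
            c'.1 = Function.update c.1 s.1 ((c.1 s.1).erase s.2)) ↔
            cellSet c'.1 = (cellSet c.1).erase s := by
          have h3 : (cellSet c.1).erase s =
              cellSet (Function.update c.1 s.1 ((c.1 s.1).erase s.2)) := by
            ext t
            rw [Finset.mem_erase, mem_cellSet, mem_cellSet]
            obtain ⟨i, a⟩ := s
            obtain ⟨l, b⟩ := t
            by_cases hl : l = i
            · subst hl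
              simp
            · simp [hl]
          rw [h3]
          exact ⟨fun h => congrArg _ h.2, fun h => ⟨mem_cellSet.mp hs, cellSet_injective h⟩⟩
        by_cases h4 : cellSet c'.1 = (cellSet c.1).erase s
        · rw [if_pos (hiff.mpr h4), if_pos h4, homCoeff_cellSet, cellSign_cellSet c.2.1,
            X_pow_eq_monomial]
          have h5 : ((contractSign c.1 s : ℤ) : CoordRing R r) =
              C ((contractSign c.1 s : ℤ) : R) := by simp
          rw [h5, mul_assoc, ← smul_eq_C_mul, map_smul, smul_eq_mul, intCoeff_monomial_mul]
          congr 3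
          funext t
          rw [cellExp_apply, cellExp_apply, h4]
          by_cases hts : t = s
          · subst hts
            simp [hs]
          · simp [hts]
        · rw [if_neg (fun h => h4 (hiff.mp h)), if_neg h4, zero_mul, map_zero]
      · intro s _ hs
        rw [if_neg (fun h => hs (mem_cellSet.mpr h.1)), zero_mul, map_zero]
    rw [Finset.sum_congr rfl fun c' _ => h2 c', Finset.sum_comm]
    refine Finset.sum_congr rfl fun s _ => ?_
    by_cases hs : ∃ c' : Cell r j, cellSet c'.1 = (cellSet c.1).erase s
    · obtain ⟨c', hc'⟩ := hs
      rw [Finset.sum_eq_single c', if_pos hc', hc']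
      · intro b _ hb
        exact if_neg fun h => hb (Subtype.ext (cellSet_injective (h.trans hc'.symm)))
      · simp
    · push Not at hs
      rw [homCoeff_eq_zero e φ x hs, mul_zero]
      exact Finset.sum_eq_zero fun c' _ => if_neg (hs c')
  · push Not at hF
    rw [homCoeff_eq_zero _ _ _ hF, Finset.sum_eq_zero]
    intro s hs
    rw [homCoeff_eq_zero, mul_zero]
    intro c' hc'
    -- a set with a cell as a face is a cell
    obtain ⟨c, hc⟩ := exists_cellSet_eq (r := r) (F := F) (j := j') (fun i => by
        obtain ⟨a, ha⟩ := c'.2.1 i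
        refine ⟨⟨i, a⟩, Finset.mem_of_mem_erase (a := s) ?_, rfl⟩
        rw [← hc']
        exact mem_cellSet.mpr ha) (by
        have h1 := card_cellSet c'
        rw [hc', Finset.card_erase_of_mem hs] at h1
        have h2 := Finset.card_pos.mpr ⟨s, hs⟩
        omega)
    exact hF c hc

open scoped Classical in
/-- Dividing by monomials and forgetting remainders forgets the Laurent monomials whose exponents
are not all at least `-e i`. -/
theorem homCoeff_homProj (e e' : Fin m → ℕ) (h : e ≤ e') (j : ℤ) (φ : homZero R r d e' j)
    (x : LaurentExp r d) : homCoeff d e j (homProj R r d j e e' h φ) x =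
      if ∀ s : Var r, -(e s.1 : ℤ) ≤ x.1.2 s then homCoeff d e' j φ x else 0 := by
  funext F
  by_cases hF : ∃ c : Cell r j, cellSet c.1 = F
  · obtain ⟨c, rfl⟩ := hF
    rw [homCoeff_cellSet]
    have h1 : (homProj R r d j e e' h φ).1 (Pi.single c 1) x.1.1 =
        (φ.1 (Pi.single c 1) x.1.1).divMonomial (cellExp (e' - e) c) := by
      change Fintype.linearCombination (CoordRing R r) (fun (c : Cell r j) k =>
        (φ.1 (Pi.single c 1) k).divMonomial (cellExp (e' - e) c)) (Pi.single c 1) x.1.1 = _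
      rw [Fintype.linearCombination_apply_single, one_smul]
    have h2 : (fun s => x.1.2 s + (cellExp e c s : ℤ) + (cellExp (e' - e) c s : ℤ)) =
        fun s => x.1.2 s + (cellExp e' c s : ℤ) := by
      funext s
      rw [cellExp_apply, cellExp_apply, cellExp_apply]
      have := h s.1
      split_ifs
      · rw [Pi.sub_apply, Nat.cast_sub this]
        ring
      · ring
    rw [h1]
    by_cases h3 : ∀ s, 0 ≤ x.1.2 s + (cellExp e c s : ℤ)
    · rw [intCoeff_divMonomial _ _ h3, h2, if_pos, homCoeff_cellSet]
      intro s
      have := h3 s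
      rw [cellExp_apply] at this
      split_ifs at this <;> omega
    · push Not at h3
      obtain ⟨s, hs⟩ := h3
      rw [intCoeff_of_neg (β := fun s => x.1.2 s + (cellExp e c s : ℤ)) hs]
      split_ifs with h4
      · rw [homCoeff_cellSet, intCoeff_of_neg (s := s)]
        have := h4 s
        rw [cellExp_apply] at hs ⊢
        split_ifs at hs ⊢ <;> omega
      · rfl
  · push Not at hF
    rw [homCoeff_eq_zero _ _ _ hF]
    split_ifs
    · rw [homCoeff_eq_zero _ _ _ hF]
    · rfl

end HomCoeff

/-! ### The sections on the charts as families of cochains -/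

section Charts

variable {R : Type*} [CommRing R] {m : ℕ} {r : Fin m → ℕ} {κ : Type} {d : κ → Fin m → ℤ}

/-- The exponent vector of the equation of the complement of `⋂_{v ∈ J} D(h_v)`. -/
noncomputable def chartExp (J : Finset (Chart r)) : Var r →₀ ℕ :=
  Finsupp.equivFunOnFinite.symm fun s => (J.filter fun v => v s.1 = s.2).card

theorem chartExp_apply (J : Finset (Chart r)) (s : Var r) :
    chartExp J s = (J.filter fun v => v s.1 = s.2).card := rfl

theorem chartEq_eq_monomial (J : Finset (Chart r)) :
    chartEq R r J = monomial (chartExp J) 1 := by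
  have h : chartExp J = ∑ v ∈ J, ∑ i, Finsupp.single (⟨i, v i⟩ : Var r) 1 := by
    ext s
    rw [chartExp_apply, Finset.card_filter, Finsupp.finsetSum_apply]
    refine Finset.sum_congr rfl fun v _ => ?_
    rw [Finsupp.finsetSum_apply, Finset.sum_eq_single s.1]
    · obtain ⟨i, a⟩ := s
      by_cases hv : v i = a
      · simp [hv]
      · have : ¬ (⟨i, v i⟩ : Var r) = ⟨i, a⟩ := by simpa using hv
        simp [hv]
    · intro i _ hi
      exact Finsupp.single_eq_of_ne fun h => hi (by rw [h])
    · simp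
  rw [h, chartEq, monomial_sum_one]
  refine Finset.prod_congr rfl fun v _ => ?_
  rw [monomial_sum_one]
  rfl

theorem sum_chartExp (J : Finset (Chart r)) (i : Fin m) :
    ∑ k, (chartExp J ⟨i, k⟩ : ℤ) = J.card := by
  have h := Finset.card_eq_sum_card_fiberwise (s := J) (t := Finset.univ) (f := fun v => v i)
    fun _ _ => Finset.mem_univ _
  rw [h]
  push_cast
  rfl

theorem intCoeff_chartEq_pow_mul (J : Finset (Chart r)) (t : ℕ) (p : CoordRing R r)
    (β : Var r → ℤ) : intCoeff β (chartEq R r J ^ t * p) =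
      intCoeff (fun s => β s - t * chartExp J s) p := by
  rw [chartEq_eq_monomial, monomial_pow, one_pow, intCoeff_monomial_mul]
  congr 2

/-- The coefficients of a fraction `a / f^t`, `f = ∏_{v ∈ J} h_v`, at the Laurent monomials. The
chosen exponent `t` of a power of `f` does not matter, by `locCoeff_mk`. -/
noncomputable def locCoeff (J : Finset (Chart r)) (z : LocMod R r κ J) (k : κ) (α : Var r → ℤ) :
    R :=
  LocalizedModule.liftOn z
    (fun p => intCoeff (fun s => α s + (Classical.choose p.2.2 : ℕ) * chartExp J s) (p.1 k)) <| by
      rintro ⟨a, s⟩ ⟨b, s'⟩ ⟨u, h⟩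
      -- the coefficients of both sides of `h` are those of the two fractions, shifted by the
      -- exponents of the denominators
      have h1 := congrArg (fun w : κ → CoordRing R r => intCoeff (fun v => α v +
        (((Classical.choose u.2 : ℕ) : ℤ) + (Classical.choose s.2 : ℕ) +
          (Classical.choose s'.2 : ℕ)) * chartExp J v) (w k)) h
      have hu := Classical.choose_spec u.2
      have hs := Classical.choose_spec s.2
      have hs' := Classical.choose_spec s'.2
      dsimp only at hu hs hs' h1 ⊢
      generalize Classical.choose u.2 = nu at *
      generalize Classical.choose s.2 = ns at *
      generalize Classical.choose s'.2 = ns' at *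
      simp only [Submonoid.smul_def, ← hu, ← hs, ← hs', Pi.smul_apply, smul_eq_mul,
        intCoeff_chartEq_pow_mul] at h1
      convert h1 using 3 <;> exact funext fun _ => by ring

theorem locCoeff_mk (J : Finset (Chart r)) (a : κ → CoordRing R r) (t : ℕ) (k : κ)
    (α : Var r → ℤ) :
    locCoeff J (LocalizedModule.mk a
      (⟨chartEq R r J ^ t, t, rfl⟩ : Submonoid.powers (chartEq R r J))) k α =
      intCoeff (fun s => α s + t * chartExp J s) (a k) := by
  have ht : chartEq R r J ^ t ∈ Submonoid.powers (chartEq R r J) := ⟨t, rfl⟩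
  change intCoeff (fun s => α s + (Classical.choose ht : ℕ) * chartExp J s) (a k) = _
  have h := Classical.choose_spec ht
  dsimp only at h
  generalize Classical.choose ht = n at *
  have h1 := congrArg
    (fun p => intCoeff (fun s => α s + ((n : ℤ) + t) * chartExp J s) (p * a k)) h
  simp only [intCoeff_chartEq_pow_mul] at h1
  convert h1.symm using 3 <;> exact funext fun _ => by ring

theorem locCoeff_add (J : Finset (Chart r)) {z w : LocMod R r κ J} (hz : z ∈ chartSections R r d J)
    (hw : w ∈ chartSections R r d J) (k : κ) (α : Var r → ℤ) :
    locCoeff J (z + w) k α = locCoeff J z k α + locCoeff J w k α := by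
  obtain ⟨t, a, -, rfl⟩ := hz
  obtain ⟨t', a', -, rfl⟩ := hw
  have h : (⟨chartEq R r J ^ t, t, rfl⟩ : Submonoid.powers (chartEq R r J)) *
      ⟨chartEq R r J ^ t', t', rfl⟩ = ⟨chartEq R r J ^ (t + t'), t + t', rfl⟩ :=
    Subtype.ext (pow_add _ _ _).symm
  rw [LocalizedModule.mk_add_mk, h, locCoeff_mk, locCoeff_mk, locCoeff_mk]
  simp only [Submonoid.smul_def, Pi.add_apply, Pi.smul_apply, smul_eq_mul, map_add,
    intCoeff_chartEq_pow_mul]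
  push_cast
  congr 3 <;> funext s <;> ring

theorem locCoeff_smul (J : Finset (Chart r)) {z : LocMod R r κ J} (hz : z ∈ chartSections R r d J)
    (b : R) (k : κ) (α : Var r → ℤ) : locCoeff J (b • z) k α = b * locCoeff J z k α := by
  obtain ⟨t, a, -, rfl⟩ := hz
  rw [LocalizedModule.smul'_mk, locCoeff_mk, locCoeff_mk, Pi.smul_apply, map_smul, smul_eq_mul]

theorem locRes_mk {J J' : Finset (Chart r)} (h : J ⊆ J') (a : κ → CoordRing R r) (t : ℕ) :
    locRes R r κ h (LocalizedModule.mk a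
      (⟨chartEq R r J ^ t, t, rfl⟩ : Submonoid.powers (chartEq R r J))) =
      LocalizedModule.mk (chartEq R r (J' \ J) ^ t • a)
        (⟨chartEq R r J' ^ t, t, rfl⟩ : Submonoid.powers (chartEq R r J')) := by
  have h2 : chartEq R r J' = chartEq R r J * chartEq R r (J' \ J) := by
    rw [mul_comm]
    exact (Finset.prod_sdiff h).symm
  rw [locRes, LocalizedModule.lift_mk]
  generalize_proofs h4 h5
  rw [Module.End.algebraMap_isUnit_inv_apply_eq_iff]
  simp only [LocalizedModule.mkLinearMap_apply, LocalizedModule.smul'_mk]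
  rw [smul_smul, ← mul_pow, ← h2]
  exact (LocalizedModule.mk_cancel
    (⟨chartEq R r J' ^ t, t, rfl⟩ : Submonoid.powers (chartEq R r J')) a).symm

theorem locCoeff_locRes {J J' : Finset (Chart r)} (h : J ⊆ J') {z : LocMod R r κ J}
    (hz : z ∈ chartSections R r d J) (k : κ) (α : Var r → ℤ) :
    locCoeff J' (locRes R r κ h z) k α = locCoeff J z k α := by
  obtain ⟨t, a, -, rfl⟩ := hz
  rw [locRes_mk, locCoeff_mk, locCoeff_mk, Pi.smul_apply, smul_eq_mul, intCoeff_chartEq_pow_mul]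
  congr 2
  funext s
  have h1 : (chartExp J' s : ℤ) = chartExp (J' \ J) s + chartExp J s := by
    rw [chartExp_apply, chartExp_apply, chartExp_apply, ← Nat.cast_add,
      ← Finset.card_union_of_disjoint
        (Finset.disjoint_filter_filter Finset.sdiff_disjoint), ← Finset.filter_union,
      Finset.sdiff_union_of_subset h]
  rw [h1]
  ring

/-- The coefficients of a section of `M~` on `⋂_{v ∈ J} D(h_v)`. -/
noncomputable def secCoeff (d : κ → Fin m → ℤ) (J : Finset (Chart r)) :
    ChartSec R r d J →ₗ[R] (LaurentExp r d → R) where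
  toFun z x := locCoeff J z.1 x.1.1 x.1.2
  map_add' z w := funext fun _ => locCoeff_add J z.2 w.2 _ _
  map_smul' b z := funext fun _ => locCoeff_smul J z.2 b _ _

theorem secCoeff_chartRes {J J' : Finset (Chart r)} (h : J ⊆ J') (z : ChartSec R r d J) :
    secCoeff d J' (chartRes R r d h z) = secCoeff d J z :=
  funext fun _ => locCoeff_locRes h z.2 _ _

theorem secCoeff_injective (J : Finset (Chart r)) :
    Function.Injective (secCoeff (R := R) d J) := by
  rw [injective_iff_map_eq_zero]
  rintro ⟨_, t, a, ha, rfl⟩ hz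
  apply Subtype.ext
  change LocalizedModule.mk a _ = (0 : LocMod R r κ J)
  have h0 : a = 0 := by
    funext k
    refine ext_intCoeff fun β => ?_
    rw [Pi.zero_apply, map_zero]
    by_contra hβ
    have h1 := isWeightedHomogeneous_iff_intCoeff.mp (ha k) β hβ
    have h2 : ∀ i, ∑ l, (β ⟨i, l⟩ - t * chartExp J ⟨i, l⟩) = -d k i := by
      intro i
      rw [Finset.sum_sub_distrib, h1, ← Finset.mul_sum, sum_chartExp]
      simp
    have h3 : locCoeff J (LocalizedModule.mk a
        (⟨chartEq R r J ^ t, t, rfl⟩ : Submonoid.powers (chartEq R r J))) k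
          (fun s => β s - t * chartExp J s) = 0 :=
      congrFun hz ⟨(k, fun s => β s - t * chartExp J s), h2⟩
    rw [locCoeff_mk] at h3
    simp only [sub_add_cancel] at h3
    exact hβ h3
  rw [h0, LocalizedModule.zero_mk]

/-- Only the variables in the equation of a chart of `J` can have negative exponents. -/
theorem secCoeff_supp (J : Finset (Chart r)) (z : ChartSec R r d J) (x : LaurentExp r d)
    (hx : secCoeff d J z x ≠ 0) (s : Var r) (hs : s ∈ negSupport x) : ∃ v ∈ J, v s.1 = s.2 := by
  obtain ⟨_, t, a, ha, rfl⟩ := z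
  change locCoeff J (LocalizedModule.mk a _) x.1.1 x.1.2 ≠ 0 at hx
  rw [locCoeff_mk] at hx
  have h1 := nonneg_of_intCoeff_ne_zero hx s
  have h2 := (Finset.mem_filter.mp hs).2
  have h3 : chartExp J s ≠ 0 := by
    intro h
    simp only [h, Nat.cast_zero, mul_zero, add_zero] at h1
    omega
  rw [chartExp_apply] at h3
  obtain ⟨v, hv⟩ := Finset.card_ne_zero.mp h3
  exact ⟨v, Finset.mem_filter.mp hv⟩

theorem secCoeff_finite [Finite κ] (J : Finset (Chart r)) (z : ChartSec R r d J) :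
    {x | secCoeff d J z x ≠ 0}.Finite := by
  obtain ⟨_, t, a, ha, rfl⟩ := z
  have hfin : (⋃ k : κ, (fun β : Var r → ℤ => (k, fun s => β s - t * chartExp J s)) ''
      {β | intCoeff β (a k) ≠ 0}).Finite :=
    Set.finite_iUnion fun k => (finite_intCoeff _).image _
  refine (hfin.preimage (f := Subtype.val) Subtype.val_injective.injOn).subset fun x hx => ?_
  change locCoeff J (LocalizedModule.mk a _) x.1.1 x.1.2 ≠ 0 at hx
  rw [locCoeff_mk] at hx
  simp only [Set.mem_preimage, Set.mem_iUnion]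
  refine ⟨x.1.1, _, hx, Prod.ext rfl (funext fun s => ?_)⟩
  simp

/-- Conversely, such families of coefficients become polynomials after multiplication with a power
of the equation. -/
theorem exists_secCoeff_eq (J : Finset (Chart r)) (g : LaurentExp r d → R)
    (hfin : {x | g x ≠ 0}.Finite)
    (hg : ∀ x, g x ≠ 0 → ∀ s ∈ negSupport x, ∃ v ∈ J, v s.1 = s.2) :
    ∃ z : ChartSec R r d J, secCoeff d J z = g := by
  classical
  obtain ⟨t, ht⟩ : ∃ t : ℕ, ∀ x, g x ≠ 0 → ∀ s, -(t : ℤ) ≤ x.1.2 s := by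
    refine ⟨∑ x ∈ hfin.toFinset, ∑ s, (x.1.2 s).natAbs, fun x hx s => ?_⟩
    have h1 : (x.1.2 s).natAbs ≤ ∑ s, (x.1.2 s).natAbs :=
      Finset.single_le_sum (f := fun s => (x.1.2 s).natAbs) (fun _ _ => Nat.zero_le _)
        (Finset.mem_univ s)
    have h2 : ∑ s, (x.1.2 s).natAbs ≤ ∑ x ∈ hfin.toFinset, ∑ s, (x.1.2 s).natAbs :=
      Finset.single_le_sum (f := fun x : LaurentExp r d => ∑ s, (x.1.2 s).natAbs)
        (fun _ _ => Nat.zero_le _) (by simpa using hx)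
    omega
  have hP : ∀ k : κ, ∃ P : CoordRing R r, ∀ β, intCoeff β P =
      if h : ∀ i, ∑ l, (β ⟨i, l⟩ - t * chartExp J ⟨i, l⟩) = -d k i then
        g ⟨(k, fun s => β s - t * chartExp J s), h⟩ else 0 := by
    intro k
    refine exists_intCoeff_eq _ ?_ ?_
    · refine ((hfin.image fun x : LaurentExp r d => fun s =>
        x.1.2 s + t * chartExp J s)).subset fun β hβ => ?_
      by_cases h : ∀ i, ∑ l, (β ⟨i, l⟩ - t * chartExp J ⟨i, l⟩) = -d k i
      · rw [Set.mem_ofPred_eq, dif_pos h] at hβ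
        refine ⟨_, hβ, funext fun s => ?_⟩
        simp
      · exact absurd (dif_neg h) hβ
    · intro β hβ s
      by_cases h : ∀ i, ∑ l, (β ⟨i, l⟩ - t * chartExp J ⟨i, l⟩) = -d k i
      · rw [dif_pos h] at hβ
        have h1 := ht _ hβ s
        dsimp only at h1
        by_contra hs
        have hle : (0 : ℤ) ≤ t * chartExp J s := by positivity
        have h2 : s ∈ negSupport (d := d) ⟨(k, fun s => β s - t * chartExp J s), h⟩ := by
          refine Finset.mem_filter.mpr ⟨Finset.mem_univ _, ?_⟩
          dsimp only
          omega
        obtain ⟨v, hv, hvs⟩ := hg _ hβ s h2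
        have h3 : 1 ≤ chartExp J s :=
          Finset.card_pos.mpr ⟨v, Finset.mem_filter.mpr ⟨hv, hvs⟩⟩
        have h4 : (t : ℤ) * 1 ≤ t * chartExp J s := by
          gcongr
          exact_mod_cast h3
        omega
      · exact absurd (dif_neg h) hβ
  choose P hP using hP
  refine ⟨⟨LocalizedModule.mk P (⟨chartEq R r J ^ t, t, rfl⟩ : Submonoid.powers (chartEq R r J)),
    t, P, fun k => ?_, rfl⟩, funext fun x => ?_⟩
  · refine isWeightedHomogeneous_iff_intCoeff.mpr fun β hβ i => ?_
    rw [hP] at hβ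
    by_cases h : ∀ i, ∑ l, (β ⟨i, l⟩ - t * chartExp J ⟨i, l⟩) = -d k i
    · have h2 := h i
      rw [Finset.sum_sub_distrib, ← Finset.mul_sum, sum_chartExp] at h2
      change _ = t • (J.card : ℤ) - d k i
      rw [nsmul_eq_mul]
      linarith
    · exact absurd (dif_neg h) hβ
  · change locCoeff J (LocalizedModule.mk P _) x.1.1 x.1.2 = _
    rw [locCoeff_mk, hP]
    simp only [add_sub_cancel_right]
    rw [dif_pos x.2]

/-- The signs of the alternating Čech complex. -/
noncomputable def chartSign (r : Fin m → ℕ) : ContractionSign (Chart r) :=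
  ContractionSign.ofOrder (L := Lex (∀ i : Fin m, Fin (r i + 1))) toLex toLex.injective
    (fun _ => 1) fun _ => one_mul 1

theorem isUpperSet_chartFamily (x : LaurentExp r d) :
    IsUpperSet (chartFamily ∅ (negSupport x)) := by
  rintro a b hab ⟨h1, -, h3⟩
  refine ⟨h1.mono hab, by simp, fun s hs => ?_⟩
  obtain ⟨v, hv, hvs⟩ := h3 s hs
  exact ⟨v, hab hv, hvs⟩

/-- A cochain of degree `q` lives on sets of `q + 1` charts, hence the shift by one. -/
theorem hasSplit_chartFamily (x : LaurentExp r d) :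
    HasSplit (chartSign r) (chartFamily ∅ (negSupport x)) (IsCritical x) (critDegree x + 1) := by
  by_cases h : IsCritical x
  · exact (chartFamily_sphere (negSupport x) ∅ (Finset.disjoint_empty_right _)
      (fun i => ⟨0, by simp⟩) (fun i => by simpa using h i)).of_true h
  · have h' := h
    rw [IsCritical] at h'
    push Not at h'
    obtain ⟨i, ⟨a, ha⟩, b, hb⟩ := h'
    exact (chartFamily_acyclic _ ∅ _ _ ha hb (by simp) rfl 0).of_false h _

open scoped Classical in
/-- The coefficients of an alternating Čech cochain as a family of cochains. -/
noncomputable def chartCoeff (d : κ → Fin m → ℤ) (q : ℤ) :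
    ChartCochain R r d q →ₗ[R] (LaurentExp r d → Finset (Chart r) → R) where
  toFun f x J := if h : J.Nonempty ∧ (J.card : ℤ) = q + 1 then secCoeff d J (f ⟨J, h⟩) x else 0
  map_add' f g := by
    funext x J
    by_cases h : J.Nonempty ∧ (J.card : ℤ) = q + 1
    · simp only [Pi.add_apply, dif_pos h]
      exact congrFun (map_add (secCoeff d J) _ _) x
    · simp [h]
  map_smul' b f := by
    funext x J
    by_cases h : J.Nonempty ∧ (J.card : ℤ) = q + 1
    · simp only [Pi.smul_apply, dif_pos h]
      exact congrFun (map_smul (secCoeff d J) b _) x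
    · simp [h]

theorem chartCoeff_apply {q : ℤ} (f : ChartCochain R r d q) (x : LaurentExp r d)
    (J : ChartCell r q) : chartCoeff d q f x J.1 = secCoeff d J.1 (f J) x :=
  dif_pos J.2

theorem chartCoeff_eq_zero {q : ℤ} (f : ChartCochain R r d q) (x : LaurentExp r d)
    {J : Finset (Chart r)} (h : ¬ (J.Nonempty ∧ (J.card : ℤ) = q + 1)) :
    chartCoeff d q f x J = 0 :=
  dif_neg h

theorem chartCoeff_injective (q : ℤ) : Function.Injective (chartCoeff (R := R) (r := r) d q) := by
  intro f g h
  funext J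
  refine secCoeff_injective J.1 (funext fun x => ?_)
  rw [← chartCoeff_apply, ← chartCoeff_apply, h]

theorem chartCoeff_mem [Finite κ] {q : ℤ} (f : ChartCochain R r d q) :
    chartCoeff d q f ∈ cochains R (fun x => chartFamily ∅ (negSupport x)) (q + 1) := by
  constructor
  · refine (Set.finite_iUnion fun J : ChartCell r q => secCoeff_finite J.1 (f J)).subset
      fun x hx => ?_
    obtain ⟨J, hJ⟩ := Function.ne_iff.mp hx
    by_cases h : J.Nonempty ∧ (J.card : ℤ) = q + 1
    · exact Set.mem_iUnion.mpr ⟨⟨J, h⟩, ((chartCoeff_apply f x ⟨J, h⟩).symm.trans_ne hJ :)⟩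
    · exact absurd (chartCoeff_eq_zero f x h) hJ
  · intro x J hJ
    by_cases h : J.Nonempty ∧ (J.card : ℤ) = q + 1
    · refine ⟨⟨h.1, by simp, ?_⟩, h.2⟩
      exact secCoeff_supp J _ x ((chartCoeff_apply f x ⟨J, h⟩).symm.trans_ne hJ)
    · exact absurd (chartCoeff_eq_zero f x h) hJ

theorem exists_chartCoeff_eq {q : ℤ} {f : LaurentExp r d → Finset (Chart r) → R}
    (hf : f ∈ cochains R (fun x => chartFamily ∅ (negSupport x)) (q + 1)) :
    ∃ g : ChartCochain R r d q, chartCoeff d q g = f := by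
  have h : ∀ J : ChartCell r q, ∃ z : ChartSec R r d J.1, secCoeff d J.1 z = fun x => f x J.1 :=
    fun J => exists_secCoeff_eq J.1 _ (hf.1.subset fun x hx h => hx (congrFun h J.1))
      fun x hx => (hf.2 x J.1 hx).1.2.2
  choose g hg using h
  refine ⟨g, funext fun x => funext fun J => ?_⟩
  by_cases hJ : J.Nonempty ∧ (J.card : ℤ) = q + 1
  · exact (chartCoeff_apply g x ⟨J, hJ⟩).trans (congrFun (hg ⟨J, hJ⟩) x)
  · rw [chartCoeff_eq_zero g x hJ]
    by_contra h
    have h1 := hf.2 x J (Ne.symm h)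
    exact hJ ⟨h1.1.1, h1.2⟩

theorem secCoeff_chartD {q q' : ℤ} (hq : q + 1 = q') (f : ChartCochain R r d q)
    (x : LaurentExp r d) (J : ChartCell r q') :
    secCoeff d J.1 (chartD R r d q q' f J) x =
      ∑ v ∈ J.1, ((chartSign r).sign J.1 v : R) * chartCoeff d q f x (J.1.erase v) := by
  classical
  rw [chartD, LinearMap.pi_apply]
  simp only [LinearMap.sum_apply, map_sum, Finset.sum_apply]
  rw [Finset.sum_comm]
  refine Finset.sum_congr rfl fun v hv => ?_
  have hsign : ((chartSign r).sign J.1 v : R) =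
      (-1) ^ (J.1.filter fun w => toLex w < toLex v).card := by
    simp only [chartSign, ContractionSign.ofOrder, one_mul]
    push_cast
    congr!
  by_cases hne : (J.1.erase v).Nonempty
  · have hcard : ((J.1.erase v).card : ℤ) = q + 1 := by
      have h1 := Finset.card_erase_add_one hv
      have h2 := J.2.2
      omega
    obtain ⟨J', hJ'⟩ : ∃ J' : ChartCell r q, J'.1 = J.1.erase v := ⟨⟨_, hne, hcard⟩, rfl⟩
    rw [Finset.sum_eq_single J']
    · have h : J'.1 = J.1.erase v := hJ'
      rw [dif_pos (by convert h), hsign, LinearMap.smul_apply, map_smul, Pi.smul_apply,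
        smul_eq_mul, LinearMap.comp_apply, secCoeff_chartRes, LinearMap.proj_apply,
        ← chartCoeff_apply, ← hJ']
    · intro J'' _ hJ
      rw [dif_neg fun h => hJ (Subtype.ext (Eq.trans (by convert h) hJ'.symm))]
      simp
    · simp
  · rw [chartCoeff_eq_zero f x fun h => hne h.1, mul_zero]
    refine Finset.sum_eq_zero fun J' _ => ?_
    rw [dif_neg fun h => hne (Eq.subst (motive := Finset.Nonempty)
      (show J'.1 = J.1.erase v by convert h) J'.2.1)]
    simp

theorem chartCoeff_chartD {q q' : ℤ} (hq : q + 1 = q') (f : ChartCochain R r d q) :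
    chartCoeff d q' (chartD R r d q q' f) = bigD R _ (chartSign r) (chartCoeff d q f) := by
  funext x F
  rw [bigD_apply_apply]
  by_cases hF : F.Nonempty ∧ (F.card : ℤ) = q' + 1
  · exact (chartCoeff_apply _ _ (⟨F, hF⟩ : ChartCell r q')).trans
      (secCoeff_chartD hq f x (⟨F, hF⟩ : ChartCell r q'))
  · rw [chartCoeff_eq_zero _ x hF, Finset.sum_eq_zero]
    intro v hv
    rw [chartCoeff_eq_zero, mul_zero]
    rintro ⟨-, h⟩
    have h1 := Finset.card_erase_add_one hv
    exact hF ⟨⟨v, hv⟩, by omega⟩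

end Charts

/-! ### Split complexes of modules -/

section Splitting

variable {R A M C Q : Type*} [CommRing R]

/-- The cocycles of a complex `A → M → C` are the direct sum of `Q` and of the coboundaries if
`U : Q → M` maps to the cocycles and has a left inverse `T` that kills exactly the coboundaries
among the cocycles. The subtractions take place in `Q`, since the direct limit of the strands
carries only the structure of an additive monoid. -/
noncomputable def kerEquivOfSplitting [AddCommMonoid A] [Module R A] [AddCommMonoid M] [Module R M]
    [AddCommMonoid C] [Module R C] [AddCommGroup Q] [Module R Q]
    {f : A →ₗ[R] M} {g : M →ₗ[R] C} {U : Q →ₗ[R] M} {T : M →ₗ[R] Q}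
    (hgU : ∀ q, g (U q) = 0) (hgf : ∀ a, g (f a) = 0)
    (hTU : ∀ q, T (U q) = q) (hTf : ∀ a, T (f a) = 0)
    (hex : ∀ z, g z = 0 → T z = 0 → ∃ a, f a = z) :
    (Q × LinearMap.range f) ≃ₗ[R] LinearMap.ker g :=
  LinearEquiv.ofBijective
    ((LinearMap.coprod U (LinearMap.range f).subtype).codRestrict (LinearMap.ker g) (by
      rintro ⟨q, _, a, rfl⟩
      simp [hgU, hgf]))
    ⟨by
      rintro ⟨q, _, a, rfl⟩ ⟨q', _, a', rfl⟩ h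
      have h1 : U q + f a = U q' + f a' := congrArg Subtype.val h
      obtain rfl : q = q' := by
        have := congrArg T h1
        rwa [map_add, hTU, hTf, add_zero, map_add, hTU, hTf, add_zero] at this
      have h2 := congrArg (U (-q) + ·) h1
      simp only [← add_assoc, ← map_add, neg_add_cancel, map_zero, zero_add] at h2
      exact Prod.ext rfl (Subtype.ext h2), by
      rintro ⟨z, hz⟩
      obtain ⟨a, ha⟩ := hex (z + U (-T z)) (by rw [map_add, hgU, add_zero]; exact hz)
        (by rw [map_add, hTU, add_neg_cancel])
      refine ⟨(T z, ⟨f a, a, rfl⟩), Subtype.ext ?_⟩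
      change U (T z) + f a = z
      rw [ha, add_left_comm, ← map_add, add_neg_cancel, map_zero, add_zero]⟩

/-- In the situation of `kerEquivOfSplitting`, the cohomology of the complex is `Q`. -/
noncomputable def cohomologyEquivOfSplitting [AddCommMonoid A] [Module R A] [AddCommGroup M]
    [Module R M] [AddCommGroup C] [Module R C] [AddCommGroup Q] [Module R Q]
    {f : A →ₗ[R] M} {g : M →ₗ[R] C} {U : Q →ₗ[R] M} {T : M →ₗ[R] Q} (hgU : ∀ q, g (U q) = 0)
    (hTU : ∀ q, T (U q) = q) (hTf : ∀ a, T (f a) = 0)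
    (hex : ∀ z, g z = 0 → T z = 0 → ∃ a, f a = z) :
    Q ≃ₗ[R] (LinearMap.ker g ⧸ (LinearMap.range f).submoduleOf (LinearMap.ker g)) :=
  LinearEquiv.ofBijective
    ((Submodule.mkQ _).comp (U.codRestrict (LinearMap.ker g) hgU))
    ⟨by
      rw [injective_iff_map_eq_zero]
      intro q h
      obtain ⟨a, ha⟩ := (Submodule.Quotient.mk_eq_zero _).mp h
      replace ha : f a = U q := ha
      rw [← hTU q, ← ha, hTf], by
      intro y
      obtain ⟨⟨z, hz⟩, rfl⟩ := Submodule.mkQ_surjective _ y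
      refine ⟨T z, (Submodule.Quotient.eq _).mpr ?_⟩
      obtain ⟨a, ha⟩ := hex (U (T z) - z) (by rw [map_sub, hgU, zero_sub, neg_eq_zero]; exact hz)
        (by rw [map_sub, hTU, sub_self])
      exact ⟨a, ha⟩⟩

variable [AddCommMonoid A] [Module R A] [AddCommMonoid M] [Module R M] [AddCommMonoid C]
  [Module R C] {f : A →ₗ[R] M} {g : M →ₗ[R] C}
  {X V : Type} [Fintype V] [DecidableEq V] {ε : ContractionSign V}
  {W : X → Set (Finset V)} {p : X → Prop} {k : X → ℕ}

/-- The splitting of `exists_cohomology_splitting`, carried over to a complex of modules that is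
identified with the complex of cochains. -/
theorem exists_splitting_of_equiv_cochains (hW : ∀ x, IsUpperSet (W x))
    (hs : ∀ x, HasSplit ε (W x) (p x) (k x)) {n' n : ℤ} (hn : n' + 1 = n)
    [Finite {x // p x ∧ (k x : ℤ) = n}]
    (a : A →ₗ[R] (X → Finset V → R)) (b : M →ₗ[R] (X → Finset V → R))
    (c : C →ₗ[R] (X → Finset V → R)) (hb : Function.Injective b) (hc : Function.Injective c)
    (ham : ∀ z, a z ∈ cochains R W n') (hbm : ∀ z, b z ∈ cochains R W n)
    (has : ∀ y ∈ cochains R W n', ∃ z, a z = y) (hbs : ∀ y ∈ cochains R W n, ∃ z, b z = y)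
    (hf : ∀ z, b (f z) = bigD R X ε (a z)) (hg : ∀ z, c (g z) = bigD R X ε (b z)) :
    ∃ (U : ({x // p x ∧ (k x : ℤ) = n} → R) →ₗ[R] M)
      (T : M →ₗ[R] ({x // p x ∧ (k x : ℤ) = n} → R)),
      (∀ q, g (U q) = 0) ∧ (∀ q, T (U q) = q) ∧ (∀ z, T (f z) = 0) ∧
      (∀ z, g z = 0 → T z = 0 → ∃ y, f y = z) ∧ ∀ q x, b (U q) x ≠ 0 → p x := by
  obtain ⟨U, T, hU, hUp, hdU, hTU, hTd, hex⟩ := exists_cohomology_splitting (R := R) hW hs n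
  let β := LinearEquiv.ofInjective b hb
  let U' := β.symm.toLinearMap ∘ₗ U.codRestrict (LinearMap.range b) fun q => hbs _ (hU q)
  have hbU : ∀ q, b (U' q) = U q := fun q =>
    congrArg Subtype.val (β.apply_symm_apply ⟨U q, hbs _ (hU q)⟩)
  refine ⟨U', T ∘ₗ b, fun q => hc ?_, fun q => ?_, fun z => ?_, fun z hz hTz => ?_,
    fun q x hx => ?_⟩
  · rw [hg, hbU, hdU, map_zero]
  · rw [LinearMap.comp_apply, hbU, hTU]
  · rw [LinearMap.comp_apply, hf, hTd n' hn _ (ham z)]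
  · obtain ⟨y, hy, hyz⟩ := hex n' hn _ (hbm z) (by rw [← hg, hz, map_zero]) hTz
    obtain ⟨y, rfl⟩ := has y hy
    exact ⟨y, hb (by rw [hf, hyz])⟩
  · rw [hbU] at hx
    exact (hUp q x hx).1.1

end Splitting

/-! ### Critical Laurent monomials -/

section Critical

variable {m : ℕ} {r : Fin m → ℕ} {κ : Type} {d : κ → Fin m → ℤ}

/-- The sum of the exponents in a block, which have the same sign, is prescribed by the degree. -/
theorem IsCritical.abs_le {x : LaurentExp r d} (hx : IsCritical x) (s : Var r) :
    |x.1.2 s| ≤ |d x.1.1 s.1| := by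
  obtain ⟨i, a⟩ := s
  have hsum := x.2 i
  rcases hx i with h | h
  · have h0 : ∀ l, 0 ≤ x.1.2 ⟨i, l⟩ := fun l => by
      have := h l
      simpa [negSupport] using this
    have h1 : x.1.2 ⟨i, a⟩ ≤ ∑ l, x.1.2 ⟨i, l⟩ :=
      Finset.single_le_sum (f := fun l => x.1.2 ⟨i, l⟩) (fun l _ => h0 l) (Finset.mem_univ a)
    rw [abs_of_nonneg (h0 a), ← abs_neg, ← hsum]
    exact h1.trans (le_abs_self _)
  · have h0 : ∀ l, x.1.2 ⟨i, l⟩ < 0 := fun l => (Finset.mem_filter.mp (h l)).2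
    have h1 : -x.1.2 ⟨i, a⟩ ≤ ∑ l, -x.1.2 ⟨i, l⟩ :=
      Finset.single_le_sum (f := fun l => -x.1.2 ⟨i, l⟩)
        (fun l _ => (neg_pos.mpr (h0 l)).le) (Finset.mem_univ a)
    rw [Finset.sum_neg_distrib, hsum, neg_neg] at h1
    rw [abs_of_neg (h0 a)]
    exact h1.trans (le_abs_self _)

theorem finite_isCritical [Finite κ] : {x : LaurentExp r d | IsCritical x}.Finite := by
  have h : (⋃ k : κ, Prod.mk k ''
      Set.Icc (fun s : Var r => -|d k s.1|) (fun s => |d k s.1|)).Finite :=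
    Set.finite_iUnion fun k => (Set.finite_Icc _ _).image _
  refine (h.preimage (f := Subtype.val) Subtype.val_injective.injOn).subset fun x hx => ?_
  refine Set.mem_iUnion.mpr ⟨x.1.1, x.1.2, ⟨fun s => ?_, fun s => ?_⟩, rfl⟩
  · exact (abs_le.mp (hx.abs_le s)).1
  · exact (abs_le.mp (hx.abs_le s)).2

instance finite_isCritical_and [Finite κ] (q : LaurentExp r d → Prop) :
    Finite {x : LaurentExp r d // IsCritical x ∧ q x} :=
  (finite_isCritical.subset fun _ h => h.1 : {x : LaurentExp r d | IsCritical x ∧ q x}.Finite)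

end Critical

/-! ### Exponent bounds -/

section Bounds

variable {R : Type*} [CommRing R] {m : ℕ} {r : Fin m → ℕ} {δ : Fin m → ℤ}

/-- The exponent vector `e` is at least the pole order of every critical Laurent monomial of
degree `-δ`. -/
def BoundsPoles (r : Fin m → ℕ) (δ : Fin m → ℤ) (e : Fin m → ℕ) : Prop :=
  ∀ x : LaurentExp r (fun _ : Unit => δ), IsCritical x → ∀ s, -(e s.1 : ℤ) ≤ x.1.2 s

/-- The homotopy contracts the summands at the Laurent monomials that do not occur in level `e`;
these are not critical. -/
theorem BoundsPoles.isExponentBound {e₀ : Fin m → ℕ} (h : BoundsPoles r δ e₀) :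
    IsExponentBound R r δ e₀ := by
  classical
  intro e e' he hee
  obtain ⟨K, hK, hK0, hKd⟩ := exists_contraction (R := R)
    (isUpperSet_cellFamily (r := r) (d := fun _ : Unit => δ)) hasSplit_cellFamily
  -- the complement of `ι ∘ π`
  let mask : (LaurentExp r (fun _ : Unit => δ) → Finset (Var r) → R) →ₗ[R]
      (LaurentExp r (fun _ : Unit => δ) → Finset (Var r) → R) :=
    { toFun := fun f x => if ∀ s, -(e s.1 : ℤ) ≤ x.1.2 s then 0 else f x
      map_add' := fun f g => funext fun x => by
        by_cases hx : ∀ s, -(e s.1 : ℤ) ≤ x.1.2 s <;> simp [hx]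
      map_smul' := fun a f => funext fun x => by
        by_cases hx : ∀ s, -(e s.1 : ℤ) ≤ x.1.2 s <;> simp [hx] }
  have hmask : ∀ f x, mask f x = if ∀ s, -(e s.1 : ℤ) ≤ x.1.2 s then 0 else f x :=
    fun _ _ => rfl
  have hmask_ne : ∀ f x, mask f x ≠ 0 → f x ≠ 0 ∧ ¬ ∀ s, -(e s.1 : ℤ) ≤ x.1.2 s := by
    intro f x hx
    rw [hmask] at hx
    split_ifs at hx with hx'
    · exact absurd rfl hx
    · exact ⟨hx, hx'⟩
  have hmask_mem : ∀ n, ∀ f ∈ cochains R cellFamily n, mask f ∈ cochains R cellFamily n :=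
    fun n f hf => ⟨hf.1.subset fun x hx => (hmask_ne f x hx).1, fun x c hc => hf.2 x c fun h0 => by
      rw [hmask] at hc
      split_ifs at hc
      · exact hc rfl
      · exact hc h0⟩
  have hmask_d : ∀ f, mask (bigD R _ (cellSign r) f) = bigD R _ (cellSign r) (mask f) := by
    intro f
    funext x
    rw [hmask, bigD_apply, bigD_apply, hmask]
    split_ifs
    · rw [map_zero]
    · rfl
  have hL : ∀ i i' : ℤ, ∃ L : homZero R r (fun _ : Unit => δ) e' i →ₗ[R]
      homZero R r (fun _ : Unit => δ) e' i', i' + 1 = i → ∀ φ,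
        homCoeff _ e' i' (L φ) = K (mask (homCoeff _ e' i φ)) := by
    intro i i'
    by_cases hi : i' + 1 = i
    · have hmem : ∀ φ : homZero R r (fun _ : Unit => δ) e' i,
          K (mask (homCoeff _ e' i φ)) ∈
            LinearMap.range (homCoeff (R := R) (r := r) (fun _ : Unit => δ) e' i') := by
        intro φ
        refine exists_homCoeff_eq e' i' (hK _ _ (by omega) _
          (hmask_mem _ _ (homCoeff_mem e' i φ))) fun x hx s => ?_
        obtain ⟨F, hF⟩ := Function.ne_iff.mp
          (hmask_ne _ x fun h0 => hx (hK0 _ x h0)).1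
        exact neg_le_of_homCoeff_ne_zero hF s
      let β := LinearEquiv.ofInjective _
        (homCoeff_injective (R := R) (r := r) (d := fun _ : Unit => δ) e' i')
      refine ⟨β.symm.toLinearMap ∘ₗ
        (K ∘ₗ mask ∘ₗ homCoeff _ e' i).codRestrict _ hmem, fun _ φ => ?_⟩
      exact congrArg Subtype.val (β.apply_symm_apply ⟨_, hmem φ⟩)
    · exact ⟨0, fun h => absurd h hi⟩
  choose L hL using hL
  refine ⟨L, fun j φ => homCoeff_injective e' j ?_⟩
  rw [homCoeff_sub, map_add, hL (j + 1) j rfl, homCoeff_homIncl, homCoeff_homD e' rfl, hmask_d,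
    homCoeff_homD e' (sub_add_cancel j 1), hL j (j - 1) (sub_add_cancel j 1)]
  refine Eq.trans ?_ (hKd _ _ (hmask_mem _ _ (homCoeff_mem e' j φ)) fun x hx hcrit =>
    (hmask_ne _ x hx).2 fun s => le_trans ?_ (h x hcrit s))
  · funext x
    rw [Pi.sub_apply, homCoeff_homProj, hmask]
    split_ifs
    · exact sub_self _
    · exact sub_zero _
  · have h1 : e₀ s.1 ≤ e s.1 := he s.1
    omega

/-- A critical Laurent monomial that does not occur in level `e` gives a cocycle in higher levels
which `ι ∘ π` maps to zero although it is not a coboundary. -/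
theorem IsExponentBound.boundsPoles [Nontrivial R] {e : Fin m → ℕ}
    (h : IsExponentBound R r δ e) : BoundsPoles r δ e := by
  classical
  intro x hx
  by_contra hxe
  -- a level in which `x` occurs
  let e' : Fin m → ℕ := fun i => e i + ∑ s, (x.1.2 s).natAbs
  have hee : e ≤ e' := fun i => Nat.le_add_right _ _
  obtain ⟨K, hK⟩ := h e e' le_rfl hee
  obtain ⟨U, T, hU, hUp, hdU, hTU, hTd, -⟩ := exists_cohomology_splitting (R := R)
    (isUpperSet_cellFamily (r := r) (d := fun _ : Unit => δ)) hasSplit_cellFamily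
    ((critDegree x : ℤ) + m)
  let x' : {y : LaurentExp r (fun _ : Unit => δ) // IsCritical y ∧
    ((critDegree y + m : ℕ) : ℤ) = (critDegree x : ℤ) + m} := ⟨x, hx, Nat.cast_add _ _⟩
  have hsupp : ∀ y, U (Pi.single x' 1) y ≠ 0 → y = x := by
    intro y hy
    obtain ⟨hy, hne⟩ := hUp _ y hy
    by_contra hyx
    exact hne (Pi.single_eq_of_ne (fun hh => hyx (congrArg Subtype.val hh)) _)
  obtain ⟨φ, hφ⟩ := exists_homCoeff_eq e' _ (hU (Pi.single x' 1)) fun y hy s => by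
    rw [hsupp y hy]
    have h1 : (x.1.2 s).natAbs ≤ ∑ s, (x.1.2 s).natAbs :=
      Finset.single_le_sum (f := fun s => (x.1.2 s).natAbs) (fun _ _ => Nat.zero_le _)
        (Finset.mem_univ s)
    dsimp only [e']
    omega
  have hdφ : homD R r (fun _ : Unit => δ) e' (critDegree x) (critDegree x + 1) φ = 0 :=
    homCoeff_injective e' _ (by rw [homCoeff_homD e' rfl, hφ, hdU, map_zero])
  have hπφ : homProj R r (fun _ : Unit => δ) (critDegree x) e e' hee φ = 0 := by
    refine homCoeff_injective e _ (funext fun y => ?_)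
    rw [homCoeff_homProj, map_zero, Pi.zero_apply, hφ]
    split_ifs with hy
    · by_contra hne
      rw [hsupp y hne] at hy
      exact hxe hy
    · rfl
  have h1 := congrArg (homCoeff _ e' _) (hK (critDegree x) φ)
  rw [hdφ, hπφ, homCoeff_sub, map_add, map_zero, map_zero, map_zero, sub_zero, map_zero,
    zero_add, hφ,    homCoeff_homD e' (sub_add_cancel _ 1)] at h1
  have h2 := hTU (Pi.single x' 1)
  rw [h1, hTd _ (by omega) _ (homCoeff_mem e' _ _)] at h2
  have h3 := congrFun h2 x'
  rw [Pi.single_eq_same] at h3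
  exact zero_ne_one h3

/-- The conditions on the components of an exponent vector are independent of each other, so that
there is a least vector. -/
theorem exists_isLeast_boundsPoles (r : Fin m → ℕ) (δ : Fin m → ℤ) :
    ∃ e, IsLeast {e | BoundsPoles r δ e} e := by
  let B : Fin m → Set ℕ := fun i => {n | ∀ x : LaurentExp r (fun _ : Unit => δ),
    IsCritical x → ∀ a, -(n : ℤ) ≤ x.1.2 ⟨i, a⟩}
  have hB : ∀ i, (B i).Nonempty := fun i => ⟨(δ i).natAbs, fun x hx a => by
    have := (abs_le.mp (hx.abs_le ⟨i, a⟩)).1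
    rw [Int.natCast_natAbs]
    exact this⟩
  exact ⟨fun i => sInf (B i), fun x hx s => Nat.sInf_mem (hB s.1) x hx s.2,
    fun e he i => Nat.sInf_le fun x hx a => he x hx ⟨i, a⟩⟩

theorem exists_isMinimalExponentVector (R : Type*) [CommRing R] (r : Fin m → ℕ)
    (δ : Fin m → ℤ) : ∃ e, IsMinimalExponentVector R r δ e := by
  cases subsingleton_or_nontrivial R
  -- over the zero ring all homotopies exist
  · refine ⟨0, fun e e' _ hee => ⟨fun _ _ => 0, fun j φ => ?_⟩, fun _ _ _ => Nat.zero_le _⟩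
    have := Module.subsingleton R (homZero R r (fun _ : Unit => δ) e' j)
    exact Subsingleton.elim _ _
  · obtain ⟨e, he, hle⟩ := exists_isLeast_boundsPoles r δ
    exact ⟨e, he.isExponentBound, fun e' he' => hle he'.boundsPoles⟩

end Bounds

/-! ### The limit of the truncated complexes -/

section Limit

variable {R : Type*} [CommRing R] {m : ℕ} {r : Fin m → ℕ} {κ : Type} {d : κ → Fin m → ℤ}

/-- The coefficients of an element of the Čech complex as a family of cochains. -/
noncomputable def limCoeff (d : κ → Fin m → ℤ) (j : ℤ) :
    CechLim R r d j →ₗ[R] (LaurentExp r d → Finset (Var r) → R) :=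
  Module.DirectLimit.lift R (Fin m → ℕ) (fun e : Fin m → ℕ => homZero R r d e j)
    (homIncl R r d j) (fun e => homCoeff d e j) fun e e' h φ => homCoeff_homIncl e e' h j φ

theorem limCoeff_toCechLim (e : Fin m → ℕ) (j : ℤ) (φ : homZero R r d e j) :
    limCoeff d j (toCechLim R r d e j φ) = homCoeff d e j φ :=
  Module.DirectLimit.lift_of _ _ _

theorem limCoeff_injective (j : ℤ) : Function.Injective (limCoeff (R := R) (r := r) d j) :=
  Module.DirectLimit.lift_injective _ _ fun e => homCoeff_injective e j

theorem exists_toCechLim_eq {j : ℤ} (z : CechLim R r d j) :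
    ∃ e φ, toCechLim R r d e j φ = z :=
  Module.DirectLimit.exists_of z

theorem limCoeff_mem [Finite κ] {j : ℤ} (z : CechLim R r d j) :
    limCoeff d j z ∈ cochains R cellFamily (j + m) := by
  obtain ⟨e, φ, rfl⟩ := exists_toCechLim_eq z
  rw [limCoeff_toCechLim]
  exact homCoeff_mem e j φ

theorem exists_limCoeff_eq {j : ℤ} {f : LaurentExp r d → Finset (Var r) → R}
    (hf : f ∈ cochains R cellFamily (j + m)) : ∃ z : CechLim R r d j, limCoeff d j z = f := by
  obtain ⟨φ, hφ⟩ := exists_homCoeff_eq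
    (fun _ => ∑ x ∈ hf.1.toFinset, ∑ s, (x.1.2 s).natAbs) j hf fun x hx s => by
      have h1 : (x.1.2 s).natAbs ≤ ∑ s, (x.1.2 s).natAbs :=
        Finset.single_le_sum (f := fun s => (x.1.2 s).natAbs) (fun _ _ => Nat.zero_le _)
          (Finset.mem_univ s)
      have h2 : ∑ s, (x.1.2 s).natAbs ≤ ∑ x ∈ hf.1.toFinset, ∑ s, (x.1.2 s).natAbs :=
        Finset.single_le_sum (f := fun x : LaurentExp r d => ∑ s, (x.1.2 s).natAbs)
          (fun _ _ => Nat.zero_le _) (by simpa using hx)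
      omega
  exact ⟨toCechLim R r d _ j φ, (limCoeff_toCechLim _ _ _).trans hφ⟩

theorem limCoeff_cechLimD {j j' : ℤ} (hj : j + 1 = j') (z : CechLim R r d j) :
    limCoeff d j' (cechLimD R r d j j' z) = bigD R _ (cellSign r) (limCoeff d j z) := by
  obtain ⟨e, φ, rfl⟩ := exists_toCechLim_eq z
  have h : cechLimD R r d j j' (toCechLim R r d e j φ) =
      toCechLim R r d e j' (homD R r d e j j' φ) := Module.DirectLimit.map_apply_of _ _ _
  rw [h, limCoeff_toCechLim, limCoeff_toCechLim, homCoeff_homD e hj]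

theorem free_range_cechLimD [Finite κ] {j j' : ℤ} (hj : j + 1 = j') :
    Module.Free R (LinearMap.range (cechLimD R r d j j')) := by
  have h : (LinearMap.range (cechLimD R r d j j')).map (limCoeff d j') =
      (cochains R cellFamily (j + m)).map (bigD R (LaurentExp r d) (cellSign r)) := by
    ext f
    constructor
    · rintro ⟨_, ⟨z, rfl⟩, rfl⟩
      exact ⟨_, limCoeff_mem z, (limCoeff_cechLimD hj z).symm⟩
    · rintro ⟨y, hy, rfl⟩
      obtain ⟨z, rfl⟩ := exists_limCoeff_eq hy
      exact ⟨_, ⟨z, rfl⟩, limCoeff_cechLimD hj z⟩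
  have h1 := free_map_bigD (R := R) (isUpperSet_cellFamily (r := r) (d := d)) hasSplit_cellFamily
    (show (j + m : ℤ) + 1 = j' + m by omega)
  rw [← h] at h1
  exact Module.Free.of_equiv
    (Submodule.equivMapOfInjective _ (limCoeff_injective j') _).symm

theorem cechLimD_cechLimD {j j' j'' : ℤ} (hj : j + 1 = j') (hj' : j' + 1 = j'')
    (z : CechLim R r d j) : cechLimD R r d j' j'' (cechLimD R r d j j' z) = 0 := by
  refine limCoeff_injective _ ?_
  rw [limCoeff_cechLimD hj', limCoeff_cechLimD hj, bigD_bigD, map_zero]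

theorem exists_splitting_cechLim [Finite κ] {i j j' : ℤ} (hi : i + 1 = j) (hj : j + 1 = j') :
    ∃ (U : ({x : LaurentExp r d // IsCritical x ∧ ((critDegree x + m : ℕ) : ℤ) = j + m} → R) →ₗ[R]
        CechLim R r d j)
      (T : CechLim R r d j →ₗ[R]
        ({x : LaurentExp r d // IsCritical x ∧ ((critDegree x + m : ℕ) : ℤ) = j + m} → R)),
      (∀ q, cechLimD R r d j j' (U q) = 0) ∧ (∀ q, T (U q) = q) ∧
      (∀ z, T (cechLimD R r d i j z) = 0) ∧
      (∀ z, cechLimD R r d j j' z = 0 → T z = 0 → ∃ y, cechLimD R r d i j y = z) ∧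
      ∀ q x, limCoeff d j (U q) x ≠ 0 → IsCritical x :=
  exists_splitting_of_equiv_cochains isUpperSet_cellFamily hasSplit_cellFamily
    (n' := i + m) (n := j + m) (by omega) (limCoeff d i) (limCoeff d j) (limCoeff d j')
    (limCoeff_injective _) (limCoeff_injective _) limCoeff_mem limCoeff_mem
    (fun _ => exists_limCoeff_eq) (fun _ => exists_limCoeff_eq)
    (limCoeff_cechLimD hi) (limCoeff_cechLimD hj)

theorem exists_splitting_chartCochain [Finite κ] {i j j' : ℤ} (hi : i + 1 = j)
    (hj : j + 1 = j') :
    ∃ (U : ({x : LaurentExp r d // IsCritical x ∧ ((critDegree x + 1 : ℕ) : ℤ) = j + 1} → R) →ₗ[R]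
        ChartCochain R r d j)
      (T : ChartCochain R r d j →ₗ[R]
        ({x : LaurentExp r d // IsCritical x ∧ ((critDegree x + 1 : ℕ) : ℤ) = j + 1} → R)),
      (∀ q, chartD R r d j j' (U q) = 0) ∧ (∀ q, T (U q) = q) ∧
      (∀ z, T (chartD R r d i j z) = 0) ∧
      ∀ z, chartD R r d j j' z = 0 → T z = 0 → ∃ y, chartD R r d i j y = z := by
  obtain ⟨U, T, h1, h2, h3, h4, -⟩ := exists_splitting_of_equiv_cochains (R := R)
    isUpperSet_chartFamily hasSplit_chartFamily
    (n' := i + 1) (n := j + 1) (by omega) (chartCoeff d i) (chartCoeff d j) (chartCoeff d j')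
    (chartCoeff_injective _) (chartCoeff_injective _) chartCoeff_mem chartCoeff_mem
    (fun _ => exists_chartCoeff_eq) (fun _ => exists_chartCoeff_eq)
    (chartCoeff_chartD hi) (chartCoeff_chartD hj)
  exact ⟨U, T, h1, h2, h3, h4⟩

end Limit

end MultiProj

theorem mainTheorem3 {R : Type*} [CommRing R] [IsNoetherianRing R] {m : ℕ} (r : Fin m → ℕ)
    {b : ℕ} (d : Fin b → Fin m → ℤ) (j : ℤ) :
    Module.Free R (HigherDirectImage R r d j) ∧
    Module.Finite R (HigherDirectImage R r d j) ∧
    Module.Free R (LinearMap.range (cechLimD R r d (j - 1) j)) ∧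
    ∃ e : Fin b → Fin m → ℕ,
      (∀ k, IsMinimalExponentVector R r (d k) (e k)) ∧
      ∃ Φ : (HigherDirectImage R r d j × LinearMap.range (cechLimD R r d (j - 1) j)) ≃ₗ[R]
          LinearMap.ker (cechLimD R r d j (j + 1)),
        (∀ y, (Φ (0, y) : CechLim R r d j) = y) ∧
        ∀ x, (Φ (x, 0) : CechLim R r d j) ∈
          LinearMap.range (toCechLim R r d (Finset.univ.sup e) j) := by
  have hj : j - 1 + 1 = j := sub_add_cancel j 1
  obtain ⟨Uc, Tc, hgUc, hTUc, hTfc, hexc⟩ :=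
    exists_splitting_chartCochain (R := R) (r := r) (d := d) hj rfl
  obtain ⟨U, T, hgU, hTU, hTf, hex, hsupp⟩ :=
    exists_splitting_cechLim (R := R) (r := r) (d := d) hj rfl
  let θ := cohomologyEquivOfSplitting hgUc hTUc hTfc hexc
  let σ : ({x : LaurentExp r d // IsCritical x ∧ ((critDegree x + 1 : ℕ) : ℤ) = j + 1} → R) ≃ₗ[R]
      ({x : LaurentExp r d // IsCritical x ∧ ((critDegree x + m : ℕ) : ℤ) = j + m} → R) :=
    LinearEquiv.funCongrLeft R R (Equiv.subtypeEquivRight fun x =>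
      and_congr_right fun _ => by push_cast; omega)
  refine ⟨Module.Free.of_equiv θ, Module.Finite.equiv θ, free_range_cechLimD hj, ?_⟩
  choose e he using fun k => exists_isMinimalExponentVector R r (d k)
  refine ⟨e, he, (LinearEquiv.prodCongr (θ.symm.trans σ) (LinearEquiv.refl R _)).trans
    (kerEquivOfSplitting hgU (cechLimD_cechLimD hj rfl) hTU hTf hex), fun y => ?_, fun x => ?_⟩
  · change U (σ (θ.symm 0)) + y.1 = y.1
    rw [map_zero, map_zero, map_zero, zero_add]
  · change U (σ (θ.symm x)) + 0 ∈ _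
    rw [add_zero]
    generalize σ (θ.symm x) = q
    cases subsingleton_or_nontrivial R
    · have := Module.subsingleton R (CechLim R r d j)
      rw [Subsingleton.elim (U q) 0]
      exact Submodule.zero_mem _
    -- the representatives of the cohomology only involve critical Laurent monomials
    · obtain ⟨φ, hφ⟩ := exists_homCoeff_eq (Finset.univ.sup e) j (limCoeff_mem (U q))
        fun x hx s => by
          have h1 := (he x.1.1).1.boundsPoles ⟨((), x.1.2), x.2⟩ (hsupp q x hx) s
          have h2 : e x.1.1 s.1 ≤ Finset.univ.sup e s.1 :=
            Finset.le_sup (f := e) (Finset.mem_univ x.1.1) s.1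
          dsimp only at h1
          omega
      exact ⟨φ, limCoeff_injective j ((limCoeff_toCechLim _ _ _).trans hφ)⟩
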